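/- Let $G$ be a group (for instance a finite group or a compact Lie group), let $U$ be a unitary representation of $G$ on a finite-dimensional complex Hilbert space $\mathcal H$, and let $$\mathcal H=\bigoplus_{\lambda\in\Lambda}\mathcal Q_\lambda\otimes\mathcal M_\lambda$$ be its isotypic decomposition: $\Lambda$ is a finite set of pairwise inequivalent irreducible unitary representations of $G$, $\mathcal Q_\lambda$ carries the irrep $\lambda$, the multiplicity spaces $\mathcal M_\lambda\neq 0$ are Hilbert spaces, and $U(g)$ acts as $\bigoplus_\lambda \lambda(g)\otimes\mathbb I$. Let $\mathcal V^G$ be the group of unitaries on $\mathcal H$ that commute with $U(g)$ for all $g\in G$. By Schur's lemma every $V\in\mathcal V^G$ has a unique expression $V=\bigoplus_\lambda \mathbb I_{\mathcal Q_\lambda}\otimes\pi_\lambda(V)$ with $\pi_\lambda(V)\in\mathrm U(\mathcal M_\lambda)$, which defines homomorphisms $\pi_\lambda:\mathcal V^G\to\mathrm U(\mathcal M_\lambda)$. Let $\mathcal T\subseteq\mathcal V^G$ be a subgroup such that for every $\lambda\in\Lambda$ $$\mathrm{SU}(\mathcal M_\lambda)\subseteq\pi_\lambda(\mathcal T)=\{\pi_\lambda(V):V\in\mathcal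 T\}.$$ Then $\Lambda$ can be partitioned into disjoint nonempty subsets $\Delta_1,\dots,\Delta_s$ such that: 1. for each $r$, all $\lambda\in\Delta_r$ have the same multiplicity dimension $\dim\mathcal M_\lambda=:m_r$; 2. the commutator subgroup of $\mathcal T$ is isomorphic, as a topological group, to a product of special unitary groups, $$[\mathcal T,\mathcal T]\cong\prod_{r=1}^s\mathrm{SU}(m_r);$$ 3. for every $r$, every pair $\lambda,\lambda'\in\Delta_r$ and every choice of orthonormal bases of $\mathcal M_\lambda$ and $\mathcal M_{\lambda'}$, there is a matrix $W\in\mathrm{SU}(m_r)$ such that either $$[\pi_{\lambda'}(V)]=W\,[\pi_\lambda(V)]\,W^\dagger\quad\text{for all }V\in[\mathcal T,\mathcal T],$$ or $$[\pi_{\lambda'}(V)]=W\,[\pi_\lambda(V)]^{*}\,W^\dagger\quad\text{for all }V\in[\mathcal T,\mathcal T],$$ where $[\,\cdot\,]$ denotes the matrix in the chosen bases and $^{*}$ the entrywise complex conjugate. -/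

import Mathlib

open scoped TensorProduct
noncomputable section

/-- The complex linear representation underlying a unitary representation. -/
def unitaryRepresentation {G : Type*} [Group G] {E : Type*} [NormedAddCommGroup E]
    [InnerProductSpace ℂ E] [CompleteSpace E] (U : G →* unitary (E →L[ℂ] E)) :
    Representation ℂ G E where
  toFun g := ((U g : E →L[ℂ] E) : E →ₗ[ℂ] E)
  map_one' := by ext x; simp
  map_mul' g h := by ext x; simp

/-- The group `𝒱^G` of `G`-invariant unitaries: those commuting with `U g` for all `g`. -/
def invariantUnitaries {G : Type*} [Group G] {H : Type*} [NormedAddCommGroup H]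
    [InnerProductSpace ℂ H] [CompleteSpace H] (U : G →* unitary (H →L[ℂ] H)) :
    Subgroup (unitary (H →L[ℂ] H)) :=
  Subgroup.centralizer (Set.range U)

/-- The special unitary group `SU(E)` of a finite-dimensional Hilbert space. -/
def specialUnitary (E : Type*) [NormedAddCommGroup E] [InnerProductSpace ℂ E] [CompleteSpace E] :
    Subgroup (unitary (E →L[ℂ] E)) where
  carrier := {u | LinearMap.det ((u : E →L[ℂ] E) : E →ₗ[ℂ] E) = 1}
  one_mem' := by simp
  mul_mem' {u v} hu hv := by
    simp only [Set.mem_ofPred_eq, Submonoid.coe_mul, ContinuousLinearMap.toLinearMap_mul] at *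
    rw [map_mul, hu, hv, one_mul]
  inv_mem' {u} hu := by
    have h : ((u : E →L[ℂ] E) : E →ₗ[ℂ] E) *
        (((u⁻¹ : unitary (E →L[ℂ] E)) : E →L[ℂ] E) : E →ₗ[ℂ] E) = 1 := by
      rw [← ContinuousLinearMap.toLinearMap_mul, ← Submonoid.coe_mul, mul_inv_cancel]
      simp
    have h' := congrArg LinearMap.det h
    simp only [Set.mem_ofPred_eq] at *
    rwa [map_mul, hu, one_mul, map_one] at h'

/-- An isotypic decomposition `H ≅ ⨁ l, Q l ⊗ M l` of a unitary representation `U`: an isometric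
isomorphism carrying `U g` to `⨁ l, irrep l g ⊗ 1`, where the `irrep l` are pairwise inequivalent
irreducible unitary representations on `Q l` and the multiplicity spaces `M l` are nonzero. -/
structure IsotypicDecomposition {G : Type*} [Group G] {H : Type*} [NormedAddCommGroup H]
    [InnerProductSpace ℂ H] [CompleteSpace H] (U : G →* unitary (H →L[ℂ] H))
    (Λ : Type*) [Fintype Λ] (Q M : Λ → Type*)
    [∀ l, NormedAddCommGroup (Q l)] [∀ l, InnerProductSpace ℂ (Q l)] [∀ l, CompleteSpace (Q l)]
    [∀ l, NormedAddCommGroup (M l)] [∀ l, InnerProductSpace ℂ (M l)] where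
  irrep : ∀ l, G →* unitary (Q l →L[ℂ] Q l)
  irreducible : ∀ l, (unitaryRepresentation (irrep l)).IsIrreducible
  inequivalent : ∀ l k, l ≠ k →
    IsEmpty ((unitaryRepresentation (irrep l)).Equiv (unitaryRepresentation (irrep k)))
  nontrivial_mult : ∀ l, Nontrivial (M l)
  iso : H ≃ₗᵢ[ℂ] PiLp 2 (fun l => Q l ⊗[ℂ] M l)
  iso_apply : ∀ (g : G) (x : H) (l : Λ),
    iso ((U g : H →L[ℂ] H) x) l = (irrep l g : Q l →L[ℂ] Q l).rTensor (M l) (iso x l)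

section Schur

variable {G Q Q' M M' : Type*} [Group G]
  [AddCommGroup Q] [Module ℂ Q] [AddCommGroup Q'] [Module ℂ Q']
  [AddCommGroup M] [Module ℂ M] [AddCommGroup M'] [Module ℂ M']

theorem tensor_ext_dual {x y : Q ⊗[ℂ] M}
    (h : ∀ φ : M →ₗ[ℂ] ℂ, TensorProduct.rid ℂ Q (φ.lTensor Q x) =
      TensorProduct.rid ℂ Q (φ.lTensor Q y)) : x = y := by
  classical
  let b := Module.Free.chooseBasis ℂ M
  apply (TensorProduct.equivFinsuppOfBasisRight (M := Q) b).injective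
  ext i
  rw [TensorProduct.equivFinsuppOfBasisRight_apply, TensorProduct.equivFinsuppOfBasisRight_apply]
  exact h _

/-- The intertwiner `q ↦ (1 ⊗ φ) (F (q ⊗ m))` cut out of a `G`-equivariant map of tensor products
on which `G` acts through the left factors. -/
def sliceIntertwiner (ρ : Representation ℂ G Q) (σ : Representation ℂ G Q')
    (F : Q ⊗[ℂ] M →ₗ[ℂ] Q' ⊗[ℂ] M')
    (hF : ∀ g x, F ((ρ g).rTensor M x) = (σ g).rTensor M' (F x))
    (m : M) (φ : M' →ₗ[ℂ] ℂ) : ρ.IntertwiningMap σ where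
  toLinearMap := (TensorProduct.rid ℂ Q').toLinearMap ∘ₗ φ.lTensor Q' ∘ₗ F ∘ₗ
    (TensorProduct.mk ℂ Q M).flip m
  isIntertwining' g := by
    ext q
    have h1 : (ρ g q) ⊗ₜ[ℂ] m = (ρ g).rTensor M (q ⊗ₜ[ℂ] m) := by simp
    have h2 : ∀ y : Q' ⊗[ℂ] M', TensorProduct.rid ℂ Q' (φ.lTensor Q' ((σ g).rTensor M' y)) =
        σ g (TensorProduct.rid ℂ Q' (φ.lTensor Q' y)) := by
      intro y
      induction y with
      | zero => simp
      | tmul a b => simp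
      | add a b ha hb => simp only [map_add, ha, hb]
    simp only [LinearMap.comp_apply, LinearMap.flip_apply, TensorProduct.mk_apply,
      LinearEquiv.coe_coe]
    rw [h1, hF, h2]

theorem tensor_schur_zero (ρ : Representation ℂ G Q) (σ : Representation ℂ G Q')
    [ρ.IsIrreducible] [σ.IsIrreducible] (h : IsEmpty (ρ.Equiv σ))
    (F : Q ⊗[ℂ] M →ₗ[ℂ] Q' ⊗[ℂ] M')
    (hF : ∀ g x, F ((ρ g).rTensor M x) = (σ g).rTensor M' (F x)) : F = 0 := by
  apply TensorProduct.ext'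
  intro q m
  apply tensor_ext_dual
  intro φ
  have h0 : sliceIntertwiner ρ σ F hF m φ = 0 := Subsingleton.elim _ _
  have h1 := congrArg (fun f => f q) h0
  simpa [sliceIntertwiner] using h1

theorem tensor_schur_self [FiniteDimensional ℂ Q] (ρ : Representation ℂ G Q) [ρ.IsIrreducible]
    (F : Q ⊗[ℂ] M →ₗ[ℂ] Q ⊗[ℂ] M')
    (hF : ∀ g x, F ((ρ g).rTensor M x) = (ρ g).rTensor M' (F x)) :
    ∃ v : M →ₗ[ℂ] M', F = v.lTensor Q := by
  have hQ : Nontrivial Q := by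
    by_contra hn
    rw [not_nontrivial_iff_subsingleton] at hn
    obtain ⟨a, b, hab⟩ := (inferInstance : Nontrivial (Subrepresentation ρ))
    exact hab (by ext x; rw [Subsingleton.elim x 0]; simp)
  obtain ⟨q0, hq0⟩ := exists_ne (0 : Q)
  obtain ⟨ψ, hψ⟩ : ∃ ψ : Q →ₗ[ℂ] ℂ, ψ q0 = 1 := by
    obtain ⟨ψ, hψ⟩ := Module.Projective.exists_dual_ne_zero ℂ hq0
    exact ⟨(ψ q0)⁻¹ • ψ, by simp [hψ]⟩
  refine ⟨(TensorProduct.lid ℂ M').toLinearMap ∘ₗ ψ.rTensor M' ∘ₗ F ∘ₗ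
    (TensorProduct.mk ℂ Q M) q0, ?_⟩
  apply TensorProduct.ext'
  intro q m
  apply tensor_ext_dual
  intro φ
  obtain ⟨c, hc⟩ :=
    (Representation.IsIrreducible.algebraMap_intertwiningMap_bijective_of_isAlgClosed
      (ρ := ρ)).2 (sliceIntertwiner ρ ρ F hF m φ)
  have hs : ∀ q, TensorProduct.rid ℂ Q (φ.lTensor Q (F (q ⊗ₜ m))) = c • q := by
    intro q
    have := congrArg (fun f => f q) hc
    simpa [sliceIntertwiner, Algebra.algebraMap_eq_smul_one] using this.symm
  have hcomm : ∀ y : Q ⊗[ℂ] M', φ (TensorProduct.lid ℂ M' (ψ.rTensor M' y)) =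
      ψ (TensorProduct.rid ℂ Q (φ.lTensor Q y)) := by
    intro y
    induction y with
    | zero => simp
    | tmul a b => simp [mul_comm]
    | add a b ha hb => simp only [map_add, ha, hb]
  rw [hs]
  simp [hcomm, hs, hψ]

end Schur

namespace IsotypicDecomposition

variable {G : Type*} [Group G] {H : Type*} [NormedAddCommGroup H]
  [InnerProductSpace ℂ H] [CompleteSpace H] {U : G →* unitary (H →L[ℂ] H)}
  {Λ : Type*} [Fintype Λ] {Q M : Λ → Type*}
  [∀ l, NormedAddCommGroup (Q l)] [∀ l, InnerProductSpace ℂ (Q l)] [∀ l, CompleteSpace (Q l)]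
  [∀ l, NormedAddCommGroup (M l)] [∀ l, InnerProductSpace ℂ (M l)]

theorem exists_unit (D : IsotypicDecomposition U Λ Q M) (l : Λ) : ∃ q : Q l, ‖q‖ = 1 := by
  have := D.irreducible l
  have hQ : Nontrivial (Q l) := by
    by_contra hn
    rw [not_nontrivial_iff_subsingleton] at hn
    obtain ⟨a, b, hab⟩ :=
      (inferInstance : Nontrivial (Subrepresentation (unitaryRepresentation (D.irrep l))))
    exact hab (by ext x; rw [Subsingleton.elim x 0]; simp)
  exact exists_norm_eq (Q l) zero_le_one

variable [∀ l, FiniteDimensional ℂ (Q l)]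

theorem exists_linear (D : IsotypicDecomposition U Λ Q M) (V : invariantUnitaries U) (l : Λ) :
    ∃ v : M l →ₗ[ℂ] M l, ∀ x : H,
      D.iso ((V.1 : H →L[ℂ] H) x) l = v.lTensor (Q l) (D.iso x l) := by
  classical
  have hirr := D.irreducible
  have hcomm : ∀ g x, (U g : H →L[ℂ] H) ((V.1 : H →L[ℂ] H) x) =
      (V.1 : H →L[ℂ] H) ((U g : H →L[ℂ] H) x) := by
    intro g x
    have h := (Subgroup.mem_centralizer_iff.1 V.2) (U g) ⟨g, rfl⟩
    have h' := congrArg (fun u : unitary (H →L[ℂ] H) => (u : H →L[ℂ] H) x) h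
    simpa using h'
  let F : ∀ k, Q k ⊗[ℂ] M k →ₗ[ℂ] Q l ⊗[ℂ] M l := fun k =>
    { toFun := fun t => D.iso ((V.1 : H →L[ℂ] H) (D.iso.symm (PiLp.single 2 k t))) l
      map_add' := by intro s t; simp [PiLp.single_add]
      map_smul' := by
        intro c t
        have h : PiLp.single 2 k (c • t) = c • (PiLp.single 2 k t : PiLp 2 fun k => Q k ⊗[ℂ] M k) := by
          ext j
          by_cases hj : j = k
          · subst hj
            simp
          · simp [hj]
        simp [h] }
  have hF : ∀ k g x, F k ((unitaryRepresentation (D.irrep k) g).rTensor (M k) x) =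
      (unitaryRepresentation (D.irrep l) g).rTensor (M l) (F k x) := by
    intro k g x
    have h1 : D.iso.symm (PiLp.single 2 k ((unitaryRepresentation (D.irrep k) g).rTensor (M k) x))
        = (U g : H →L[ℂ] H) (D.iso.symm (PiLp.single 2 k x)) := by
      apply D.iso.injective
      ext j
      rw [D.iso_apply, LinearIsometryEquiv.apply_symm_apply, LinearIsometryEquiv.apply_symm_apply]
      by_cases hj : j = k
      · subst hj
        simp [unitaryRepresentation]
      · simp [hj]
    show D.iso _ l = _
    rw [h1, ← hcomm, D.iso_apply]
    rfl
  obtain ⟨v, hv⟩ := tensor_schur_self (unitaryRepresentation (D.irrep l)) (F l) (hF l)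
  refine ⟨v, fun x => ?_⟩
  have hx : D.iso x = ∑ k, PiLp.single 2 k (D.iso x k) := by
    ext j
    simp
  have hx' : x = ∑ k, D.iso.symm (PiLp.single 2 k (D.iso x k)) := by
    rw [← map_sum, ← hx, LinearIsometryEquiv.symm_apply_apply]
  have h2 : D.iso ((V.1 : H →L[ℂ] H) x) l = ∑ k, F k (D.iso x k) := by
    conv_lhs => rw [hx']
    simp [F]
  rw [h2, Finset.sum_eq_single l, hv]
  · intro k _ hk
    rw [tensor_schur_zero _ _ (D.inequivalent k l hk) (F k) (hF k)]
    rfl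
  · simp

variable [∀ l, CompleteSpace (M l)] [∀ l, FiniteDimensional ℂ (M l)]

/-- By Schur's lemma a `G`-invariant unitary acts on the sector `Q l ⊗ M l` as `1 ⊗ v` for a unique
unitary `v` of `M l`. -/
theorem existsUnique_component (D : IsotypicDecomposition U Λ Q M) (V : invariantUnitaries U)
    (l : Λ) : ∃! v : unitary (M l →L[ℂ] M l), ∀ x : H,
      D.iso ((V.1 : H →L[ℂ] H) x) l = (v : M l →L[ℂ] M l).lTensor (Q l) (D.iso x l) := by
  classical
  obtain ⟨q, hq⟩ := D.exists_unit l
  obtain ⟨v, hv⟩ := D.exists_linear V l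
  have key : ∀ m, ‖v m‖ = ‖m‖ := by
    intro m
    have hz : ∀ k, k ≠ l → 
        D.iso ((V.1 : H →L[ℂ] H) (D.iso.symm (PiLp.single 2 l (q ⊗ₜ m)))) k = 0 := by
      intro k hk
      obtain ⟨w, hw⟩ := D.exists_linear V k
      rw [hw]
      simp [hk]
    have h1 : D.iso ((V.1 : H →L[ℂ] H) (D.iso.symm (PiLp.single 2 l (q ⊗ₜ m)))) =
        PiLp.single 2 l (q ⊗ₜ v m) := by
      ext k
      by_cases hk : k = l
      · subst hk
        rw [hv]
        simp
      · rw [hz k hk]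
        simp [hk]
    have h2 := congrArg norm h1
    rw [LinearIsometryEquiv.norm_map, Unitary.norm_map, LinearIsometryEquiv.norm_map] at h2
    simpa [hq] using h2.symm
  let e : M l ≃ₗᵢ[ℂ] M l := LinearIsometry.toLinearIsometryEquiv ⟨v, key⟩ rfl
  refine ⟨Unitary.linearIsometryEquiv.symm e, fun x => ?_, fun w hw => ?_⟩
  · rw [hv]
    have he : (((Unitary.linearIsometryEquiv.symm e : unitary (M l →L[ℂ] M l)) :
        M l →L[ℂ] M l) : M l →ₗ[ℂ] M l) = v := by
      ext m
      rfl
    rw [ContinuousLinearMap.lTensor_apply, he]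
  · ext m
    have h := hw (D.iso.symm (PiLp.single 2 l (q ⊗ₜ m)))
    rw [hv] at h
    have h3 : q ⊗ₜ[ℂ] (v m - (w : M l →L[ℂ] M l) m) = 0 := by
      rw [TensorProduct.tmul_sub, sub_eq_zero]
      simpa using h
    have h4 := congrArg norm h3
    rw [TensorProduct.norm_tmul, hq, one_mul, norm_zero, norm_eq_zero, sub_eq_zero] at h4
    exact h4.symm

/-- The component `π_l V` of a `G`-invariant unitary `V = ⨁ l, 1 ⊗ π_l V` on the multiplicity space
`M l`. -/
def component (D : IsotypicDecomposition U Λ Q M) (l : Λ) (V : invariantUnitaries U) :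
    unitary (M l →L[ℂ] M l) :=
  (D.existsUnique_component V l).choose

theorem iso_component (D : IsotypicDecomposition U Λ Q M) (l : Λ) (V : invariantUnitaries U)
    (x : H) : D.iso ((V.1 : H →L[ℂ] H) x) l =
      (D.component l V : M l →L[ℂ] M l).lTensor (Q l) (D.iso x l) :=
  (D.existsUnique_component V l).choose_spec.1 x

theorem component_eq (D : IsotypicDecomposition U Λ Q M) (l : Λ) (V : invariantUnitaries U)
    (v : unitary (M l →L[ℂ] M l)) (h : ∀ x : H, D.iso ((V.1 : H →L[ℂ] H) x) l =
      (v : M l →L[ℂ] M l).lTensor (Q l) (D.iso x l)) : D.component l V = v :=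
  ((D.existsUnique_component V l).choose_spec.2 v h).symm

/-- The homomorphism `π_l : 𝒱^G → U(M l)`. -/
def proj (D : IsotypicDecomposition U Λ Q M) (l : Λ) :
    invariantUnitaries U →* unitary (M l →L[ℂ] M l) where
  toFun := D.component l
  map_one' := D.component_eq l 1 1 fun x => by simp
  map_mul' V W := D.component_eq l (V * W) _ fun x => by
    have h : (((V * W : invariantUnitaries U) : unitary (H →L[ℂ] H)) : H →L[ℂ] H) x =
      (V.1 : H →L[ℂ] H) ((W.1 : H →L[ℂ] H) x) := rfl
    rw [h, iso_component, iso_component, Submonoid.coe_mul, ContinuousLinearMap.lTensor_mul]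
    rfl

end IsotypicDecomposition

/-- The matrix of a unitary operator relative to an orthonormal basis. -/
def unitaryMatrix {E : Type*} [NormedAddCommGroup E] [InnerProductSpace ℂ E] [CompleteSpace E]
    {m : ℕ} (b : OrthonormalBasis (Fin m) ℂ E) (u : unitary (E →L[ℂ] E)) :
    Matrix (Fin m) (Fin m) ℂ :=
  LinearMap.toMatrix b.toBasis b.toBasis ((u : E →L[ℂ] E) : E →ₗ[ℂ] E)

/-- Subsystem universality in all sectors: for every `l`, the projection of `T` to `M l` contains
`SU(M l)`. -/
def SubsystemUniversal {G : Type*} [Group G] {H : Type*} [NormedAddCommGroup H]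
    [InnerProductSpace ℂ H] [CompleteSpace H] {U : G →* unitary (H →L[ℂ] H)}
    {Λ : Type*} [Fintype Λ] {Q M : Λ → Type*}
    [∀ l, NormedAddCommGroup (Q l)] [∀ l, InnerProductSpace ℂ (Q l)] [∀ l, CompleteSpace (Q l)]
    [∀ l, FiniteDimensional ℂ (Q l)]
    [∀ l, NormedAddCommGroup (M l)] [∀ l, InnerProductSpace ℂ (M l)] [∀ l, CompleteSpace (M l)]
    [∀ l, FiniteDimensional ℂ (M l)]
    (D : IsotypicDecomposition U Λ Q M) (T : Subgroup (invariantUnitaries U)) : Prop :=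
  ∀ l, specialUnitary (M l) ≤ T.map (D.proj l)

end

/-! Two facts about a single sector drive the proof: `SU(E)` is perfect
(`isometrySU_le_commutator`), and a normal subgroup of it containing a non-scalar is everything
(`isometrySU_le_of_nonscalar`). By perfectness, `[T,T]` projects exactly onto each `SU(M l)`.

For two sectors this gives Goursat's alternative (`isometrySU_le_map_ker_or`). Either one projection
of `[T,T]` still covers its special unitary group on the kernel of the other, or each kernel acts by
scalars in the other sector. In the second case, adjoining scalars to the image of `T` yields an
abstract identification of the projective unitary groups of the two spaces. `T` is an arbitrary
subgroup, so no continuity or Lie theory is available, and the identification is analysed by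
geometry. Complex reflections go to complex reflections, which gives a correspondence of lines; it
preserves orthogonality, then overlaps, and a Wigner-type argument
(`ProjectiveCorrespondence.exists_implementing_basis`) implements it by a unitary or an antiunitary.
The relation holds up to scalars on `T`; scalars cancel in commutators, so it is exact on `[T,T]`
(`eq_on_commutator_of_smul`).

Two sectors are put in one class when their projections have the same kernel on `[T,T]`. Implemented
sectors have equal kernels, so different classes are independent. Pairwise independent maps onto
perfect groups are jointly surjective (`exists_forall_map_eq`); one representative per class then
gives the isomorphism with the product, injective because a class shares its kernel. The sectors
with `dim M = 1` form a single class with trivial factor. -/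

noncomputable section

/-! ### Scalar unitaries and complex reflections -/

section UnitaryBasics

open InnerProductSpace

variable {E F : Type*} [NormedAddCommGroup E] [InnerProductSpace ℂ E]
  [NormedAddCommGroup F] [InnerProductSpace ℂ F]

/-- The linear endomorphism underlying a unitary. -/
def toEnd : (E ≃ₗᵢ[ℂ] E) →* Module.End ℂ E where
  toFun u := (u.toLinearEquiv : E →ₗ[ℂ] E)
  map_one' := rfl
  map_mul' _ _ := rfl

@[simp] theorem toEnd_apply (u : E ≃ₗᵢ[ℂ] E) (ξ : E) : toEnd u ξ = u ξ := rfl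

theorem toEnd_injective : Function.Injective (toEnd (E := E)) := fun u v h =>
  LinearIsometryEquiv.ext fun ξ => congrArg (fun f => f ξ) h

@[simp] theorem isometry_mul_apply (u v : E ≃ₗᵢ[ℂ] E) (ξ : E) : (u * v) ξ = u (v ξ) := rfl

@[simp] theorem isometry_inv_apply_apply (u : E ≃ₗᵢ[ℂ] E) (ξ : E) : u⁻¹ (u ξ) = ξ :=
  u.symm_apply_apply ξ

@[simp] theorem isometry_apply_inv_apply (u : E ≃ₗᵢ[ℂ] E) (ξ : E) : u (u⁻¹ ξ) = ξ :=
  u.apply_symm_apply ξ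

/-- Multiplication by a complex number of modulus one. -/
def phase (z : Circle) : E ≃ₗᵢ[ℂ] E where
  toFun ξ := (z : ℂ) • ξ
  invFun ξ := ((z⁻¹ : Circle) : ℂ) • ξ
  map_add' := smul_add _
  map_smul' c ξ := smul_comm _ _ _
  left_inv ξ := by simp [smul_smul]
  right_inv ξ := by simp [smul_smul]
  norm_map' ξ := by
    change ‖(z : ℂ) • ξ‖ = ‖ξ‖
    rw [norm_smul, Circle.norm_coe, one_mul]

@[simp] theorem phase_apply (z : Circle) (ξ : E) : phase z ξ = (z : ℂ) • ξ := rfl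

variable (E) in
/-- The subgroup of scalar unitaries. -/
def scalars : Subgroup (E ≃ₗᵢ[ℂ] E) where
  carrier := {u | ∃ c : ℂ, ∀ ξ, u ξ = c • ξ}
  one_mem' := ⟨1, fun ξ => by simp⟩
  mul_mem' := by
    rintro u v ⟨c, hc⟩ ⟨d, hd⟩
    exact ⟨c * d, fun ξ => by rw [isometry_mul_apply, hd, hc, smul_smul]⟩
  inv_mem' := by
    rintro u ⟨c, hc⟩
    refine ⟨c⁻¹, fun ξ => ?_⟩
    by_cases h : c = 0
    · have : ξ = 0 := by simpa [h] using hc (u⁻¹ ξ)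
      simp [this]
    · have := hc (u⁻¹ ξ)
      rw [isometry_apply_inv_apply] at this
      rw [eq_inv_smul_iff₀ h, ← this]

theorem phase_mem_scalars (z : Circle) : (phase z : E ≃ₗᵢ[ℂ] E) ∈ scalars E := ⟨z, fun _ => rfl⟩

theorem commute_of_mem_scalars {s : E ≃ₗᵢ[ℂ] E} (hs : s ∈ scalars E) (u : E ≃ₗᵢ[ℂ] E) :
    Commute s u := by
  obtain ⟨c, hc⟩ := hs
  exact LinearIsometryEquiv.ext fun ξ => by simp [hc]

theorem phase_commute (z : Circle) (u : E ≃ₗᵢ[ℂ] E) : Commute (phase z) u :=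
  commute_of_mem_scalars (phase_mem_scalars z) u

instance : (scalars E).Normal := ⟨fun s hs u => by
  rwa [← (commute_of_mem_scalars hs u).eq, mul_inv_cancel_right]⟩

theorem mul_inv_mem_scalars {u v : E ≃ₗᵢ[ℂ] E} :
    u * v⁻¹ ∈ scalars E ↔ ∃ c : ℂ, ∀ ξ, u ξ = c • v ξ := by
  constructor
  · rintro ⟨c, hc⟩
    exact ⟨c, fun ξ => by simpa using hc (v ξ)⟩
  · rintro ⟨c, hc⟩
    exact ⟨c, fun ξ => by simp [hc]⟩

theorem exists_circle_of_norm {c : ℂ} (h : ‖c‖ = 1) : ∃ z : Circle, (z : ℂ) = c :=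
  ⟨⟨c, mem_sphere_zero_iff_norm.2 h⟩, rfl⟩

theorem exists_phase_of_eigenvector (u : E ≃ₗᵢ[ℂ] E) {x : E} (hx : x ≠ 0) {c : ℂ}
    (h : u x = c • x) : ∃ z : Circle, (z : ℂ) = c := by
  apply exists_circle_of_norm
  have := congrArg norm h
  rw [u.norm_map, norm_smul] at this
  have hx' : ‖x‖ ≠ 0 := norm_ne_zero_iff.2 hx
  field_simp at this
  exact this.symm

theorem mem_scalars_of_parallel (u : E ≃ₗᵢ[ℂ] E) (h : ∀ ξ, ∃ c : ℂ, u ξ = c • ξ) :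
    u ∈ scalars E := by
  obtain ⟨c, hc⟩ := LinearMap.exists_eq_smul_id_of_forall_notLinearIndependent (f := toEnd u) (by
    intro v hv
    obtain ⟨c, hc⟩ := h v
    rw [LinearIndependent.pair_iff] at hv
    have := hv c (-1) (by simp [hc])
    simp at this)
  exact ⟨c, fun ξ => congrArg (fun f => f ξ) hc⟩

/-- The complex reflection `1 + (z - 1) P`, where `P` projects onto the line through `x`. -/
def crefl (x : E) (z : Circle) : E ≃ₗᵢ[ℂ] E where
  toFun ξ := ξ + ((z : ℂ) - 1) • (ℂ ∙ x).starProjection ξ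
  invFun ξ := ξ + (((z⁻¹ : Circle) : ℂ) - 1) • (ℂ ∙ x).starProjection ξ
  map_add' ξ η := by simp only [map_add, smul_add]; abel
  map_smul' c ξ := by simp only [map_smul, smul_add, RingHom.id_apply]; rw [smul_comm]
  left_inv ξ := by
    have h : (ℂ ∙ x).starProjection ((ℂ ∙ x).starProjection ξ) = (ℂ ∙ x).starProjection ξ :=
      Submodule.starProjection_eq_self_iff.2 (Submodule.starProjection_apply_mem _ _)
    have hz : (z : ℂ) ≠ 0 := z.coe_ne_zero
    simp only [map_add, map_smul, h, Circle.coe_inv]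
    match_scalars
    · ring
    · field_simp
      ring
  right_inv ξ := by
    have h : (ℂ ∙ x).starProjection ((ℂ ∙ x).starProjection ξ) = (ℂ ∙ x).starProjection ξ :=
      Submodule.starProjection_eq_self_iff.2 (Submodule.starProjection_apply_mem _ _)
    have hz : (z : ℂ) ≠ 0 := z.coe_ne_zero
    simp only [map_add, map_smul, h, Circle.coe_inv]
    match_scalars
    · ring
    · field_simp
      ring
  norm_map' ξ := by
    change ‖ξ + ((z : ℂ) - 1) • (ℂ ∙ x).starProjection ξ‖ = ‖ξ‖
    set P := (ℂ ∙ x).starProjection ξ with hP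
    have horth : inner ℂ (ξ - P) P = 0 :=
      Submodule.starProjection_inner_eq_zero ξ P (Submodule.starProjection_apply_mem _ _)
    have h1 : ξ + ((z : ℂ) - 1) • P = (ξ - P) + (z : ℂ) • P := by module
    have h2 : ξ = (ξ - P) + P := by abel
    have e1 := norm_add_sq_eq_norm_sq_add_norm_sq_of_inner_eq_zero (𝕜 := ℂ) (ξ - P) P horth
    have e2 := norm_add_sq_eq_norm_sq_add_norm_sq_of_inner_eq_zero (𝕜 := ℂ) (ξ - P) ((z : ℂ) • P)
      (by rw [inner_smul_right, horth, mul_zero])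
    rw [← h2] at e1
    rw [← h1, norm_smul, Circle.norm_coe, one_mul, ← e1] at e2
    rw [← sq_eq_sq₀ (norm_nonneg _) (norm_nonneg _), pow_two, pow_two]
    exact e2

theorem crefl_apply {x : E} (hx : ‖x‖ = 1) (z : Circle) (ξ : E) :
    crefl x z ξ = ξ + (((z : ℂ) - 1) * inner ℂ x ξ) • x := by
  change ξ + ((z : ℂ) - 1) • (ℂ ∙ x).starProjection ξ = _
  rw [Submodule.starProjection_unit_singleton ℂ hx, smul_smul]

theorem inner_self_of_norm_eq_one {x : E} (hx : ‖x‖ = 1) : inner ℂ x x = (1 : ℂ) := by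
  rw [inner_self_eq_norm_sq_to_K, hx]; simp

theorem ne_zero_of_norm_eq_one {x : E} (hx : ‖x‖ = 1) : x ≠ 0 := by
  rintro rfl; simp at hx

theorem crefl_apply_self {x : E} (hx : ‖x‖ = 1) (z : Circle) : crefl x z x = (z : ℂ) • x := by
  rw [crefl_apply hx, inner_self_of_norm_eq_one hx]; module

theorem crefl_apply_of_orthogonal {x ξ : E} (hx : ‖x‖ = 1) (h : inner ℂ x ξ = (0 : ℂ))
    (z : Circle) : crefl x z ξ = ξ := by
  rw [crefl_apply hx, h]; simp

theorem crefl_mul {x : E} (hx : ‖x‖ = 1) (z w : Circle) :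
    crefl x z * crefl x w = crefl x (z * w) := by
  ext ξ
  rw [isometry_mul_apply, crefl_apply hx, crefl_apply hx, crefl_apply hx, inner_add_right,
    inner_smul_right, inner_self_of_norm_eq_one hx, Circle.coe_mul]
  module

theorem crefl_one {x : E} (hx : ‖x‖ = 1) : crefl x 1 = 1 := by
  ext ξ
  rw [crefl_apply hx]; simp

theorem crefl_inv {x : E} (hx : ‖x‖ = 1) (z : Circle) : (crefl x z)⁻¹ = crefl x z⁻¹ := by
  rw [inv_eq_iff_mul_eq_one, crefl_mul hx, mul_inv_cancel, crefl_one hx]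

theorem crefl_pow {x : E} (hx : ‖x‖ = 1) (z : Circle) (n : ℕ) :
    crefl x z ^ n = crefl x (z ^ n) := by
  induction n with
  | zero => rw [pow_zero, pow_zero, crefl_one hx]
  | succ n ih => rw [pow_succ, pow_succ, ih, crefl_mul hx]

/-- Conjugation of reflections is the action of the unitary group on lines. All the geometry of
lines below is read off from group theory through this covariance. -/
theorem conj_crefl (u : E ≃ₗᵢ[ℂ] E) {x : E} (hx : ‖x‖ = 1) (z : Circle) :
    u * crefl x z * u⁻¹ = crefl (u x) z := by
  ext ξ
  rw [isometry_mul_apply, isometry_mul_apply, crefl_apply hx, crefl_apply (by rwa [u.norm_map]),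
    map_add, map_smul, isometry_apply_inv_apply]
  congr 3
  rw [← u.inner_map_map, isometry_apply_inv_apply]

theorem crefl_smul {x : E} (hx : ‖x‖ = 1) {c : ℂ} (hc : ‖c‖ = 1) (z : Circle) :
    crefl (c • x) z = crefl x z := by
  ext ξ
  rw [crefl_apply (by rw [norm_smul, hc, hx, one_mul]), crefl_apply hx, inner_smul_left, smul_smul]
  congr 2
  have : c * (starRingEnd ℂ) c = 1 := by rw [Complex.mul_conj']; simp [hc]
  linear_combination (((z : ℂ) - 1) * inner ℂ x ξ) * this

theorem norm_smul_eq_one {c : ℂ} {x y : E} (hx : ‖x‖ = 1) (hy : ‖y‖ = 1) (h : y = c • x) :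
    ‖c‖ = 1 := by
  rw [h, norm_smul, hx, mul_one] at hy; exact hy

/-- A unitary commuting with a nontrivial reflection in `y` has `y` as an eigenvector. -/
theorem apply_eq_smul_of_commute {u : E ≃ₗᵢ[ℂ] E} {y : E} (hy : ‖y‖ = 1) {z : Circle}
    (hz : z ≠ 1) (h : Commute u (crefl y z)) : u y = (inner ℂ y (u y) : ℂ) • y := by
  have h1 := congrArg (fun f : E ≃ₗᵢ[ℂ] E => f y) h.eq
  simp only [isometry_mul_apply] at h1
  rw [crefl_apply_self hy, map_smul, crefl_apply hy] at h1
  have hz' : (z : ℂ) - 1 ≠ 0 := by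
    rw [sub_ne_zero]
    exact fun h => hz (Circle.ext h)
  have h2 : ((z : ℂ) - 1) • u y = ((z : ℂ) - 1) • ((inner ℂ y (u y) : ℂ) • y) := by
    rw [sub_smul, one_smul, h1, smul_smul]; abel
  exact smul_right_injective E hz' h2

theorem commute_crefl_of_apply_eq_smul {u : E ≃ₗᵢ[ℂ] E} {y : E} (hy : ‖y‖ = 1) {c : ℂ}
    (h : u y = c • y) (z : Circle) : Commute u (crefl y z) := by
  have hc : ‖c‖ = 1 := norm_smul_eq_one hy (by rw [u.norm_map, hy]) h
  have := conj_crefl u hy z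
  rw [h, crefl_smul hy hc, mul_inv_eq_iff_eq_mul] at this
  exact this

/-- Commuting makes `y` an eigenvector of the reflection in `x`, whose eigenvectors lie on the line
of `x` or in its orthogonal complement. Orthogonality of lines thus becomes a group-theoretic
condition. -/
theorem parallel_or_orthogonal_of_commute {x y : E} (hx : ‖x‖ = 1) (hy : ‖y‖ = 1) {z w : Circle}
    (hz : z ≠ 1) (hw : w ≠ 1) (h : Commute (crefl x w) (crefl y z)) :
    (∃ c : ℂ, y = c • x) ∨ inner ℂ x y = (0 : ℂ) := by
  have h1 := apply_eq_smul_of_commute hy hz h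
  set c : ℂ := inner ℂ y (crefl x w y)
  rw [crefl_apply hx] at h1
  have hw' : (w : ℂ) - 1 ≠ 0 := by
    rw [sub_ne_zero]
    exact fun h => hw (Circle.ext h)
  by_cases h0 : inner ℂ x y = (0 : ℂ)
  · exact Or.inr h0
  have h2 : (((w : ℂ) - 1) * inner ℂ x y) • x = (c - 1) • y := by
    rw [sub_smul, one_smul, ← h1]; abel
  have h3 : c - 1 ≠ 0 := by
    intro h
    rw [h, zero_smul, smul_eq_zero] at h2
    rcases h2 with h2 | h2
    · exact mul_ne_zero hw' h0 h2
    · exact ne_zero_of_norm_eq_one hx h2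
  left
  refine ⟨(c - 1)⁻¹ * (((w : ℂ) - 1) * inner ℂ x y), ?_⟩
  rw [mul_smul, h2, inv_smul_smul₀ h3]

theorem commute_crefl_of_orthogonal {x y : E} (hx : ‖x‖ = 1) (hy : ‖y‖ = 1)
    (h : inner ℂ x y = (0 : ℂ)) (z w : Circle) : Commute (crefl x w) (crefl y z) :=
  commute_crefl_of_apply_eq_smul hy (c := 1)
    (by rw [one_smul, crefl_apply_of_orthogonal hx h]) z

theorem commute_crefl_of_parallel {x y : E} (hx : ‖x‖ = 1) (hy : ‖y‖ = 1) {c : ℂ}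
    (h : y = c • x) (z w : Circle) : Commute (crefl x w) (crefl y z) :=
  commute_crefl_of_apply_eq_smul hy (c := w)
    (by rw [h, map_smul, crefl_apply_self hx, smul_comm]) z

end UnitaryBasics

/-! ### Traces, diagonalization, and transitivity on pairs of lines -/

section FiniteDimensionalUnitary

variable {E F : Type*} [NormedAddCommGroup E] [InnerProductSpace ℂ E] [FiniteDimensional ℂ E]
  [NormedAddCommGroup F] [InnerProductSpace ℂ F] [FiniteDimensional ℂ F]

theorem trace_crefl {x : E} (hx : ‖x‖ = 1) (z : Circle) :
    LinearMap.trace ℂ E (toEnd (crefl x z)) = Module.finrank ℂ E + ((z : ℂ) - 1) := by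
  have h : toEnd (crefl x z) = 1 + ((z : ℂ) - 1) • (InnerProductSpace.rankOne ℂ x x).toLinearMap := by
    ext ξ
    simp [crefl_apply hx, smul_smul]
  rw [h, map_add, map_smul, LinearMap.trace_one, InnerProductSpace.trace_rankOne,
    inner_self_of_norm_eq_one hx]
  simp

/-- The trace is `n - 1 + z` with `|z| = 1`, which vanishes only for `n = 2`, `z = -1`. The
exception is genuine: in dimension two, reflections of order two in different lines can anticommute,
hence commute modulo scalars without commuting. For this reason reflections of order four or of odd
order are used throughout. -/
theorem trace_crefl_ne_zero (hE : 2 ≤ Module.finrank ℂ E) {x : E} (hx : ‖x‖ = 1) {z : Circle}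
    (hz : (z : ℂ) ≠ -1) : LinearMap.trace ℂ E (toEnd (crefl x z)) ≠ 0 := by
  rw [trace_crefl hx]
  intro h
  have h1 : (z : ℂ) = ((1 - (Module.finrank ℂ E : ℝ) : ℝ) : ℂ) := by
    push_cast; linear_combination h
  have h2 : ‖(z : ℂ)‖ = 1 := Circle.norm_coe z
  have h3 : (2 : ℝ) ≤ Module.finrank ℂ E := by exact_mod_cast hE
  rw [h1, Complex.norm_real, Real.norm_eq_abs, abs_of_nonpos (by linarith)] at h2
  apply hz
  rw [h1]
  have : (Module.finrank ℂ E : ℝ) = 2 := by linarith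
  rw [this]; push_cast; ring

theorem eq_one_of_trace {u v : E ≃ₗᵢ[ℂ] E} {c : ℂ} {w : E ≃ₗᵢ[ℂ] E} (hv : v = w * u * w⁻¹)
    (h : ∀ ξ, v ξ = c • u ξ) (ht : LinearMap.trace ℂ E (toEnd u) ≠ 0) : c = 1 := by
  have h1 : toEnd v = c • toEnd u := LinearMap.ext h
  have h2 : LinearMap.trace ℂ E (toEnd v) = LinearMap.trace ℂ E (toEnd u) := by
    rw [hv, map_mul, LinearMap.trace_mul_comm, ← map_mul, ← mul_assoc, inv_mul_cancel, one_mul]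
  rw [h1, map_smul, smul_eq_mul] at h2
  exact mul_right_cancel₀ ht (by rw [h2, one_mul])

/-- Two unitaries commuting up to a scalar commute if one of them has nonzero trace. -/
theorem commute_of_commutator_mem_scalars {u v : E ≃ₗᵢ[ℂ] E} (h : v * u * v⁻¹ * u⁻¹ ∈ scalars E)
    (ht : LinearMap.trace ℂ E (toEnd u) ≠ 0) : Commute v u := by
  rw [mul_inv_mem_scalars] at h
  obtain ⟨c, hc⟩ := h
  have := eq_one_of_trace rfl hc ht
  have h2 : v * u * v⁻¹ = u := LinearIsometryEquiv.ext fun ξ => by rw [hc, this, one_smul]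
  rwa [mul_inv_eq_iff_eq_mul] at h2

theorem unitary_eigenvalue_conj (u : E ≃ₗᵢ[ℂ] E) {x : E} {c : ℂ}
    (h : u x = c • x) : (starRingEnd ℂ) c • u x = x := by
  by_cases hx : x = 0
  · simp [hx]
  obtain ⟨z, rfl⟩ := exists_phase_of_eigenvector u hx h
  rw [h, smul_smul, ← Circle.coe_inv_eq_conj, ← Circle.coe_mul]
  simp

theorem exists_eigenbasis (u : E ≃ₗᵢ[ℂ] E) :
    ∃ (b : OrthonormalBasis (Fin (Module.finrank ℂ E)) ℂ E)
      (β : Fin (Module.finrank ℂ E) → Circle), ∀ j, u (b j) = (β j : ℂ) • b j := by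
  classical
  have hortho : OrthogonalFamily ℂ (fun μ => Module.End.eigenspace (toEnd u) μ)
      fun μ => (Module.End.eigenspace (toEnd u) μ).subtypeₗᵢ := by
    rintro μ ν hμν ⟨v, hv⟩ ⟨w, hw⟩
    rw [Module.End.mem_eigenspace_iff] at hv hw
    change inner ℂ v w = (0 : ℂ)
    by_cases hv0 : v = 0
    · simp [hv0]
    obtain ⟨z, rfl⟩ := exists_phase_of_eigenvector u hv0 hv
    have h1 : inner ℂ v w = ((starRingEnd ℂ) (z : ℂ) * ν) * inner ℂ v w := by
      conv_lhs => rw [← u.inner_map_map, ← toEnd_apply u v, ← toEnd_apply u w, hv, hw,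
        inner_smul_left, inner_smul_right, ← mul_assoc]
    by_contra h0
    have h2 : (starRingEnd ℂ) (z : ℂ) * ν = 1 :=
      mul_right_cancel₀ h0 (by rw [one_mul]; exact h1.symm)
    apply hμν
    rw [← Circle.coe_inv_eq_conj, Circle.coe_inv] at h2
    have := z.coe_ne_zero
    field_simp at h2
    exact h2.symm
  have hortho' : OrthogonalFamily ℂ
      (fun μ : Module.End.Eigenvalues (toEnd u) => Module.End.eigenspace (toEnd u) μ)
      fun μ => (Module.End.eigenspace (toEnd u) μ).subtypeₗᵢ :=
    hortho.comp Subtype.coe_injective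
  have hbot : (⨆ μ, Module.End.eigenspace (toEnd u) μ)ᗮ = ⊥ := by
    set p := (⨆ μ, Module.End.eigenspace (toEnd u) μ)ᗮ with hp
    -- An eigenvector of `u` is up to a factor its own image under `u`, so `u` preserves
    -- orthogonality to it. An eigenvector of `u` inside the complement would then be orthogonal to
    -- itself.
    have hinv : ∀ v ∈ p, toEnd u v ∈ p := by
      intro v hv
      rw [hp, ← Submodule.iInf_orthogonal, Submodule.mem_iInf] at hv ⊢
      intro μ w hw
      have hw' := hw
      rw [Module.End.mem_eigenspace_iff] at hw
      have h1 : (starRingEnd ℂ) μ • u w = w := unitary_eigenvalue_conj u hw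
      rw [← h1, inner_smul_left, toEnd_apply, u.inner_map_map, hv μ w hw', mul_zero]
    by_contra hne
    have : Nontrivial p := Submodule.nontrivial_iff_ne_bot.2 hne
    obtain ⟨μ, hμ⟩ := Module.End.exists_eigenvalue ((toEnd u).restrict hinv)
    obtain ⟨⟨v, hvp⟩, hv, hv0⟩ := hμ.exists_hasEigenvector
    rw [Module.End.mem_eigenspace_iff] at hv
    have hv' : v ∈ Module.End.eigenspace (toEnd u) μ := by
      rw [Module.End.mem_eigenspace_iff]
      exact congrArg Subtype.val hv
    have h0 : inner ℂ v v = (0 : ℂ) :=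
      hvp v (Submodule.mem_iSup_of_mem μ hv')
    exact hv0 (Subtype.ext (inner_self_eq_zero.1 h0))
  have hint : DirectSum.IsInternal
      fun μ : Module.End.Eigenvalues (toEnd u) => Module.End.eigenspace (toEnd u) μ := by
    rw [hortho'.isInternal_iff]
    change (⨆ μ : { μ // Module.End.eigenspace (toEnd u) μ ≠ ⊥ },
      Module.End.eigenspace (toEnd u) μ)ᗮ = ⊥
    rw [iSup_ne_bot_subtype, hbot]
  let b := hint.subordinateOrthonormalBasis rfl hortho'
  have hb : ∀ j, ∃ z : Circle, u (b j) = (z : ℂ) • b j := by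
    intro j
    have := hint.subordinateOrthonormalBasis_subordinate rfl j hortho'
    rw [Module.End.mem_eigenspace_iff] at this
    obtain ⟨z, hz⟩ := exists_phase_of_eigenvector u (b.toBasis.ne_zero j) (by simpa using this)
    exact ⟨z, by rw [hz]; exact this⟩
  choose β hβ using hb
  exact ⟨b, β, hβ⟩

theorem det_of_eigenbasis {ι : Type*} [Fintype ι] (b : OrthonormalBasis ι ℂ E)
    (u : E ≃ₗᵢ[ℂ] E) (β : ι → Circle) (h : ∀ j, u (b j) = (β j : ℂ) • b j) :
    LinearMap.det (toEnd u) = ∏ j, (β j : ℂ) := by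
  classical
  rw [← LinearMap.det_toMatrix b.toBasis]
  have : LinearMap.toMatrix b.toBasis b.toBasis (toEnd u) = Matrix.diagonal fun j => (β j : ℂ) := by
    ext i j
    rw [LinearMap.toMatrix_apply]
    simp only [OrthonormalBasis.coe_toBasis, toEnd_apply, h, map_smul]
    by_cases hij : i = j
    · subst hij
      simp
    · simp [Matrix.diagonal_apply_ne _ hij, OrthonormalBasis.repr_self, hij]
  rw [this, Matrix.det_diagonal]

theorem exists_orthonormalBasis_pair (hE : 2 ≤ Module.finrank ℂ E) {x y : E} (hx : ‖x‖ = 1)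
    (hy : ‖y‖ = 1) (h : inner ℂ x y = (0 : ℂ)) :
    ∃ b : OrthonormalBasis (Fin (Module.finrank ℂ E)) ℂ E,
      b ⟨0, by omega⟩ = x ∧ b ⟨1, by omega⟩ = y := by
  let i0 : Fin (Module.finrank ℂ E) := ⟨0, by omega⟩
  let i1 : Fin (Module.finrank ℂ E) := ⟨1, by omega⟩
  have h01 : i1 ≠ i0 := by simp [i0, i1]
  let v : Fin (Module.finrank ℂ E) → E := fun i => if i = i0 then x else y
  have hv : Orthonormal ℂ (({i0, i1} : Set _).domRestrict v) := by
    constructor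
    · rintro ⟨i, hi⟩
      rcases hi with rfl | rfl
      · simpa [v] using hx
      · simpa [v, h01] using hy
    · rintro ⟨i, hi⟩ ⟨j, hj⟩ hij
      rcases hi with rfl | rfl <;> rcases hj with rfl | rfl
      · exact absurd rfl hij
      · simpa [v, h01] using h
      · simpa [v, h01] using inner_eq_zero_symm.1 h
      · exact absurd rfl hij
  obtain ⟨b, hb⟩ := hv.exists_orthonormalBasis_extension_of_card_eq (by simp)
  exact ⟨b, by simpa [v] using hb i0 (by simp), by
    have := hb i1 (by simp)
    simpa [v, h01] using this⟩

theorem exists_unit_orthogonal (hE : 2 ≤ Module.finrank ℂ E) (x : E) :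
    ∃ y : E, ‖y‖ = 1 ∧ inner ℂ x y = (0 : ℂ) := by
  have h : (ℂ ∙ x) ≠ ⊤ := by
    intro h
    have h1 : Module.finrank ℂ (ℂ ∙ x) ≤ 1 := by
      simpa using finrank_span_le_card (R := ℂ) ({x} : Set E)
    rw [h, finrank_top] at h1
    omega
  have h2 : (ℂ ∙ x)ᗮ ≠ ⊥ := fun h' => h (Submodule.orthogonal_eq_bot_iff.1 h')
  have := Submodule.nontrivial_iff_ne_bot.2 h2
  obtain ⟨⟨y, hy⟩, hn⟩ := exists_norm_eq (ℂ ∙ x)ᗮ zero_le_one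
  exact ⟨y, hn, Submodule.mem_orthogonal_singleton_iff_inner_right.1 hy⟩

theorem det_crefl {x : E} (hE : 2 ≤ Module.finrank ℂ E) (hx : ‖x‖ = 1) (z : Circle) :
    LinearMap.det (toEnd (crefl x z)) = z := by
  obtain ⟨y, hy, hxy⟩ := exists_unit_orthogonal hE x
  obtain ⟨b, hb, -⟩ := exists_orthonormalBasis_pair hE hx hy hxy
  rw [det_of_eigenbasis b _ (fun j => if j = ⟨0, by omega⟩ then z else 1)]
  · rw [Finset.prod_eq_single ⟨0, by omega⟩]
    · simp
    · intro j _ hj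
      simp [hj]
    · simp
  · intro j
    by_cases hj : j = ⟨0, by omega⟩
    · rw [hj, hb, crefl_apply_self hx]; simp
    · have : inner ℂ x (b j) = (0 : ℂ) := by
        rw [← hb, b.inner_eq_ite]; simp [Ne.symm hj]
      rw [crefl_apply_of_orthogonal hx this]; simp [hj]

theorem exists_isometry_pair (hE : 2 ≤ Module.finrank ℂ E) {x y x' y' : E} (hx : ‖x‖ = 1)
    (hy : ‖y‖ = 1) (h : inner ℂ x y = (0 : ℂ)) (hx' : ‖x'‖ = 1)
    (hy' : ‖y'‖ = 1) (h' : inner ℂ x' y' = (0 : ℂ)) :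
    ∃ u : E ≃ₗᵢ[ℂ] E, u x = x' ∧ u y = y' := by
  obtain ⟨b, hb0, hb1⟩ := exists_orthonormalBasis_pair hE hx hy h
  obtain ⟨b', hb0', hb1'⟩ := exists_orthonormalBasis_pair hE hx' hy' h'
  refine ⟨b.equiv b' (Equiv.refl _), ?_, ?_⟩
  · rw [← hb0, OrthonormalBasis.equiv_apply_basis]; exact hb0'
  · rw [← hb1, OrthonormalBasis.equiv_apply_basis]; exact hb1'

theorem exists_isometry_apply_eq (hE : 2 ≤ Module.finrank ℂ E) {x x' : E} (hx : ‖x‖ = 1)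
    (hx' : ‖x'‖ = 1) : ∃ u : E ≃ₗᵢ[ℂ] E, u x = x' := by
  obtain ⟨y, hy, hxy⟩ := exists_unit_orthogonal hE x
  obtain ⟨y', hy', hxy'⟩ := exists_unit_orthogonal hE x'
  obtain ⟨u, hu, -⟩ := exists_isometry_pair hE hx hy hxy hx' hy' hxy'
  exact ⟨u, hu⟩

/-- Up to a phase, a unit vector `y` is `t x + √(1 - t²) v` with `t = |⟨x, y⟩|` and `v ⟂ x`. -/
theorem exists_planar_decomposition (hE : 2 ≤ Module.finrank ℂ E) {x y : E} (hx : ‖x‖ = 1)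
    (hy : ‖y‖ = 1) : ∃ (v : E) (c : ℂ), ‖v‖ = 1 ∧ inner ℂ x v = (0 : ℂ) ∧ ‖c‖ = 1 ∧
      y = c • ((‖(inner ℂ x y : ℂ)‖ : ℂ) • x +
        (√(1 - ‖(inner ℂ x y : ℂ)‖ ^ 2) : ℂ) • v) := by
  set a : ℂ := inner ℂ x y with ha
  set w := y - a • x with hw
  have hxw : inner ℂ x w = (0 : ℂ) := by
    rw [hw, inner_sub_right, inner_smul_right, inner_self_of_norm_eq_one hx, ← ha]; ring
  have hyw : y = a • x + w := by rw [hw]; abel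
  have hnorm : ‖w‖ ^ 2 = 1 - ‖a‖ ^ 2 := by
    have := norm_add_sq_eq_norm_sq_add_norm_sq_of_inner_eq_zero (𝕜 := ℂ) (a • x) w
      (by rw [inner_smul_left, hxw, mul_zero])
    rw [← hyw, hy, norm_smul, hx] at this
    nlinarith
  have hsq : √(1 - ‖a‖ ^ 2) = ‖w‖ := by
    rw [← hnorm, Real.sqrt_sq (norm_nonneg _)]
  obtain ⟨α, hα, hαa⟩ : ∃ α : ℂ, ‖α‖ = 1 ∧ a = α * ‖a‖ := by
    by_cases h : a = 0
    · exact ⟨1, by simp, by simp [h]⟩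
    · have h' : ‖a‖ ≠ 0 := norm_ne_zero_iff.2 h
      have h'' : (‖a‖ : ℂ) ≠ 0 := by exact_mod_cast h'
      exact ⟨a / ‖a‖, by simp [h'], by field_simp⟩
  have hα0 : α ≠ 0 := norm_ne_zero_iff.1 (by rw [hα]; exact one_ne_zero)
  -- If `y` is parallel to `x`, the coefficient of `v0` is zero and any unit vector orthogonal to
  -- `x` serves.
  obtain ⟨v0, hv0, hxv0, hwv⟩ : ∃ v0 : E, ‖v0‖ = 1 ∧ inner ℂ x v0 = (0 : ℂ) ∧
      w = (‖w‖ : ℂ) • v0 := by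
    by_cases h : w = 0
    · obtain ⟨v, hv, hxv⟩ := exists_unit_orthogonal hE x
      exact ⟨v, hv, hxv, by simp [h]⟩
    · have h' : ‖w‖ ≠ 0 := norm_ne_zero_iff.2 h
      have h'' : (‖w‖ : ℂ) ≠ 0 := by exact_mod_cast h'
      refine ⟨(‖w‖ : ℂ)⁻¹ • w, by simp [norm_smul, h'], by rw [inner_smul_right, hxw, mul_zero], ?_⟩
      rw [smul_inv_smul₀ h'']
  refine ⟨α⁻¹ • v0, α, by simp [norm_smul, hα, hv0], by rw [inner_smul_right, hxv0, mul_zero],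
    hα, ?_⟩
  rw [hsq, smul_add, smul_smul, ← hαa, smul_comm (‖w‖ : ℂ), smul_inv_smul₀ hα0, ← hwv, hyw]

/-- The overlap is the only unitary invariant of a pair of lines, because both pairs reduce to the
same planar normal form. The constant `c` is there because this form fixes the second vector only up
to a phase. -/
theorem exists_isometry_of_norm_inner_eq (hE : 2 ≤ Module.finrank ℂ E) {x y x' y' : E}
    (hx : ‖x‖ = 1) (hy : ‖y‖ = 1) (hx' : ‖x'‖ = 1) (hy' : ‖y'‖ = 1)
    (h : ‖(inner ℂ x y : ℂ)‖ = ‖(inner ℂ x' y' : ℂ)‖) :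
    ∃ (u : E ≃ₗᵢ[ℂ] E) (c : ℂ), ‖c‖ = 1 ∧ u x = x' ∧ u y = c • y' := by
  obtain ⟨v, c, hv, hxv, hc, hyv⟩ := exists_planar_decomposition hE hx hy
  obtain ⟨v', c', hv', hxv', hc', hyv'⟩ := exists_planar_decomposition hE hx' hy'
  obtain ⟨u, hux, huv⟩ := exists_isometry_pair hE hx hv hxv hx' hv' hxv'
  have hc0 : c' ≠ 0 := norm_ne_zero_iff.1 (by rw [hc']; exact one_ne_zero)
  refine ⟨u, c * c'⁻¹, by simp [hc, hc'], hux, ?_⟩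
  have h1 : u y = c • ((‖(inner ℂ x' y' : ℂ)‖ : ℂ) • x' +
      (√(1 - ‖(inner ℂ x' y' : ℂ)‖ ^ 2) : ℂ) • v') := by
    conv_lhs => rw [hyv]
    rw [map_smul, map_add, map_smul, map_smul, hux, huv, h]
  rw [h1]
  conv_rhs => rw [hyv']
  rw [smul_smul, inv_mul_cancel_right₀ hc0]

end FiniteDimensionalUnitary

/-! ### Normal subgroups and perfectness of the special unitary group -/

section SpecialUnitary

variable {E : Type*} [NormedAddCommGroup E] [InnerProductSpace ℂ E]

variable (E) in
/-- The special unitary group as a group of linear isometric automorphisms. -/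
def isometrySU : Subgroup (E ≃ₗᵢ[ℂ] E) :=
  ((LinearMap.det : Module.End ℂ E →* ℂ).comp toEnd).ker

theorem mem_isometrySU {u : E ≃ₗᵢ[ℂ] E} : u ∈ isometrySU E ↔ LinearMap.det (toEnd u) = 1 := Iff.rfl

instance : (isometrySU E).Normal := MonoidHom.normal_ker _

theorem commutator_le_isometrySU (H K : Subgroup (E ≃ₗᵢ[ℂ] E)) : ⁅H, K⁆ ≤ isometrySU E := by
  rw [Subgroup.commutator_le]
  intro g _ h _
  change ((LinearMap.det : Module.End ℂ E →* ℂ).comp toEnd) (g * h * g⁻¹ * h⁻¹) = 1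
  set f := (LinearMap.det : Module.End ℂ E →* ℂ).comp (toEnd (E := E))
  have h1 : f g * f g⁻¹ = 1 := by rw [← map_mul, mul_inv_cancel, map_one]
  have h2 : f h * f h⁻¹ = 1 := by rw [← map_mul, mul_inv_cancel, map_one]
  rw [map_mul, map_mul, map_mul]
  linear_combination f h * f h⁻¹ * h1 + h2

variable [FiniteDimensional ℂ E]

theorem Circle.exists_pow_eq (d : Circle) {n : ℕ} (hn : n ≠ 0) : ∃ z : Circle, z ^ n = d := by
  refine ⟨Circle.exp (Complex.arg d / n), ?_⟩
  rw [← Circle.exp_nsmul, nsmul_eq_mul, mul_div_cancel₀ _ (by exact_mod_cast hn), Circle.exp_arg]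

/-- An `n`-th root of the inverse determinant is a suitable phase. Hence `U(E)` is `SU(E)` times
scalars, and statements insensitive to scalars pass between the two groups. -/
theorem exists_phase_mul_mem_isometrySU (u : E ≃ₗᵢ[ℂ] E) :
    ∃ z : Circle, phase z * u ∈ isometrySU E := by
  obtain ⟨b, β, hb⟩ := exists_eigenbasis u
  by_cases hn : Module.finrank ℂ E = 0
  · refine ⟨1, ?_⟩
    rw [mem_isometrySU, LinearMap.det_eq_one_of_finrank_eq_zero hn]
  · obtain ⟨z, hz⟩ := Circle.exists_pow_eq (∏ j, β j)⁻¹ hn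
    refine ⟨z, ?_⟩
    rw [mem_isometrySU, det_of_eigenbasis b _ (fun j => z * β j)]
    · have : ∏ j, (z * β j) = 1 := by
        rw [Finset.prod_mul_distrib, Finset.prod_const, Finset.card_univ, Fintype.card_fin, hz,
          inv_mul_cancel]
      change ∏ j, Circle.coeHom (z * β j) = 1
      rw [← map_prod, this, map_one]
    · intro j
      rw [isometry_mul_apply, hb, phase_apply, smul_smul, Circle.coe_mul]

/-- Complex reflections generate the unitary group: a unitary is the product of the reflections in
its eigenbasis. The induction removes one eigenvector at a time from those that are moved. -/
theorem mem_of_crefl_mem (H : Subgroup (E ≃ₗᵢ[ℂ] E))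
    (h : ∀ (y : E) (z : Circle), ‖y‖ = 1 → crefl y z ∈ H) (u : E ≃ₗᵢ[ℂ] E) : u ∈ H := by
  classical
  obtain ⟨b, β, hb⟩ := exists_eigenbasis u
  have key : ∀ (s : Finset (Fin (Module.finrank ℂ E))) (u : E ≃ₗᵢ[ℂ] E),
      (∀ j ∈ s, u (b j) = (β j : ℂ) • b j) → (∀ j ∉ s, u (b j) = b j) → u ∈ H := by
    intro s
    induction s using Finset.induction_on with
    | empty =>
      intro u _ hu
      have : u = 1 := toEnd_injective (b.toBasis.ext fun j => by simpa using hu j (by simp))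
      rw [this]; exact H.one_mem
    | insert i s hi ih =>
      intro u hu hu'
      have hbi : ‖b i‖ = 1 := b.norm_eq_one i
      have h1 : u * crefl (b i) (β i)⁻¹ ∈ H := by
        have hne : ∀ j, j ≠ i → crefl (b i) (β i)⁻¹ (b j) = b j := fun j hj =>
          crefl_apply_of_orthogonal hbi (by rw [b.inner_eq_ite]; simp [Ne.symm hj]) _
        refine ih _ (fun j hj => ?_) (fun j hj => ?_)
        · have hji : j ≠ i := by rintro rfl; exact hi hj
          rw [isometry_mul_apply, hne j hji, hu j (Finset.mem_insert_of_mem hj)]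
        · by_cases hji : j = i
          · subst hji
            rw [isometry_mul_apply, crefl_apply_self hbi, map_smul, hu j (Finset.mem_insert_self _ _),
              smul_smul, ← Circle.coe_mul, inv_mul_cancel, Circle.coe_one, one_smul]
          · rw [isometry_mul_apply, hne j hji, hu' j (by simp [hji, hj])]
      have h2 := H.mul_mem h1 (h (b i) (β i) hbi)
      rwa [mul_assoc, crefl_mul hbi, inv_mul_cancel, crefl_one hbi, mul_one] at h2
  exact key Finset.univ u (fun j _ => hb j) (fun j hj => absurd (Finset.mem_univ j) hj)

/-- Reflections in `x` and in `y` agree modulo the subgroup `N`. -/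
def ReflectionCongr (N : Subgroup (E ≃ₗᵢ[ℂ] E)) (x y : E) : Prop :=
  ∀ z, crefl x z * (crefl y z)⁻¹ ∈ N

namespace ReflectionCongr

variable {N : Subgroup (E ≃ₗᵢ[ℂ] E)} {x y w : E}

theorem refl (N : Subgroup (E ≃ₗᵢ[ℂ] E)) (x : E) : ReflectionCongr N x x := fun z => by
  rw [mul_inv_cancel]; exact N.one_mem

theorem symm (h : ReflectionCongr N x y) : ReflectionCongr N y x := fun z => by
  have := N.inv_mem (h z)
  rwa [mul_inv_rev, inv_inv] at this

theorem trans (h : ReflectionCongr N x y) (h' : ReflectionCongr N y w) : ReflectionCongr N x w :=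
  fun z => by
    have := N.mul_mem (h z) (h' z)
    rwa [mul_assoc, inv_mul_cancel_left] at this

theorem map [N.Normal] (hx : ‖x‖ = 1) (hy : ‖y‖ = 1) (h : ReflectionCongr N x y)
    (u : E ≃ₗᵢ[ℂ] E) : ReflectionCongr N (u x) (u y) := fun z => by
  have := (inferInstance : N.Normal).conj_mem _ (h z) u
  rw [← conj_crefl u hx, ← conj_crefl u hy]
  convert this using 1
  group

theorem smul_right {c : ℂ} (hy : ‖y‖ = 1) (hc : ‖c‖ = 1) :
    ReflectionCongr N x (c • y) ↔ ReflectionCongr N x y := by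
  unfold ReflectionCongr
  simp only [crefl_smul hy hc]

/-- For normal `N` the congruence is invariant under unitaries, and these act transitively on pairs
of lines with a given overlap. -/
theorem of_norm_inner_eq [N.Normal] (hE : 2 ≤ Module.finrank ℂ E) {x' y' : E}
    (hx : ‖x‖ = 1) (hy : ‖y‖ = 1) (hx' : ‖x'‖ = 1) (hy' : ‖y'‖ = 1)
    (h : ‖(inner ℂ x y : ℂ)‖ = ‖(inner ℂ x' y' : ℂ)‖) (hxy : ReflectionCongr N x y) :
    ReflectionCongr N x' y' := by
  obtain ⟨u, c, hc, hux, huy⟩ := exists_isometry_of_norm_inner_eq hE hx hy hx' hy' h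
  have := hxy.map hx hy u
  rwa [hux, huy, smul_right hy' hc] at this

end ReflectionCongr

theorem norm_combination {x v : E} (hx : ‖x‖ = 1) (hv : ‖v‖ = 1) (hxv : inner ℂ x v = (0 : ℂ))
    {a b : ℂ} (h : ‖a‖ ^ 2 + ‖b‖ ^ 2 = 1) : ‖a • x + b • v‖ = 1 := by
  have := norm_add_sq_eq_norm_sq_add_norm_sq_of_inner_eq_zero (𝕜 := ℂ) (a • x) (b • v)
      (by rw [inner_smul_left, inner_smul_right, hxv, mul_zero, mul_zero])
  rw [norm_smul, norm_smul, hx, hv, mul_one, mul_one] at this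
  nlinarith [norm_nonneg (a • x + b • v)]

theorem inner_combination {x v : E} (hx : ‖x‖ = 1) (hv : ‖v‖ = 1) (hxv : inner ℂ x v = (0 : ℂ))
    (a b a' b' : ℂ) : inner ℂ (a • x + b • v) (a' • x + b' • v) =
      (starRingEnd ℂ) a * a' + (starRingEnd ℂ) b * b' := by
  have hvx : inner ℂ v x = (0 : ℂ) := inner_eq_zero_symm.1 hxv
  simp only [inner_add_left, inner_add_right, inner_smul_left, inner_smul_right, hxv, hvx,
    inner_self_of_norm_eq_one hx, inner_self_of_norm_eq_one hv]
  ring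

/-- A non-scalar unitary moves some line by an angle strictly between `0` and `π / 2`. -/
theorem exists_moved_vector {n : E ≃ₗᵢ[ℂ] E} (hn : n ∉ scalars E) :
    ∃ x : E, ‖x‖ = 1 ∧ 1 / 2 ≤ ‖(inner ℂ (n x) x : ℂ)‖ ∧ ‖(inner ℂ (n x) x : ℂ)‖ < 1 := by
  obtain ⟨b, β, hb⟩ := exists_eigenbasis n
  obtain ⟨i, j, hij⟩ : ∃ i j, β i ≠ β j := by
    by_contra! h
    apply hn
    by_cases h0 : Module.finrank ℂ E = 0
    · have := Module.finrank_zero_iff.1 h0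
      exact ⟨1, fun ξ => Subsingleton.elim _ _⟩
    · let i0 : Fin (Module.finrank ℂ E) := ⟨0, by omega⟩
      refine ⟨β i0, fun ξ => ?_⟩
      have : toEnd n = (β i0 : ℂ) • 1 := b.toBasis.ext fun j => by
        simp [hb, h j i0]
      exact congrArg (fun f => f ξ) this
  have hne : i ≠ j := fun h => hij (by rw [h])
  have hbij : inner ℂ (b i) (b j) = (0 : ℂ) := by rw [b.inner_eq_ite]; simp [hne]
  have h3 : ‖((√3 / 2 : ℝ) : ℂ)‖ ^ 2 = 3 / 4 := by
    rw [Complex.norm_real, Real.norm_eq_abs, sq_abs, div_pow, Real.sq_sqrt (by norm_num)]; norm_num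
  -- The squared weights 1/4 and 3/4 make the overlap at least (3 - 1)/4 in modulus. Equal weights
  -- would give 0 for opposite eigenvalues. Strictness of the upper bound comes from `β i ≠ β j`.
  have hin : inner ℂ (n ((1 / 2 : ℂ) • b i + ((√3 / 2 : ℝ) : ℂ) • b j))
      ((1 / 2 : ℂ) • b i + ((√3 / 2 : ℝ) : ℂ) • b j) =
      (starRingEnd ℂ) (((β i : ℂ) + 3 * β j) / 4) := by
    rw [map_add, map_smul, map_smul, hb, hb, smul_smul, smul_smul,
      inner_combination (b.norm_eq_one i) (b.norm_eq_one j) hbij]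
    have h4 : ((√3 / 2 : ℝ) : ℂ) * ((√3 / 2 : ℝ) : ℂ) = 3 / 4 := by
      rw [← Complex.ofReal_mul, div_mul_div_comm, Real.mul_self_sqrt (by norm_num)]; norm_num
    simp only [map_mul, map_add, map_div₀, Complex.conj_ofReal, map_ofNat, map_one]
    linear_combination (starRingEnd ℂ) (β j : ℂ) * h4
  refine ⟨(1 / 2 : ℂ) • b i + ((√3 / 2 : ℝ) : ℂ) • b j,
    norm_combination (b.norm_eq_one i) (b.norm_eq_one j) hbij (by rw [h3]; norm_num), ?_, ?_⟩
  · rw [hin, RCLike.norm_conj, norm_div]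
    have h5 : ‖(3 * β j : ℂ)‖ - ‖-(β i : ℂ)‖ ≤ ‖(3 * β j : ℂ) - -(β i : ℂ)‖ := norm_sub_norm_le _ _
    rw [norm_neg, norm_mul, Circle.norm_coe, Circle.norm_coe, sub_neg_eq_add] at h5
    rw [add_comm (β i : ℂ)]
    norm_num at h5 ⊢
    linarith
  · rw [hin, RCLike.norm_conj, norm_div]
    have h5 := parallelogram_law_with_norm ℝ (β i : ℂ) (β j : ℂ)
    have h6 : 0 < ‖(β i : ℂ) - β j‖ := norm_pos_iff.2 (sub_ne_zero.2 fun h => hij (Circle.ext h))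
    rw [Circle.norm_coe, Circle.norm_coe] at h5
    have h7 : ‖(β i : ℂ) + β j‖ < 2 := by nlinarith
    have h8 : ‖((β i : ℂ) + β j) + 2 * β j‖ ≤ ‖(β i : ℂ) + β j‖ + ‖(2 * β j : ℂ)‖ := norm_add_le _ _
    rw [norm_mul, Circle.norm_coe] at h8
    have h9 : (β i : ℂ) + 3 * β j = (β i + β j) + 2 * β j := by ring
    rw [h9]
    norm_num at h8 ⊢
    linarith

/-- The modulus is 1 at `w = 1` and `|2c - 1|` at `w = -1`, so the intermediate value theorem
applies. -/
theorem exists_circle_norm_eq {c s : ℝ} (hs : |2 * c - 1| ≤ s) (hs1 : s ≤ 1) :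
    ∃ w : Circle, ‖(c : ℂ) + (1 - c) * w‖ = s := by
  let f : ℝ → ℝ := fun φ => ‖(c : ℂ) + (1 - c) * Circle.exp φ‖
  have hf : Continuous f := by fun_prop
  have h0 : f 0 = 1 := by simp [f]
  have h1 : f Real.pi = |2 * c - 1| := by
    have : (c : ℂ) + (1 - c) * Circle.exp Real.pi = ((2 * c - 1 : ℝ) : ℂ) := by
      rw [Circle.coe_exp, Complex.exp_pi_mul_I]; push_cast; ring
    simp only [f, this, Complex.norm_real, Real.norm_eq_abs]
  obtain ⟨φ, -, hφ⟩ := intermediate_value_Icc' Real.pi_pos.le hf.continuousOn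
    (show s ∈ Set.Icc (f Real.pi) (f 0) from ⟨h1 ▸ hs, h0 ▸ hs1⟩)
  exact ⟨Circle.exp φ, hφ⟩

/-- One non-scalar element makes two lines at some intermediate angle congruent, hence all pairs at
that angle. Composing two such steps reaches every sufficiently small angle, and a chain of small
steps reaches every angle. -/
theorem ReflectionCongr.of_nonscalar {N : Subgroup (E ≃ₗᵢ[ℂ] E)} [N.Normal]
    (hE : 2 ≤ Module.finrank ℂ E) {n : E ≃ₗᵢ[ℂ] E} (hnN : n ∈ N) (hn : n ∉ scalars E)
    {x y : E} (hx : ‖x‖ = 1) (hy : ‖y‖ = 1) : ReflectionCongr N x y := by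
  obtain ⟨x0, hx0, ht0, ht1⟩ := exists_moved_vector hn
  set t := ‖(inner ℂ (n x0) x0 : ℂ)‖ with ht
  -- The quotient of the two reflections is the commutator of `n` with the reflection in `x0`, which
  -- lies in the normal subgroup.
  have hcong : ReflectionCongr N (n x0) x0 := fun z => by
    rw [← conj_crefl n hx0]
    have := N.mul_mem hnN ((inferInstance : N.Normal).conj_mem _ (N.inv_mem hnN) (crefl x0 z))
    convert this using 1
    group
  have hall : ∀ {x y : E}, ‖x‖ = 1 → ‖y‖ = 1 → ‖(inner ℂ x y : ℂ)‖ = t → ReflectionCongr N x y :=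
    fun hx hy h => hcong.of_norm_inner_eq hE (by rw [n.norm_map, hx0]) hx0 hx hy (ht ▸ h.symm)
  have htt : 0 ≤ 1 - t ^ 2 := by nlinarith
  have hsq : √(1 - t ^ 2) ^ 2 = 1 - t ^ 2 := Real.sq_sqrt htt
  -- The vectors `p 1` and `p w` both have overlap `t` with `x`, so they are congruent to each
  -- other. Their mutual overlap `|t² + (1 - t²) w|` takes all values from `|2t² - 1|` to 1.
  have hnear : ∀ {x y : E}, ‖x‖ = 1 → ‖y‖ = 1 → |2 * t ^ 2 - 1| ≤ ‖(inner ℂ x y : ℂ)‖ →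
      ReflectionCongr N x y := by
    intro x y hx hy hxy
    obtain ⟨w, hw⟩ := exists_circle_norm_eq hxy (by
      simpa [hx, hy] using norm_inner_le_norm (𝕜 := ℂ) x y)
    obtain ⟨v, hv, hxv⟩ := exists_unit_orthogonal hE x
    let p : Circle → E := fun w => (t : ℂ) • x + ((√(1 - t ^ 2) : ℝ) * w : ℂ) • v
    have hp : ∀ w, ‖p w‖ = 1 := fun w => norm_combination hx hv hxv (by
      rw [norm_mul, Circle.norm_coe, mul_one, Complex.norm_real, Complex.norm_real,
        Real.norm_eq_abs, Real.norm_eq_abs, sq_abs, sq_abs, hsq]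
      ring)
    have hxp : ∀ w, ReflectionCongr N x (p w) := fun w => by
      refine hall hx (hp w) ?_
      have hx1 : x = (1 : ℂ) • x + (0 : ℂ) • v := by simp
      conv_lhs => rw [hx1]
      simp only [p]
      rw [inner_combination hx hv hxv]
      simp only [map_one, map_zero, zero_mul, add_zero, one_mul, Complex.norm_real,
        Real.norm_eq_abs]
      exact abs_of_nonneg (by linarith)
    refine ((hxp 1).symm.trans (hxp w)).of_norm_inner_eq hE (hp _) (hp _) hx hy ?_
    rw [← hw]
    simp only [p]
    rw [inner_combination hx hv hxv]
    congr 1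
    have hsq' : ((√(1 - t ^ 2) : ℝ) : ℂ) * ((√(1 - t ^ 2) : ℝ) : ℂ) = 1 - t ^ 2 := by
      rw [← pow_two, ← Complex.ofReal_pow, hsq]; push_cast; ring
    simp only [map_mul, Complex.conj_ofReal, Circle.coe_one, map_one]
    push_cast
    linear_combination (w : ℂ) * hsq'
  obtain ⟨v, c, hv, hxv, hc, hyv⟩ := exists_planar_decomposition hE hx hy
  set s := ‖(inner ℂ x y : ℂ)‖
  have hs0 : 0 ≤ s := norm_nonneg _
  have hs1 : s ≤ 1 := by simpa [hx, hy] using norm_inner_le_norm (𝕜 := ℂ) x y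
  let q : ℝ → E := fun θ => (Real.cos θ : ℂ) • x + (Real.sin θ : ℂ) • v
  have hq : ∀ θ, ‖q θ‖ = 1 := fun θ => norm_combination hx hv hxv (by
    rw [Complex.norm_real, Complex.norm_real, Real.norm_eq_abs, Real.norm_eq_abs, sq_abs, sq_abs,
      Real.cos_sq_add_sin_sq])
  have hqq : ∀ θ φ, inner ℂ (q θ) (q φ) = (Real.cos (φ - θ) : ℂ) := fun θ φ => by
    simp only [q]
    rw [inner_combination hx hv hxv, Complex.conj_ofReal, Complex.conj_ofReal, Real.cos_sub]
    push_cast; ring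
  have hyq : y = c • q (Real.arccos s) := by
    simp only [q]
    rw [Real.cos_arccos (by linarith) hs1, Real.sin_arccos]
    exact hyv
  rw [hyq, ReflectionCongr.smul_right (hq _) hc]
  -- Since `0 < t < 1`, the threshold `|2t² - 1|` is below 1, so cutting the angle from `x` to `y`
  -- into enough equal pieces makes each piece admissible.
  obtain ⟨m, hm0, hm⟩ : ∃ m : ℕ, 0 < m ∧ |2 * t ^ 2 - 1| ≤ Real.cos (Real.arccos s / m) := by
    have h1 : Filter.Tendsto (fun m : ℕ => Real.cos (Real.arccos s / m)) Filter.atTop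
        (nhds (Real.cos 0)) :=
      (Real.continuous_cos.tendsto 0).comp (tendsto_const_div_atTop_nhds_zero_nat _)
    have h2 : |2 * t ^ 2 - 1| < Real.cos 0 := by
      rw [Real.cos_zero, abs_lt]; constructor <;> nlinarith
    have h3 := (h1.eventually (lt_mem_nhds h2)).and (Filter.eventually_gt_atTop 0)
    obtain ⟨m, hm⟩ := h3.exists
    exact ⟨m, hm.2, hm.1.le⟩
  have hchain : ∀ k : ℕ, ReflectionCongr N x (q (k * (Real.arccos s / m))) := by
    intro k
    induction k with
    | zero => simpa [q] using ReflectionCongr.refl N x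
    | succ k ih =>
      refine ih.trans (hnear (hq _) (hq _) ?_)
      rw [hqq, Complex.norm_real, Real.norm_eq_abs]
      refine le_trans hm (le_trans (le_of_eq ?_) (le_abs_self _))
      congr 1; push_cast; ring
  have := hchain m
  rwa [mul_div_cancel₀ _ (by positivity)] at this

/-- A normal subgroup of `SU(E)` containing a non-scalar element is all of `SU(E)`. -/
theorem isometrySU_le_of_nonscalar (hE : 2 ≤ Module.finrank ℂ E) (N : Subgroup (E ≃ₗᵢ[ℂ] E))
    (hN : N ≤ isometrySU E) (hconj : ∀ g ∈ isometrySU E, ∀ n ∈ N, g * n * g⁻¹ ∈ N)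
    {n : E ≃ₗᵢ[ℂ] E} (hnN : n ∈ N) (hn : n ∉ scalars E) : isometrySU E ≤ N := by
  -- An arbitrary unitary is special up to a central phase, so normality under `SU(E)` is normality
  -- under `U(E)`.
  have : N.Normal := ⟨fun a ha g => by
    obtain ⟨z, hz⟩ := exists_phase_mul_mem_isometrySU g
    have := hconj _ hz a ha
    have h1 : phase z * g * a * (phase z * g)⁻¹ = phase z * (g * a * g⁻¹) * (phase z)⁻¹ := by group
    rwa [h1, (phase_commute z _).eq, mul_inv_cancel_right] at this⟩
  obtain ⟨x, hx, -⟩ := exists_moved_vector hn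
  let Z : Subgroup (E ≃ₗᵢ[ℂ] E) :=
    { carrier := Set.range (crefl x)
      one_mem' := ⟨1, crefl_one hx⟩
      mul_mem' := by
        rintro _ _ ⟨z, rfl⟩ ⟨w, rfl⟩
        exact ⟨z * w, (crefl_mul hx z w).symm⟩
      inv_mem' := by
        rintro _ ⟨z, rfl⟩
        exact ⟨z⁻¹, (crefl_inv hx z).symm⟩ }
  intro u hu
  -- Modulo `N` every reflection is one in the fixed line of `x`, and reflections generate, so `U(E)
  -- = N Z`. The determinant then detects the factor in `Z`.
  have h1 : u ∈ N ⊔ Z := by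
    refine mem_of_crefl_mem _ (fun y z hy => ?_) u
    have h2 := ReflectionCongr.of_nonscalar hE hnN hn hy hx z
    have h3 := Subgroup.mul_mem_sup h2 (show crefl x z ∈ Z from ⟨z, rfl⟩)
    rwa [inv_mul_cancel_right] at h3
  obtain ⟨a, ha, r, ⟨z, rfl⟩, rfl⟩ := Subgroup.mem_sup_of_normal_left.1 h1
  have h4 := mem_isometrySU.1 hu
  rw [map_mul, map_mul, mem_isometrySU.1 (hN ha), one_mul, det_crefl hE hx] at h4
  have h5 : z = 1 := Circle.ext h4
  rw [h5, crefl_one hx, mul_one]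
  exact ha

theorem isometrySU_eq_bot (hE : Module.finrank ℂ E ≤ 1) : isometrySU E = ⊥ := by
  rw [eq_bot_iff]
  intro u hu
  rw [Subgroup.mem_bot]
  obtain ⟨b, β, hb⟩ := exists_eigenbasis u
  have h1 := det_of_eigenbasis b u β hb
  rw [mem_isometrySU.1 hu] at h1
  refine toEnd_injective (b.toBasis.ext fun j => ?_)
  have : Subsingleton (Fin (Module.finrank ℂ E)) := Fin.subsingleton_iff_le_one.2 hE
  have h2 : ∏ j, (β j : ℂ) = β j := Fintype.prod_subsingleton _ j
  rw [h2] at h1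
  simp [hb, ← h1]

/-- Otherwise a unitary sending `x` to an orthogonal vector commutes modulo scalars with the quarter
turn about `x`. That quarter turn has nonzero trace, so they truly commute and the line of `x` is
preserved, a contradiction. -/
theorem exists_commutator_not_scalar (hE : 2 ≤ Module.finrank ℂ E) :
    ∃ g ∈ isometrySU E, ∃ h ∈ isometrySU E, g * h * g⁻¹ * h⁻¹ ∉ scalars E := by
  by_contra! hcon
  have hcomm : ∀ u v : E ≃ₗᵢ[ℂ] E, u * v * u⁻¹ * v⁻¹ ∈ scalars E := by
    intro u v
    obtain ⟨z, hz⟩ := exists_phase_mul_mem_isometrySU u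
    obtain ⟨w, hw⟩ := exists_phase_mul_mem_isometrySU v
    have h1 := hcon _ hz _ hw
    have h2 : phase z * u * (phase w * v) * (phase z * u)⁻¹ * (phase w * v)⁻¹ =
        u * v * u⁻¹ * v⁻¹ := by
      ext ξ
      simp only [mul_inv_rev, isometry_mul_apply, phase_apply, map_smul]
      have e : ∀ (z : Circle) (ξ : E), (phase z)⁻¹ ξ = ((z⁻¹ : Circle) : ℂ) • ξ := fun z ξ => rfl
      simp only [e, map_smul, smul_smul, Circle.coe_inv]
      rw [show (w * (z * ((z : ℂ)⁻¹ * (w : ℂ)⁻¹)) : ℂ) = 1 by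
        have := z.coe_ne_zero; have := w.coe_ne_zero; field_simp, one_smul]
    rwa [h2] at h1
  have hpos : Nontrivial E := Module.nontrivial_of_finrank_pos (R := ℂ) (by omega)
  obtain ⟨x, hx⟩ := exists_norm_eq E zero_le_one
  obtain ⟨v, hv, hxv⟩ := exists_unit_orthogonal hE x
  obtain ⟨u, hu⟩ := exists_isometry_apply_eq hE hx hv
  have hneg : (Circle.exp (Real.pi / 2) : ℂ) = Complex.I := by
    rw [Circle.coe_exp]; push_cast; exact Complex.exp_pi_div_two_mul_I
  have hI : (Circle.exp (Real.pi / 2) : ℂ) ≠ -1 := by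
    rw [hneg]; intro h; simpa using congrArg Complex.re h
  have hI1 : Circle.exp (Real.pi / 2) ≠ 1 := by
    intro h
    rw [h] at hneg
    simpa using congrArg Complex.re hneg
  have h3 := commute_of_commutator_mem_scalars (hcomm u (crefl x (Circle.exp (Real.pi / 2))))
    (trace_crefl_ne_zero hE hx hI)
  have h4 := apply_eq_smul_of_commute hx hI1 h3
  rw [hu, hxv, zero_smul] at h4
  exact ne_zero_of_norm_eq_one hv h4

theorem isometrySU_le_commutator : isometrySU E ≤ ⁅isometrySU E, isometrySU E⁆ := by
  by_cases hE : 2 ≤ Module.finrank ℂ E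
  · obtain ⟨g, hg, h, hh, hns⟩ := exists_commutator_not_scalar hE
    refine isometrySU_le_of_nonscalar hE _ (commutator_le_isometrySU _ _) (fun a ha n hn => ?_)
      (Subgroup.commutator_mem_commutator hg hh) hns
    exact (inferInstance : (⁅isometrySU E, isometrySU E⁆).Normal).conj_mem n hn a
  · rw [isometrySU_eq_bot (by omega)]
    exact bot_le

end SpecialUnitary

/-! ### Counting rearrangements of a finite sequence -/

section Orbits

theorem Nat.le_choose_of_pos_of_lt {n k : ℕ} (hk : 1 ≤ k) (hkn : k < n) : n ≤ n.choose k := by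
  induction n generalizing k with
  | zero => omega
  | succ n ih =>
    obtain ⟨k, rfl⟩ : ∃ j, k = j + 1 := ⟨k - 1, by omega⟩
    rw [Nat.choose_succ_succ']
    by_cases h : k = 0
    · subst h; simp
    · have h1 := ih (k := k) (by omega) (by omega)
      have h2 : 0 < n.choose (k + 1) := Nat.choose_pos (by omega)
      omega

theorem Nat.lt_choose_of_two_le {n k : ℕ} (hk : 2 ≤ k) (hkn : k + 2 ≤ n) : n < n.choose k := by
  obtain ⟨n, rfl⟩ : ∃ j, n = j + 1 := ⟨n - 1, by omega⟩
  obtain ⟨k, rfl⟩ : ∃ j, k = j + 1 := ⟨k - 1, by omega⟩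
  rw [Nat.choose_succ_succ']
  have h1 := Nat.le_choose_of_pos_of_lt (n := n) (k := k) (by omega) (by omega)
  have h2 := Nat.le_choose_of_pos_of_lt (n := n) (k := k + 1) (by omega) (by omega)
  omega

theorem exists_perm_image_eq {α : Type*} [Fintype α] [DecidableEq α] {s t : Finset α}
    (h : s.card = t.card) : ∃ σ : Equiv.Perm α, ∀ a, σ a ∈ s ↔ a ∈ t := by
  let e : {a // a ∈ t} ≃ {a // a ∈ s} := Fintype.equivOfCardEq (by simp [h])
  refine ⟨e.extendSubtype, fun a => ?_⟩
  by_cases ha : a ∈ t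
  · simp only [ha, iff_true]
    exact e.extendSubtype_mem a ha
  · simp only [ha, iff_false]
    exact e.extendSubtype_not_mem a ha

/-- If a non-constant function `β` on `n` points has at most `M` rearrangements, then `n ≤ M`; and
if moreover `M ≤ n`, then `β` is constant off one point. -/
theorem rearrangement_bound {α : Type*} {n M : ℕ} (β : Fin n → α) {i₀ j₀ : Fin n}
    (hβ : β i₀ ≠ β j₀)
    (h : ∀ (ι : Type) [Fintype ι] (σ : ι → Equiv.Perm (Fin n)),
      Function.Injective (fun i => β ∘ σ i) → Fintype.card ι ≤ M) :
    n ≤ M ∧ (M ≤ n → ∃ j a, β j ≠ a ∧ ∀ k, k ≠ j → β k = a) := by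
  classical
  -- Moving a level set of size `k` onto each of the `n.choose k` subsets of that size produces
  -- distinct rearrangements.
  have hfib : ∀ v, n.choose (Finset.univ.filter fun j => β j = v).card ≤ M := by
    intro v
    set S := Finset.univ.filter fun j => β j = v
    have hσ : ∀ A : {A // A ∈ Finset.powersetCard S.card (Finset.univ : Finset (Fin n))},
        ∃ σ : Equiv.Perm (Fin n), ∀ a, σ a ∈ S ↔ a ∈ A.1 := fun A =>
      exists_perm_image_eq (Finset.mem_powersetCard.1 A.2).2.symm
    choose σ hσ using hσ
    have h1 := h _ σ (by
      intro A B hAB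
      apply Subtype.ext
      ext a
      rw [← hσ, ← hσ]
      have h2 : β (σ A a) = β (σ B a) := congrFun hAB a
      simp [S, h2])
    simpa using h1
  have hlt : ∀ j, 1 ≤ (Finset.univ.filter fun k => β k = β j).card ∧
      (Finset.univ.filter fun k => β k = β j).card < n := by
    intro j
    constructor
    · exact Finset.card_pos.2 ⟨j, by simp⟩
    · have : (Finset.univ.filter fun k => β k = β j) ⊂ Finset.univ := by
        rw [Finset.ssubset_univ_iff]
        intro hu
        have h1 : ∀ k, β k = β j := fun k => by
          have : k ∈ (Finset.univ : Finset (Fin n)) := Finset.mem_univ k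
          rw [← hu] at this
          simpa using this
        exact hβ (by rw [h1 i₀, h1 j₀])
      simpa using Finset.card_lt_card this
  refine ⟨(Nat.le_choose_of_pos_of_lt (hlt i₀).1 (hlt i₀).2).trans (hfib _), fun hM => ?_⟩
  have hcard : ∀ j, (Finset.univ.filter fun k => β k = β j).card = 1 ∨
      (Finset.univ.filter fun k => β k = β j).card + 1 = n := by
    intro j
    by_contra! hc
    have h1 := hlt j
    have h2 := Nat.lt_choose_of_two_le (n := n)
      (k := (Finset.univ.filter fun k => β k = β j).card) (by omega) (by omega)
    have h3 := hfib (β j)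
    omega
  by_cases hbig : ∃ j, (Finset.univ.filter fun k => β k = β j).card + 1 = n
  · obtain ⟨j, hj⟩ := hbig
    have h1 : (Finset.univ.filter fun k => β k = β j)ᶜ.card = 1 := by
      rw [Finset.card_compl, Fintype.card_fin]; omega
    obtain ⟨k, hk⟩ := Finset.card_eq_one.1 h1
    have hmem : ∀ l, β l ≠ β j ↔ l = k := fun l => by
      have : l ∈ (Finset.univ.filter fun k => β k = β j)ᶜ ↔ l = k := by rw [hk]; simp
      simpa using this
    exact ⟨k, β j, (hmem k).2 rfl, fun l hl => by
      by_contra h; exact hl ((hmem l).1 h)⟩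
  · push Not at hbig
    -- If no level set has `n - 1` points, all are singletons and all `n!` rearrangements differ.
    -- Here `n ≥ 3`, since for `n = 2` a singleton has `n - 1` points; so `n! > n ≥ M`, a
    -- contradiction.
    have hinj : Function.Injective β := by
      intro a b hab
      obtain ⟨c, hc⟩ := Finset.card_eq_one.1 ((hcard b).resolve_right (hbig b))
      have ha : a ∈ Finset.univ.filter fun k => β k = β b := by simp [hab]
      have hb : b ∈ Finset.univ.filter fun k => β k = β b := by simp
      rw [hc, Finset.mem_singleton] at ha hb
      rw [ha, hb]
    have h1 := h (Equiv.Perm (Fin n)) id (by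
      intro σ τ hστ
      ext a
      exact congrArg Fin.val (hinj (congrFun hστ a)))
    rw [Fintype.card_perm, Fintype.card_fin] at h1
    have h2 := hlt i₀
    have h3 := hbig i₀
    have h4 : 3 ≤ n := by
      have := (hcard i₀).resolve_right (hbig i₀)
      omega
    have h5 := Nat.lt_factorial_self h4
    omega

end Orbits

/-! ### Projective correspondences: equal dimensions, and reflections go to reflections -/

section Correspondence

variable {E F : Type*} [NormedAddCommGroup E] [InnerProductSpace ℂ E] [FiniteDimensional ℂ E]
  [NormedAddCommGroup F] [InnerProductSpace ℂ F] [FiniteDimensional ℂ F]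

/-- A subgroup of `U(E) × U(F)` that induces an isomorphism of projective unitary groups. -/
structure ProjectiveCorrespondence (R : Subgroup ((E ≃ₗᵢ[ℂ] E) × (F ≃ₗᵢ[ℂ] F))) : Prop where
  exists_right : ∀ u, ∃ v, (u, v) ∈ R
  exists_left : ∀ v, ∃ u, (u, v) ∈ R
  scalar_iff : ∀ {u v}, (u, v) ∈ R → (u ∈ scalars E ↔ v ∈ scalars F)
  scalar_mem : ∀ {u v}, u ∈ scalars E → v ∈ scalars F → (u, v) ∈ R

namespace ProjectiveCorrespondence

variable {R : Subgroup ((E ≃ₗᵢ[ℂ] E) × (F ≃ₗᵢ[ℂ] F))}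

theorem swap (hR : ProjectiveCorrespondence R) :
    ProjectiveCorrespondence (R.comap (MulEquiv.prodComm : _ ≃* _).toMonoidHom) where
  exists_right v := hR.exists_left v
  exists_left u := hR.exists_right u
  scalar_iff h := (hR.scalar_iff h).symm
  scalar_mem hu hv := hR.scalar_mem hv hu

theorem conj_mem {u : E ≃ₗᵢ[ℂ] E} {v : F ≃ₗᵢ[ℂ] F} {a : E ≃ₗᵢ[ℂ] E} {b : F ≃ₗᵢ[ℂ] F}
    (h : (u, v) ∈ R) (hab : (a, b) ∈ R) : (u * a * u⁻¹, v * b * v⁻¹) ∈ R :=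
  R.mul_mem (R.mul_mem h hab) (R.inv_mem h)

theorem commutator_mem {u : E ≃ₗᵢ[ℂ] E} {v : F ≃ₗᵢ[ℂ] F} {a : E ≃ₗᵢ[ℂ] E} {b : F ≃ₗᵢ[ℂ] F}
    (h : (u, v) ∈ R) (hab : (a, b) ∈ R) : (u * a * u⁻¹ * a⁻¹, v * b * v⁻¹ * b⁻¹) ∈ R :=
  R.mul_mem (conj_mem h hab) (R.inv_mem hab)

/-- If `v` and `b` commute then so do `u` and `a`, provided that `a` has nonzero trace. -/
theorem commute_left (hR : ProjectiveCorrespondence R) {u : E ≃ₗᵢ[ℂ] E} {v : F ≃ₗᵢ[ℂ] F}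
    {a : E ≃ₗᵢ[ℂ] E} {b : F ≃ₗᵢ[ℂ] F} (h : (u, v) ∈ R) (hab : (a, b) ∈ R) (hvb : Commute v b)
    (ht : LinearMap.trace ℂ E (toEnd a) ≠ 0) : Commute u a := by
  refine commute_of_commutator_mem_scalars ((hR.scalar_iff (commutator_mem h hab)).2 ?_) ht
  rw [hvb.eq, mul_inv_cancel_right, mul_inv_cancel]
  exact (scalars F).one_mem

theorem commute_right (hR : ProjectiveCorrespondence R) {u : E ≃ₗᵢ[ℂ] E} {v : F ≃ₗᵢ[ℂ] F}
    {a : E ≃ₗᵢ[ℂ] E} {b : F ≃ₗᵢ[ℂ] F} (h : (u, v) ∈ R) (hab : (a, b) ∈ R) (hua : Commute u a)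
    (ht : LinearMap.trace ℂ F (toEnd b) ≠ 0) : Commute v b :=
  hR.swap.commute_left h hab hua ht

theorem crefl_map {x : E} {y : F} {z w : Circle} (hx : ‖x‖ = 1) (hy : ‖y‖ = 1)
    (h : (crefl x z, crefl y w) ∈ R) {u : E ≃ₗᵢ[ℂ] E} {v : F ≃ₗᵢ[ℂ] F} (huv : (u, v) ∈ R) :
    (crefl (u x) z, crefl (v y) w) ∈ R := by
  rw [← conj_crefl u hx, ← conj_crefl v hy]
  exact conj_mem huv h

end ProjectiveCorrespondence

theorem crefl_notMem_scalars (hE : 2 ≤ Module.finrank ℂ E) {x : E} (hx : ‖x‖ = 1) {z : Circle}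
    (hz : z ≠ 1) : crefl x z ∉ scalars E := by
  rintro ⟨c, hc⟩
  obtain ⟨y, hy, hxy⟩ := exists_unit_orthogonal hE x
  have h1 := hc x
  have h2 := hc y
  rw [crefl_apply_self hx] at h1
  rw [crefl_apply_of_orthogonal hx hxy] at h2
  have h3 := smul_left_injective ℂ (ne_zero_of_norm_eq_one hx) h1
  have h4 : (1 : ℂ) = c := smul_left_injective ℂ (ne_zero_of_norm_eq_one hy) (by simpa using h2)
  exact hz (Circle.ext (by simpa [← h4] using h3))

/-- The exponent `2n + 1` is odd, which excludes `w = -1` and so keeps traces of reflections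
nonzero. It is also prime to `n`, so a scalar whose powers with exponents `n` and `2n + 1` are both
1 must be 1. -/
theorem exists_circle_odd_order (n : ℕ) (hn : 2 ≤ n) :
    ∃ w : Circle, w ≠ 1 ∧ w ^ (2 * n + 1) = 1 := by
  refine ⟨Circle.exp (2 * Real.pi / (2 * n + 1 : ℕ)), ?_, ?_⟩
  · have hpi := Real.pi_pos
    have h0 : (0 : ℝ) < (2 * n + 1 : ℕ) := by positivity
    rw [Ne, Circle.exp_eq_one]
    rintro ⟨k, hk⟩
    rw [div_eq_iff h0.ne'] at hk
    have h1 : (k : ℝ) * (2 * n + 1 : ℕ) = 1 := by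
      have : 2 * Real.pi * ((k : ℝ) * (2 * n + 1 : ℕ) - 1) = 0 := by linear_combination -hk
      have := (mul_eq_zero.1 this).resolve_left (by positivity)
      linarith
    have h2 : k * ((2 * n + 1 : ℕ) : ℤ) = 1 := by exact_mod_cast h1
    have h3 := Int.isUnit_iff.1 (IsUnit.of_mul_eq_one _ (by rw [mul_comm]; exact h2) :
      IsUnit ((2 * n + 1 : ℕ) : ℤ))
    omega
  · rw [← Circle.exp_nsmul, nsmul_eq_mul, mul_div_cancel₀ _ (by positivity), Circle.exp_two_pi]

theorem coe_ne_neg_one_of_odd_pow {w : Circle} {n : ℕ} (h : w ^ (2 * n + 1) = 1) :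
    (w : ℂ) ≠ -1 := by
  intro hw
  have h1 : (w : ℂ) ^ (2 * n + 1) = 1 := by rw [← Circle.coe_pow, h, Circle.coe_one]
  rw [hw, Odd.neg_one_pow ⟨n, rfl⟩] at h1
  norm_num at h1

theorem eq_of_eigenbasis {ι : Type*} [Fintype ι] (b : OrthonormalBasis ι ℂ E)
    {u v : E ≃ₗᵢ[ℂ] E} (h : ∀ j, u (b j) = v (b j)) : u = v :=
  toEnd_injective (b.toBasis.ext fun j => by simpa using h j)

/-- The partner of a reflection of order prime to `2 dim F` has eigenvalues with few
rearrangements. -/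
theorem ProjectiveCorrespondence.rearrangement_le {R : Subgroup ((E ≃ₗᵢ[ℂ] E) × (F ≃ₗᵢ[ℂ] F))}
    (hR : ProjectiveCorrespondence R) (hE : 2 ≤ Module.finrank ℂ E) {n : ℕ}
    {x : E} (hx : ‖x‖ = 1) {w : Circle} (hw1 : w ≠ 1)
    (hwn : w ^ (2 * n + 1) = 1) {v : F ≃ₗᵢ[ℂ] F} (hv : (crefl x w, v) ∈ R)
    (b : OrthonormalBasis (Fin n) ℂ F) (β : Fin n → Circle)
    (hb : ∀ j, v (b j) = (β j : ℂ) • b j) (hβ : ∀ j, β j ^ (2 * n + 1) = 1)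
    (ι : Type) [Fintype ι] (σ : ι → Equiv.Perm (Fin n))
    (hσ : Function.Injective fun i => β ∘ σ i) : Fintype.card ι ≤ Module.finrank ℂ E := by
  classical
  -- Permuting the eigenbasis conjugates `v` into simultaneously diagonal, hence commuting,
  -- unitaries. Their partners are reflections in the lines of `u i x`; once these lines are shown
  -- to be pairwise orthogonal, there are at most `dim E` of them.
  let p : ι → (F ≃ₗᵢ[ℂ] F) := fun i => b.equiv b (σ i).symm
  have hp : ∀ i j, (p i * v * (p i)⁻¹) (b j) = (β (σ i j) : ℂ) • b j := by
    intro i j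
    have h1 : p i (b (σ i j)) = b j := by
      simp only [p, OrthonormalBasis.equiv_apply_basis, Equiv.symm_apply_apply]
    rw [isometry_mul_apply, isometry_mul_apply, ← h1, isometry_inv_apply_apply, hb, map_smul, h1]
  choose u hu using fun i => hR.exists_left (p i)
  have hmem : ∀ i, (crefl (u i x) w, p i * v * (p i)⁻¹) ∈ R := fun i => by
    rw [← conj_crefl (u i) hx]
    exact ProjectiveCorrespondence.conj_mem (hu i) hv
  have hnorm : ∀ i, ‖u i x‖ = 1 := fun i => by rw [(u i).norm_map, hx]
  have horth : ∀ i j, i ≠ j → inner ℂ (u i x) (u j x) = (0 : ℂ) := by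
    intro i j hij
    have hcomm : Commute (p i * v * (p i)⁻¹) (p j * v * (p j)⁻¹) := eq_of_eigenbasis b fun k => by
      rw [isometry_mul_apply (p i * v * (p i)⁻¹), isometry_mul_apply (p j * v * (p j)⁻¹), hp, hp,
        map_smul, map_smul, hp, hp, smul_comm]
    have h1 := hR.commute_left (hmem i) (hmem j) hcomm
      (trace_crefl_ne_zero hE (hnorm j) (coe_ne_neg_one_of_odd_pow hwn))
    refine (parallel_or_orthogonal_of_commute (hnorm i) (hnorm j) hw1 hw1 h1).resolve_left ?_
    -- If two lines coincided, the corresponding conjugates of `v` would differ by a scalar `d`.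
    -- Comparing products of eigenvalues gives `d ^ n = 1`, and `d ^ (2 * n + 1) = 1` holds as well,
    -- so `d = 1` and the rearrangements agree.
    rintro ⟨c, hc⟩
    have hc1 := norm_smul_eq_one (hnorm i) (hnorm j) hc
    have h2 := R.mul_mem (hmem i) (R.inv_mem (hmem j))
    rw [hc, crefl_smul (hnorm i) hc1, Prod.inv_mk, Prod.mk_mul_mk, mul_inv_cancel] at h2
    obtain ⟨d, hd⟩ := mul_inv_mem_scalars.1 ((hR.scalar_iff h2).1 (scalars E).one_mem)
    have h3 : ∀ k, (β (σ i k) : ℂ) = d * β (σ j k) := fun k => by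
      have := hd (b k)
      rw [hp, hp, smul_smul] at this
      exact smul_left_injective ℂ (b.toBasis.ne_zero k) (by simpa using this)
    by_cases hn : n = 0
    · subst hn
      exact hij (hσ (funext fun k => k.elim0))
    have h4 : d ^ (2 * n + 1) = 1 := by
      have e1 : (β (σ i ⟨0, by omega⟩) : ℂ) ^ (2 * n + 1) = 1 := by
        rw [← Circle.coe_pow, hβ, Circle.coe_one]
      have e2 : (β (σ j ⟨0, by omega⟩) : ℂ) ^ (2 * n + 1) = 1 := by
        rw [← Circle.coe_pow, hβ, Circle.coe_one]
      rw [h3, mul_pow, e2, mul_one] at e1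
      exact e1
    have h5 : d ^ n = 1 := by
      have e1 : ∏ k, (β (σ i k) : ℂ) = ∏ k, (β k : ℂ) :=
        Equiv.prod_comp (σ i) fun k => (β k : ℂ)
      have e2 : ∏ k, (β (σ j k) : ℂ) = ∏ k, (β k : ℂ) :=
        Equiv.prod_comp (σ j) fun k => (β k : ℂ)
      simp only [h3] at e1
      rw [Finset.prod_mul_distrib, Finset.prod_const, Finset.card_univ, Fintype.card_fin, e2] at e1
      have e3 : ∏ k, (β k : ℂ) ≠ 0 := Finset.prod_ne_zero_iff.2 fun k _ => (β k).coe_ne_zero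
      exact mul_right_cancel₀ e3 (by rw [e1, one_mul])
    have h6 : d = 1 := by
      rw [pow_succ, mul_comm 2 n, pow_mul, h5, one_pow, one_mul] at h4
      exact h4
    exact hij (hσ (funext fun k => Circle.ext (by simpa [h6] using h3 k)))
  have hon : Orthonormal ℂ fun i => u i x := ⟨hnorm, fun i j hij => horth i j hij⟩
  exact hon.linearIndependent.fintype_card_le_finrank

/-- Partners are ambiguous up to scalars, so one eigenvalue can be scaled to 1. The `N`-th power is
a partner of the identity, hence a scalar, and the normalized eigenvalue shows that this scalar is
1. A constant spectrum would make the reflection itself scalar. -/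
theorem ProjectiveCorrespondence.exists_normalized_partner
    {R : Subgroup ((E ≃ₗᵢ[ℂ] E) × (F ≃ₗᵢ[ℂ] F))}
    (hR : ProjectiveCorrespondence R) (hE : 2 ≤ Module.finrank ℂ E) (hF : 2 ≤ Module.finrank ℂ F)
    {x : E} (hx : ‖x‖ = 1) {w : Circle} (hw1 : w ≠ 1) {N : ℕ} (hwN : w ^ N = 1) :
    ∃ (v : F ≃ₗᵢ[ℂ] F) (b : OrthonormalBasis (Fin (Module.finrank ℂ F)) ℂ F)
      (β : Fin (Module.finrank ℂ F) → Circle), (crefl x w, v) ∈ R ∧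
      (∀ j, v (b j) = (β j : ℂ) • b j) ∧ (∀ j, β j ^ N = 1) ∧ ∃ i j, β i ≠ β j := by
  obtain ⟨v, hv⟩ := hR.exists_right (crefl x w)
  obtain ⟨b, γ, hb⟩ := exists_eigenbasis v
  let i0 : Fin (Module.finrank ℂ F) := ⟨0, by omega⟩
  let v' : F ≃ₗᵢ[ℂ] F := phase (γ i0)⁻¹ * v
  have hmem : (crefl x w, v') ∈ R := by
    have := R.mul_mem (hR.scalar_mem (scalars E).one_mem (phase_mem_scalars (γ i0)⁻¹)) hv
    simpa using this
  have hb' : ∀ j, v' (b j) = (((γ i0)⁻¹ * γ j : Circle) : ℂ) • b j := fun j => by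
    rw [show v' = phase (γ i0)⁻¹ * v from rfl, isometry_mul_apply, hb, phase_apply, smul_smul,
      Circle.coe_mul]
  refine ⟨v', b, fun j => (γ i0)⁻¹ * γ j, hmem, hb', ?_, ?_⟩
  · have h1 : (1, v' ^ N) ∈ R := by
      have := R.pow_mem hmem N
      rwa [Prod.pow_mk, crefl_pow hx, hwN, crefl_one hx] at this
    obtain ⟨c, hc⟩ := (hR.scalar_iff h1).1 (scalars E).one_mem
    have h2 : ∀ j, (v' ^ N) (b j) = ((((γ i0)⁻¹ * γ j) ^ N : Circle) : ℂ) • b j := by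
      intro j
      have : ∀ k : ℕ, (v' ^ k) (b j) =
          ((((γ i0)⁻¹ * γ j) ^ k : Circle) : ℂ) • b j := by
        intro k
        induction k with
        | zero => simp
        | succ k ih =>
          rw [pow_succ', isometry_mul_apply, ih, map_smul, hb', smul_smul, pow_succ, Circle.coe_mul _ (_ * _)]
      exact this N
    have h3 : ∀ j, ((((γ i0)⁻¹ * γ j) ^ N : Circle) : ℂ) = c := fun j =>
      smul_left_injective ℂ (b.toBasis.ne_zero j) (by
        have := (h2 j).symm.trans (hc (b j))
        simpa using this)
    intro j
    refine Circle.ext ?_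
    rw [h3 j, ← h3 i0, inv_mul_cancel, one_pow]
  · by_contra! hcon
    refine crefl_notMem_scalars hE hx hw1 ((hR.scalar_iff hmem).2 ?_)
    have : v' = phase ((γ i0)⁻¹ * γ i0) := eq_of_eigenbasis b fun j => by
      rw [hb', phase_apply]
      have := hcon j i0
      rw [this]
    rw [this]
    exact phase_mem_scalars _

theorem ProjectiveCorrespondence.finrank_le {R : Subgroup ((E ≃ₗᵢ[ℂ] E) × (F ≃ₗᵢ[ℂ] F))}
    (hR : ProjectiveCorrespondence R) (hE : 2 ≤ Module.finrank ℂ E) (hF : 2 ≤ Module.finrank ℂ F) :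
    Module.finrank ℂ F ≤ Module.finrank ℂ E := by
  have : Nontrivial E := Module.nontrivial_of_finrank_pos (R := ℂ) (by omega)
  obtain ⟨x, hx⟩ := exists_norm_eq E zero_le_one
  obtain ⟨w, hw1, hwn⟩ := exists_circle_odd_order _ hF
  obtain ⟨v, b, β, hv, hb, hβ, i, j, hij⟩ := hR.exists_normalized_partner hE hF hx hw1 hwn
  exact (rearrangement_bound β hij (hR.rearrangement_le hE hx hw1 hwn hv b β hb hβ)).1

theorem ProjectiveCorrespondence.finrank_eq {R : Subgroup ((E ≃ₗᵢ[ℂ] E) × (F ≃ₗᵢ[ℂ] F))}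
    (hR : ProjectiveCorrespondence R) (hE : 2 ≤ Module.finrank ℂ E) (hF : 2 ≤ Module.finrank ℂ F) :
    Module.finrank ℂ E = Module.finrank ℂ F :=
  le_antisymm (hR.swap.finrank_le hF hE) (hR.finrank_le hE hF)

/-- Reflections of suitable odd order correspond to reflections. -/
theorem ProjectiveCorrespondence.exists_crefl_partner
    {R : Subgroup ((E ≃ₗᵢ[ℂ] E) × (F ≃ₗᵢ[ℂ] F))}
    (hR : ProjectiveCorrespondence R) (hE : 2 ≤ Module.finrank ℂ E) (hF : 2 ≤ Module.finrank ℂ F)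
    {x : E} (hx : ‖x‖ = 1) : ∃ (n : ℕ) (w w' : Circle) (y : F), w ≠ 1 ∧ w' ≠ 1 ∧
      w ^ (2 * n + 1) = 1 ∧ w' ^ (2 * n + 1) = 1 ∧ ‖y‖ = 1 ∧ (crefl x w, crefl y w') ∈ R := by
  obtain ⟨w, hw1, hwn⟩ := exists_circle_odd_order _ hF
  obtain ⟨v, b, β, hv, hb, hβ, i, j, hij⟩ := hR.exists_normalized_partner hE hF hx hw1 hwn
  -- Because the dimensions agree, the counting bound is tight and the spectrum is constant off one
  -- point. Dividing by the common eigenvalue `a` leaves a reflection.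
  obtain ⟨k, a, hka, hk⟩ := (rearrangement_bound β hij
    (hR.rearrangement_le hE hx hw1 hwn hv b β hb hβ)).2 (hR.finrank_eq hE hF).le
  obtain ⟨l, hl⟩ : ∃ l, l ≠ k := by
    by_contra! h
    exact hij (by rw [h i, h j])
  refine ⟨_, w, a⁻¹ * β k, b k, hw1, ?_, hwn, ?_, b.norm_eq_one k, ?_⟩
  · intro h
    exact hka (by rw [inv_mul_eq_one] at h; exact h.symm)
  · rw [mul_pow, inv_pow, ← hk l hl, hβ, hβ, inv_one, one_mul]
  · have h1 := R.mul_mem (hR.scalar_mem (scalars E).one_mem (phase_mem_scalars a⁻¹)) hv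
    have h2 : phase a⁻¹ * v = crefl (b k) (a⁻¹ * β k) := eq_of_eigenbasis b fun j => by
      rw [isometry_mul_apply, hb, phase_apply, smul_smul, ← Circle.coe_mul]
      by_cases hj : j = k
      · rw [hj, crefl_apply_self (b.norm_eq_one k)]
      · rw [crefl_apply_of_orthogonal (b.norm_eq_one k) (by rw [b.inner_eq_ite]; simp [Ne.symm hj]),
          hk j hj, inv_mul_cancel, Circle.coe_one, one_smul]
    rw [Prod.mk_mul_mk, one_mul, h2] at h1
    exact h1

end Correspondence

/-! ### The correspondence of lines defined by quarter turns -/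

section QuarterTurns

variable {E F : Type*} [NormedAddCommGroup E] [InnerProductSpace ℂ E] [FiniteDimensional ℂ E]
  [NormedAddCommGroup F] [InnerProductSpace ℂ F] [FiniteDimensional ℂ F]

theorem Circle.ne_one_of_sq {c : Circle} (hc : (c : ℂ) ^ 2 = -1) : c ≠ 1 := by
  rintro rfl
  norm_num at hc

theorem Circle.coe_ne_neg_one_of_sq {c : Circle} (hc : (c : ℂ) ^ 2 = -1) : (c : ℂ) ≠ -1 := by
  intro h
  rw [h] at hc
  norm_num at hc

theorem exists_eigenvalue_of_orthogonal_lines {t : F ≃ₗᵢ[ℂ] F} {y : F} (hF : 2 ≤ Module.finrank ℂ F)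
    (hy : ‖y‖ = 1) (h : ∀ z : F, ‖z‖ = 1 → ((∃ c : ℂ, z = c • y) ∨ inner ℂ y z = (0 : ℂ)) →
      ∃ c : ℂ, t z = c • z) : ∃ a d : Circle, t = phase a * crefl y d := by
  obtain ⟨z₀, hz₀, hyz₀⟩ := exists_unit_orthogonal hF y
  obtain ⟨b, hb0, hb1⟩ := exists_orthonormalBasis_pair hF hy hz₀ hyz₀
  let i0 : Fin (Module.finrank ℂ F) := ⟨0, by omega⟩
  let i1 : Fin (Module.finrank ℂ F) := ⟨1, by omega⟩
  have h01 : i1 ≠ i0 := by simp [i0, i1]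
  have horth : ∀ j, j ≠ i0 → inner ℂ y (b j) = (0 : ℂ) := fun j hj => by
    rw [← hb0, b.inner_eq_ite, if_neg (Ne.symm hj)]
  have heig : ∀ ζ : F, inner ℂ y ζ = (0 : ℂ) → ∃ c : ℂ, t ζ = c • ζ := by
    intro ζ hζ
    by_cases h0 : ζ = 0
    · exact ⟨0, by simp [h0]⟩
    have hn : (‖ζ‖ : ℂ) ≠ 0 := by exact_mod_cast norm_ne_zero_iff.2 h0
    obtain ⟨c, hc⟩ := h ((‖ζ‖ : ℂ)⁻¹ • ζ) (by simp [norm_smul, h0])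
      (Or.inr (by rw [inner_smul_right, hζ, mul_zero]))
    refine ⟨c, ?_⟩
    rw [map_smul, smul_comm] at hc
    exact smul_right_injective F (inv_ne_zero hn) hc
  have hbj : ∀ j, ∃ c : Circle, t (b j) = (c : ℂ) • b j := by
    intro j
    have : ∃ c : ℂ, t (b j) = c • b j := by
      by_cases hj : j = i0
      · exact h _ (b.norm_eq_one j) (Or.inl ⟨1, by rw [hj, one_smul]; exact hb0⟩)
      · exact heig _ (horth j hj)
    obtain ⟨c, hc⟩ := this
    obtain ⟨z, rfl⟩ := exists_phase_of_eigenvector t (ne_zero_of_norm_eq_one (b.norm_eq_one j)) hc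
    exact ⟨z, hc⟩
  choose γ hγ using hbj
  -- The sum of two basis vectors orthogonal to `y` is again an eigenvector, which forces their
  -- eigenvalues to agree.
  have hconst : ∀ j, j ≠ i0 → γ j = γ i1 := by
    intro j hj
    by_cases hj1 : j = i1
    · rw [hj1]
    obtain ⟨c, hc⟩ := heig (b j + b i1) (by rw [inner_add_right, horth j hj, horth i1 h01, add_zero])
    rw [map_add, hγ, hγ] at hc
    have e1 := congrArg (fun ξ => (inner ℂ (b j) ξ : ℂ)) hc
    have e2 := congrArg (fun ξ => (inner ℂ (b i1) ξ : ℂ)) hc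
    simp only [inner_add_right, inner_smul_right, b.inner_eq_ite, if_neg hj1, if_neg (Ne.symm hj1),
      if_true] at e1 e2
    simp only [mul_one, mul_zero, add_zero, zero_add] at e1 e2
    exact Circle.ext (e1.trans e2.symm)
  refine ⟨γ i1, (γ i1)⁻¹ * γ i0, eq_of_eigenbasis b fun j => ?_⟩
  rw [hγ, isometry_mul_apply, phase_apply]
  by_cases hj : j = i0
  · have hb0' : b i0 = y := hb0
    rw [hj, hb0', crefl_apply_self hy, smul_smul, ← Circle.coe_mul, mul_inv_cancel_left]
  · rw [crefl_apply_of_orthogonal hy (horth j hj), hconst j hj]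

/-- The lines through the unit vectors `x` and `y` correspond under `R`, in that a quarter turn
about the first is a partner of a quarter turn about the second. -/
structure QuarterTurnRel (R : Subgroup ((E ≃ₗᵢ[ℂ] E) × (F ≃ₗᵢ[ℂ] F))) (c d : Circle) (x : E)
    (y : F) : Prop where
  norm_left : ‖x‖ = 1
  norm_right : ‖y‖ = 1
  mem : (crefl x c, crefl y d) ∈ R

/-- An odd-order reflection in `x` already has a reflection in some `y` as partner. A line equal or
orthogonal to `y` corresponds to one equal or orthogonal to `x`, whose reflection commutes with the
quarter turn. So the partner of the quarter turn preserves all these lines and is a reflection up to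
a scalar. Quarter turns matter because `d ^ 2 = c ^ 2` leaves only `d = c` or `d = -c`, the source
of the unitary and antiunitary cases. -/
theorem ProjectiveCorrespondence.exists_quarterTurnRel
    {R : Subgroup ((E ≃ₗᵢ[ℂ] E) × (F ≃ₗᵢ[ℂ] F))}
    (hR : ProjectiveCorrespondence R) (hE : 2 ≤ Module.finrank ℂ E) (hF : 2 ≤ Module.finrank ℂ F)
    {x : E} (hx : ‖x‖ = 1) {c : Circle} (hc : (c : ℂ) ^ 2 = -1) :
    ∃ (y : F) (d : Circle), (d : ℂ) ^ 2 = -1 ∧ QuarterTurnRel R c d x y := by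
  obtain ⟨n, w, w', y, hw1, hw1', hwn, hwn', hy, hmem⟩ := hR.exists_crefl_partner hE hF hx
  obtain ⟨t, ht⟩ := hR.exists_right (crefl x c)
  obtain ⟨a, d, rfl⟩ := exists_eigenvalue_of_orthogonal_lines (t := t) hF hy (by
    intro z hz hyz
    obtain ⟨v, rfl⟩ := exists_isometry_apply_eq hF hy hz
    obtain ⟨u, hu⟩ := hR.exists_left v
    have hux : ‖u x‖ = 1 := by rw [u.norm_map, hx]
    have h1 := ProjectiveCorrespondence.crefl_map hx hy hmem hu
    have h2 : Commute (crefl y w') (crefl (v y) w') := by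
      rcases hyz with ⟨c, hc⟩ | h
      · exact commute_crefl_of_parallel hy hz hc _ _
      · exact commute_crefl_of_orthogonal hy hz h _ _
    have h3 := hR.commute_left hmem h1 h2
      (trace_crefl_ne_zero hE hux (coe_ne_neg_one_of_odd_pow hwn))
    have h4 : Commute (crefl x c) (crefl (u x) w) := by
      rcases parallel_or_orthogonal_of_commute hx hux hw1 hw1 h3 with ⟨c, hc⟩ | h
      · exact commute_crefl_of_parallel hx hux hc _ _
      · exact commute_crefl_of_orthogonal hx hux h _ _
    have h5 := hR.commute_right ht h1 h4
      (trace_crefl_ne_zero hF hz (coe_ne_neg_one_of_odd_pow hwn'))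
    exact ⟨_, apply_eq_smul_of_commute hz hw1' h5⟩)
  have h6 : (crefl x c, crefl y d) ∈ R := by
    have := R.mul_mem (hR.scalar_mem (scalars E).one_mem (phase_mem_scalars a⁻¹)) ht
    have e : (phase a⁻¹ : F ≃ₗᵢ[ℂ] F) * (phase a * crefl y d) = crefl y d := by
      ext ξ
      rw [isometry_mul_apply, isometry_mul_apply, phase_apply, phase_apply, smul_smul,
        ← Circle.coe_mul, inv_mul_cancel, Circle.coe_one, one_smul]
    rwa [Prod.mk_mul_mk, one_mul, e] at this
  refine ⟨y, d, ?_, hx, hy, h6⟩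
  -- Partners are scalar together, so `c ^ 4 = 1` and `c ^ 2 ≠ 1` transfer to `d`.
  have hc2 : c ^ 2 ≠ 1 := by
    intro h
    have := congrArg (fun z : Circle => (z : ℂ)) h
    simp only [Circle.coe_pow, Circle.coe_one, hc] at this
    norm_num at this
  have hc4 : c ^ 4 = 1 := Circle.ext (by
    rw [Circle.coe_pow, show 4 = 2 * 2 from rfl, pow_mul, hc, Circle.coe_one]; norm_num)
  have hd4 : d ^ 4 = 1 := by
    by_contra h
    have h7 := R.pow_mem h6 4
    rw [Prod.pow_mk, crefl_pow hx, crefl_pow hy, hc4, crefl_one hx] at h7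
    exact crefl_notMem_scalars hF hy h ((hR.scalar_iff h7).1 (scalars E).one_mem)
  have hd2 : d ^ 2 ≠ 1 := by
    intro h
    have h7 := R.pow_mem h6 2
    rw [Prod.pow_mk, crefl_pow hx, crefl_pow hy, h, crefl_one hy] at h7
    exact crefl_notMem_scalars hE hx hc2 ((hR.scalar_iff h7).2 (scalars F).one_mem)
  have h8 : ((d : ℂ) ^ 2 - 1) * ((d : ℂ) ^ 2 + 1) = 0 := by
    have : (d : ℂ) ^ 4 = 1 := by rw [← Circle.coe_pow, hd4, Circle.coe_one]
    linear_combination this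
  rcases mul_eq_zero.1 h8 with h | h
  · exfalso
    exact hd2 (Circle.ext (by rw [Circle.coe_pow, Circle.coe_one]; linear_combination h))
  · linear_combination h

namespace QuarterTurnRel

variable {R : Subgroup ((E ≃ₗᵢ[ℂ] E) × (F ≃ₗᵢ[ℂ] F))} {c d : Circle} {x x' : E} {y y' : F}

theorem swap (h : QuarterTurnRel R c d x y) :
    QuarterTurnRel (R.comap (MulEquiv.prodComm : _ ≃* _).toMonoidHom) d c y x :=
  ⟨h.norm_right, h.norm_left, h.mem⟩

theorem map (h : QuarterTurnRel R c d x y) {u : E ≃ₗᵢ[ℂ] E} {v : F ≃ₗᵢ[ℂ] F} (huv : (u, v) ∈ R) :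
    QuarterTurnRel R c d (u x) (v y) :=
  ⟨by rw [u.norm_map, h.norm_left], by rw [v.norm_map, h.norm_right],
    ProjectiveCorrespondence.crefl_map h.norm_left h.norm_right h.mem huv⟩

theorem smul_left (h : QuarterTurnRel R c d x y) {a : ℂ} (ha : ‖a‖ = 1) :
    QuarterTurnRel R c d (a • x) y :=
  ⟨by rw [norm_smul, ha, h.norm_left, one_mul], h.norm_right, by
    rw [crefl_smul h.norm_left ha]; exact h.mem⟩

theorem exists_right (hR : ProjectiveCorrespondence R) (hE : 2 ≤ Module.finrank ℂ E)
    (h : QuarterTurnRel R c d x y) (hx' : ‖x'‖ = 1) : ∃ y', QuarterTurnRel R c d x' y' := by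
  obtain ⟨u, rfl⟩ := exists_isometry_apply_eq hE h.norm_left hx'
  obtain ⟨v, hv⟩ := hR.exists_right u
  exact ⟨v y, h.map hv⟩

theorem exists_left (hR : ProjectiveCorrespondence R) (hF : 2 ≤ Module.finrank ℂ F)
    (h : QuarterTurnRel R c d x y) (hy' : ‖y'‖ = 1) : ∃ x', QuarterTurnRel R c d x' y' := by
  obtain ⟨v, rfl⟩ := exists_isometry_apply_eq hF h.norm_right hy'
  obtain ⟨u, hu⟩ := hR.exists_left v
  exact ⟨u x, h.map hu⟩

/-- Two partners of the same quarter turn differ by a scalar; being conjugate with nonzero trace,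
they are equal. Hence the line of `y` is determined by that of `x`. -/
theorem parallel_right (hR : ProjectiveCorrespondence R) (hF : 2 ≤ Module.finrank ℂ F)
    (hd : (d : ℂ) ^ 2 = -1) (h : QuarterTurnRel R c d x y) (h' : QuarterTurnRel R c d x y') :
    ∃ a : ℂ, ‖a‖ = 1 ∧ y' = a • y := by
  have h1 := R.mul_mem h.mem (R.inv_mem h'.mem)
  rw [Prod.inv_mk, Prod.mk_mul_mk, mul_inv_cancel] at h1
  obtain ⟨a, ha⟩ := mul_inv_mem_scalars.1 ((hR.scalar_iff h1).1 (scalars E).one_mem)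
  obtain ⟨v, hv⟩ := exists_isometry_apply_eq hF h'.norm_right h.norm_right
  have ha1 : a = 1 := eq_one_of_trace (w := v) (by rw [conj_crefl v h'.norm_right, hv]) ha
    (trace_crefl_ne_zero hF h'.norm_right (Circle.coe_ne_neg_one_of_sq hd))
  have h2 : crefl y d = crefl y' d := LinearIsometryEquiv.ext fun ξ => by rw [ha, ha1, one_smul]
  have h3 : Commute (crefl y d) (crefl y' d) := by rw [h2]
  rcases parallel_or_orthogonal_of_commute h.norm_right h'.norm_right (Circle.ne_one_of_sq hd)
    (Circle.ne_one_of_sq hd) h3 with ⟨b, hb⟩ | h0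
  · exact ⟨b, norm_smul_eq_one h.norm_right h'.norm_right hb, hb⟩
  · exfalso
    have h4 : crefl y d y' = crefl y' d y' := by rw [h2]
    rw [crefl_apply_of_orthogonal h.norm_right h0, crefl_apply_self h'.norm_right] at h4
    have h5 : (1 : ℂ) = d :=
      smul_left_injective ℂ (ne_zero_of_norm_eq_one h'.norm_right) (by simpa using h4)
    exact Circle.ne_one_of_sq hd (Circle.ext (by simpa using h5.symm))

theorem orthogonal_right (hR : ProjectiveCorrespondence R) (hE : 2 ≤ Module.finrank ℂ E)
    (hF : 2 ≤ Module.finrank ℂ F) (hc : (c : ℂ) ^ 2 = -1)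
    (hd : (d : ℂ) ^ 2 = -1) (h : QuarterTurnRel R c d x y) (h' : QuarterTurnRel R c d x' y')
    (hxx : inner ℂ x x' = (0 : ℂ)) : inner ℂ y y' = (0 : ℂ) := by
  have h1 := hR.commute_right h.mem h'.mem
    (commute_crefl_of_orthogonal h.norm_left h'.norm_left hxx _ _)
    (trace_crefl_ne_zero hF h'.norm_right (Circle.coe_ne_neg_one_of_sq hd))
  refine (parallel_or_orthogonal_of_commute h.norm_right h'.norm_right (Circle.ne_one_of_sq hd)
    (Circle.ne_one_of_sq hd) h1).resolve_left ?_
  rintro ⟨a, ha⟩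
  have ha1 := norm_smul_eq_one h.norm_right h'.norm_right ha
  rw [ha] at h'
  obtain ⟨b, hb, hxb⟩ := h.swap.parallel_right hR.swap hE hc
    (⟨h.norm_right, h'.norm_left, by
      have := h'.mem; rwa [crefl_smul h.norm_right ha1] at this⟩ :
      QuarterTurnRel (R.comap (MulEquiv.prodComm : _ ≃* _).toMonoidHom) d c y x')
  rw [hxb, inner_smul_right, inner_self_of_norm_eq_one h.norm_left, mul_one] at hxx
  rw [hxx] at hb
  simp at hb

theorem orthogonal_left (hR : ProjectiveCorrespondence R) (hE : 2 ≤ Module.finrank ℂ E)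
    (hF : 2 ≤ Module.finrank ℂ F) (hc : (c : ℂ) ^ 2 = -1)
    (hd : (d : ℂ) ^ 2 = -1) (h : QuarterTurnRel R c d x y) (h' : QuarterTurnRel R c d x' y')
    (hyy : inner ℂ y y' = (0 : ℂ)) : inner ℂ x x' = (0 : ℂ) :=
  h.swap.orthogonal_right hR.swap hF hE hd hc h'.swap hyy

/-- A unitary carries one pair of lines to the other when the overlaps agree, and a partner of that
unitary carries the corresponding pairs to each other. -/
theorem norm_inner_eq (hR : ProjectiveCorrespondence R) (hE : 2 ≤ Module.finrank ℂ E)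
    (hF : 2 ≤ Module.finrank ℂ F) (hd : (d : ℂ) ^ 2 = -1) {z z' : E} {w w' : F}
    (h : QuarterTurnRel R c d x y) (h' : QuarterTurnRel R c d x' y')
    (hz : QuarterTurnRel R c d z w) (hz' : QuarterTurnRel R c d z' w')
    (hxz : ‖(inner ℂ x x' : ℂ)‖ = ‖(inner ℂ z z' : ℂ)‖) :
    ‖(inner ℂ y y' : ℂ)‖ = ‖(inner ℂ w w' : ℂ)‖ := by
  obtain ⟨u, a, ha, hux, hux'⟩ := exists_isometry_of_norm_inner_eq hE h.norm_left h'.norm_left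
    hz.norm_left hz'.norm_left hxz
  obtain ⟨v, hv⟩ := hR.exists_right u
  have h1 := h.map hv
  have h2 := h'.map hv
  rw [hux] at h1
  rw [hux'] at h2
  obtain ⟨b, hb, hwb⟩ := h1.parallel_right hR hF hd hz
  obtain ⟨b', hb', hwb'⟩ := h2.parallel_right hR hF hd (hz'.smul_left ha)
  rw [hwb, hwb', inner_smul_left, inner_smul_right, v.inner_map_map, norm_mul, norm_mul,
    RCLike.norm_conj, hb, hb', one_mul, one_mul]

/-- Overlaps of corresponding pairs of lines are related by a function. -/
theorem exists_overlap_function (hR : ProjectiveCorrespondence R) (hE : 2 ≤ Module.finrank ℂ E)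
    (hF : 2 ≤ Module.finrank ℂ F) (hd : (d : ℂ) ^ 2 = -1) :
    ∃ f : ℝ → ℝ, ∀ {x x' : E} {y y' : F}, QuarterTurnRel R c d x y → QuarterTurnRel R c d x' y' →
      ‖(inner ℂ y y' : ℂ)‖ ^ 2 = f (‖(inner ℂ x x' : ℂ)‖ ^ 2) := by
  classical
  let P : ℝ → ℝ → Prop := fun r s => ∃ (x x' : E) (y y' : F), QuarterTurnRel R c d x y ∧
    QuarterTurnRel R c d x' y' ∧ ‖(inner ℂ x x' : ℂ)‖ ^ 2 = r ∧ ‖(inner ℂ y y' : ℂ)‖ ^ 2 = s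
  -- The value 0 is only assigned to numbers that are not squared overlaps of related lines.
  refine ⟨fun r => if h : ∃ s, P r s then h.choose else 0, fun {x x' y y'} h h' => ?_⟩
  have hex : ∃ s, P (‖(inner ℂ x x' : ℂ)‖ ^ 2) s := ⟨_, x, x', y, y', h, h', rfl, rfl⟩
  simp only [dif_pos hex]
  obtain ⟨z, z', w, w', hz, hz', e1, e2⟩ := hex.choose_spec
  rw [← e2, norm_inner_eq hR hE hF hd h h' hz hz'
    ((sq_eq_sq₀ (norm_nonneg _) (norm_nonneg _)).1 e1.symm)]

end QuarterTurnRel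

end QuarterTurns

/-! ### The correspondence of lines preserves overlaps -/

section Overlaps

/-- A bounded solution of `f (2 A - 1) + f 1 = 2 f A` symmetric about `1 / 2` is the identity. -/
theorem eq_self_of_doubling {f : ℝ → ℝ} (hf : ∀ p, 0 ≤ p → p ≤ 1 → 0 ≤ f p ∧ f p ≤ 1)
    (hsymm : ∀ p, 0 ≤ p → p ≤ 1 → f (1 - p) = 1 - f p)
    (hdbl : ∀ A, 1 / 2 ≤ A → A ≤ 1 → f (2 * A - 1) + 1 = 2 * f A) {p : ℝ} (hp0 : 0 ≤ p)
    (hp1 : p ≤ 1) : f p = p := by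
  have key : ∀ n : ℕ, ∀ p, 0 ≤ p → p ≤ 1 → |f p - p| ≤ (1 / 2) ^ n := by
    intro n
    induction n with
    | zero =>
      intro p hp0 hp1
      have := hf p hp0 hp1
      rw [pow_zero, abs_le]
      constructor <;> linarith
    | succ n ih =>
      -- The doubling relation halves the error `f p - p` on the upper half of the interval, and the
      -- symmetry transports the bound to the lower half.
      have hhalf : ∀ p, 1 / 2 ≤ p → p ≤ 1 → |f p - p| ≤ (1 / 2) ^ (n + 1) := by
        intro p hp0 hp1
        have h1 := ih (2 * p - 1) (by linarith) (by linarith)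
        have h2 := hdbl p hp0 hp1
        have h3 : f p - p = (1 / 2) * (f (2 * p - 1) - (2 * p - 1)) := by linarith
        rw [h3, abs_mul, pow_succ', abs_of_pos (by norm_num : (0 : ℝ) < 1 / 2)]
        exact mul_le_mul_of_nonneg_left h1 (by norm_num)
      intro p hp0 hp1
      by_cases h : 1 / 2 ≤ p
      · exact hhalf p h hp1
      · have h1 := hhalf (1 - p) (by linarith) (by linarith)
        rw [hsymm p hp0 hp1] at h1
        rw [← abs_neg]
        convert h1 using 2
        ring
  have h1 : |f p - p| ≤ 0 := ge_of_tendsto'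
    (tendsto_pow_atTop_nhds_zero_of_lt_one (by norm_num) (by norm_num : (1 / 2 : ℝ) < 1))
    fun n => key n p hp0 hp1
  have := abs_nonpos_iff.1 h1
  linarith

variable {E F : Type*} [NormedAddCommGroup E] [InnerProductSpace ℂ E] [FiniteDimensional ℂ E]
  [NormedAddCommGroup F] [InnerProductSpace ℂ F] [FiniteDimensional ℂ F]
  {R : Subgroup ((E ≃ₗᵢ[ℂ] E) × (F ≃ₗᵢ[ℂ] F))} {c d : Circle}

/-- The component of `y'` orthogonal to `u'` and `v'` would span a line whose partner is orthogonal
to `u` and `v`, hence to `y`. That component would then be orthogonal to `y'`, so it vanishes. -/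
theorem QuarterTurnRel.mem_plane (hR : ProjectiveCorrespondence R) (hE : 2 ≤ Module.finrank ℂ E)
    (hF : 2 ≤ Module.finrank ℂ F) (hc : (c : ℂ) ^ 2 = -1) (hd : (d : ℂ) ^ 2 = -1)
    {u v y : E} {u' v' y' : F} (hu : QuarterTurnRel R c d u u') (hv : QuarterTurnRel R c d v v')
    (hy : QuarterTurnRel R c d y y') (huv : inner ℂ u v = (0 : ℂ)) {a b : ℂ}
    (hab : y = a • u + b • v) :
    y' = (inner ℂ u' y' : ℂ) • u' + (inner ℂ v' y' : ℂ) • v' := by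
  have huv' : inner ℂ u' v' = (0 : ℂ) := hu.orthogonal_right hR hE hF hc hd hv huv
  have hvu' : inner ℂ v' u' = (0 : ℂ) := inner_eq_zero_symm.1 huv'
  set w := y' - ((inner ℂ u' y' : ℂ) • u' + (inner ℂ v' y' : ℂ) • v') with hw
  have huw : inner ℂ u' w = (0 : ℂ) := by
    rw [hw, inner_sub_right, inner_add_right, inner_smul_right, inner_smul_right, huv',
      inner_self_of_norm_eq_one hu.norm_right]
    ring
  have hvw : inner ℂ v' w = (0 : ℂ) := by
    rw [hw, inner_sub_right, inner_add_right, inner_smul_right, inner_smul_right, hvu',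
      inner_self_of_norm_eq_one hv.norm_right]
    ring
  by_contra hne
  have hw0 : w ≠ 0 := sub_ne_zero.2 hne
  have hn : (‖w‖ : ℂ) ≠ 0 := by exact_mod_cast norm_ne_zero_iff.2 hw0
  obtain ⟨z, hz⟩ := hu.exists_left hR hF (y' := (‖w‖ : ℂ)⁻¹ • w) (by simp [norm_smul, hw0])
  have h1 : inner ℂ z u = (0 : ℂ) := inner_eq_zero_symm.1
    (hu.orthogonal_left hR hE hF hc hd hz (by rw [inner_smul_right, huw, mul_zero]))
  have h2 : inner ℂ z v = (0 : ℂ) := inner_eq_zero_symm.1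
    (hv.orthogonal_left hR hE hF hc hd hz (by rw [inner_smul_right, hvw, mul_zero]))
  have h3 : inner ℂ z y = (0 : ℂ) := by
    rw [hab, inner_add_right, inner_smul_right, inner_smul_right, h1, h2]; ring
  have h4 := hz.orthogonal_right hR hE hF hc hd hy h3
  have h5 : inner ℂ w y' = (0 : ℂ) := by
    rw [inner_smul_left] at h4
    refine (mul_eq_zero.1 h4).resolve_left ?_
    simpa using hw0
  have h6 : y' = w + ((inner ℂ u' y' : ℂ) • u' + (inner ℂ v' y' : ℂ) • v') := by rw [hw]; abel
  rw [h6, inner_add_right, inner_add_right, inner_smul_right, inner_smul_right,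
    inner_eq_zero_symm.1 huw, inner_eq_zero_symm.1 hvw, mul_zero, mul_zero, add_zero, add_zero] at h5
  exact hw0 (inner_self_eq_zero.1 h5)

/-- Corresponding pairs of lines have equal overlaps. -/
theorem QuarterTurnRel.norm_inner_sq_eq (hR : ProjectiveCorrespondence R)
    (hE : 2 ≤ Module.finrank ℂ E) (hF : 2 ≤ Module.finrank ℂ F) (hc : (c : ℂ) ^ 2 = -1)
    (hd : (d : ℂ) ^ 2 = -1) {x x' : E} {y y' : F} (h : QuarterTurnRel R c d x y)
    (h' : QuarterTurnRel R c d x' y') :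
    ‖(inner ℂ y y' : ℂ)‖ ^ 2 = ‖(inner ℂ x x' : ℂ)‖ ^ 2 := by
  obtain ⟨f, hf⟩ := QuarterTurnRel.exists_overlap_function (c := c) hR hE hF hd
  obtain ⟨v, hv, huv⟩ := exists_unit_orthogonal hE x
  obtain ⟨v', hvv⟩ := h.exists_right hR hE hv
  have huv' : inner ℂ y v' = (0 : ℂ) := h.orthogonal_right hR hE hF hc hd hvv huv
  have hx := h.norm_left
  have hy := h.norm_right
  have hplane : ∀ (a b : ℂ), ‖a‖ ^ 2 + ‖b‖ ^ 2 = 1 →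
      ∃ a' b' : ℂ, ‖a'‖ ^ 2 = f (‖a‖ ^ 2) ∧ ‖b'‖ ^ 2 = f (‖b‖ ^ 2) ∧ ‖a'‖ ^ 2 + ‖b'‖ ^ 2 = 1 ∧
        QuarterTurnRel R c d (a • x + b • v) (a' • y + b' • v') := by
    intro a b hab
    obtain ⟨z, hz⟩ := h.exists_right hR hE (norm_combination hx hv huv hab)
    have hz' := h.mem_plane hR hE hF hc hd hvv hz huv rfl
    have e1 := hf h hz
    have e2 := hf hvv hz
    rw [inner_add_right, inner_smul_right, inner_smul_right, huv, inner_self_of_norm_eq_one hx,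
      mul_one, mul_zero, add_zero] at e1
    rw [inner_add_right, inner_smul_right, inner_smul_right, inner_eq_zero_symm.1 huv,
      inner_self_of_norm_eq_one hv, mul_one, mul_zero, zero_add] at e2
    refine ⟨_, _, e1, e2, ?_, hz' ▸ hz⟩
    have h1 := congrArg (fun ζ => (inner ℂ ζ ζ : ℂ)) hz'
    simp only [inner_combination hy hvv.norm_right huv', inner_self_of_norm_eq_one hz.norm_right] at h1
    rw [Complex.conj_mul', Complex.conj_mul'] at h1
    exact_mod_cast h1.symm
  -- The square of a quarter turn changes the sign of the coordinate along its line, simultaneously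
  -- on both sides of the correspondence.
  have hturn : ∀ a b a' b' : ℂ, QuarterTurnRel R c d (a • x + b • v) (a' • y + b' • v') →
      QuarterTurnRel R c d ((-a) • x + b • v) ((-a') • y + b' • v') := by
    intro a b a' b' hab
    have h1 := hab.map (u := crefl x c ^ 2) (v := crefl y d ^ 2) (R.pow_mem h.mem 2)
    have e1 : (crefl x c ^ 2) (a • x + b • v) = (-a) • x + b • v := by
      rw [crefl_pow hx, map_add, map_smul, map_smul, crefl_apply_self hx,
        crefl_apply_of_orthogonal hx huv, Circle.coe_pow, hc]
      simp
    have e2 : (crefl y d ^ 2) (a' • y + b' • v') = (-a') • y + b' • v' := by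
      rw [crefl_pow hy, map_add, map_smul, map_smul, crefl_apply_self hy,
        crefl_apply_of_orthogonal hy huv', Circle.coe_pow, hd]
      simp
    rwa [e1, e2] at h1
  have hsqrt : ∀ p : ℝ, 0 ≤ p → ‖((√p : ℝ) : ℂ)‖ ^ 2 = p := fun p hp => by
    rw [Complex.norm_real, Real.norm_eq_abs, sq_abs, Real.sq_sqrt hp]
  have hbound : ∀ p, 0 ≤ p → p ≤ 1 → (0 ≤ f p ∧ f p ≤ 1) ∧ f (1 - p) = 1 - f p := by
    intro p hp0 hp1
    obtain ⟨a', b', ha, hb, hab, -⟩ := hplane (√p : ℝ) (√(1 - p) : ℝ) (by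
      rw [hsqrt p hp0, hsqrt (1 - p) (by linarith)]; ring)
    rw [hsqrt p hp0] at ha
    rw [hsqrt (1 - p) (by linarith)] at hb
    have h1 := sq_nonneg ‖a'‖
    have h2 := sq_nonneg ‖b'‖
    exact ⟨⟨by linarith, by linarith⟩, by linarith⟩
  have hdbl : ∀ A, 1 / 2 ≤ A → A ≤ 1 → f (2 * A - 1) + 1 = 2 * f A := by
    intro A hA0 hA1
    -- The vectors `√p x + √(1-p) v` and `√p x + i√(1-p) v` are used, with `p` solving `p² + (1-p)²
    -- = A`. The first has squared overlap `(1-2p)² = 2A - 1` with its own half turn, and squared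
    -- overlap `A` with both the second and the half turn of the second.
    set p := (1 + √(2 * A - 1)) / 2 with hp
    have hs0 : 0 ≤ √(2 * A - 1) := Real.sqrt_nonneg _
    have hs2 : √(2 * A - 1) ^ 2 = 2 * A - 1 := Real.sq_sqrt (by linarith)
    have hs1 : √(2 * A - 1) ≤ 1 := Real.sqrt_le_one.2 (by linarith)
    have hp0 : 0 ≤ p := by rw [hp]; linarith
    have hp1 : p ≤ 1 := by rw [hp]; linarith
    have hpA : p ^ 2 + (1 - p) ^ 2 = A := by rw [hp]; linear_combination hs2 / 2
    have hsp : ((√p : ℝ) : ℂ) * (√p : ℝ) = p := by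
      rw [← Complex.ofReal_mul, Real.mul_self_sqrt hp0]
    have hsq : ((√(1 - p) : ℝ) : ℂ) * (√(1 - p) : ℝ) = 1 - p := by
      rw [← Complex.ofReal_mul, Real.mul_self_sqrt (by linarith)]; push_cast; ring
    obtain ⟨a, b, ha, hb, hab, h1⟩ := hplane (√p : ℝ) (√(1 - p) : ℝ) (by
      rw [hsqrt p hp0, hsqrt (1 - p) (by linarith)]; ring)
    obtain ⟨a', b', ha', hb', hab', h2⟩ := hplane (√p : ℝ) (Complex.I * (√(1 - p) : ℝ)) (by
      rw [norm_mul, Complex.norm_I, one_mul, hsqrt p hp0, hsqrt (1 - p) (by linarith)]; ring)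
    have e1 := hf h1 (hturn _ _ _ _ h1)
    have e2 := hf h1 h2
    have e3 := hf h1 (hturn _ _ _ _ h2)
    rw [inner_combination hx hv huv, inner_combination hy hvv.norm_right huv'] at e1 e2 e3
    rw [hsqrt p hp0] at ha ha'
    have n1 : (starRingEnd ℂ) (√p : ℝ) * -((√p : ℝ) : ℂ) +
        (starRingEnd ℂ) (√(1 - p) : ℝ) * (√(1 - p) : ℝ) = ((1 - 2 * p : ℝ) : ℂ) := by
      rw [Complex.conj_ofReal, Complex.conj_ofReal]; push_cast; linear_combination hsq - hsp
    have n2 : (starRingEnd ℂ) (√p : ℝ) * ((√p : ℝ) : ℂ) +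
        (starRingEnd ℂ) (√(1 - p) : ℝ) * (Complex.I * (√(1 - p) : ℝ)) =
        (p : ℂ) + (1 - p : ℝ) * Complex.I := by
      rw [Complex.conj_ofReal, Complex.conj_ofReal]; push_cast
      linear_combination hsp + Complex.I * hsq
    have n3 : (starRingEnd ℂ) (√p : ℝ) * -((√p : ℝ) : ℂ) +
        (starRingEnd ℂ) (√(1 - p) : ℝ) * (Complex.I * (√(1 - p) : ℝ)) =
        ((-p : ℝ) : ℂ) + (1 - p : ℝ) * Complex.I := by
      rw [Complex.conj_ofReal, Complex.conj_ofReal]; push_cast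
      linear_combination -hsp + Complex.I * hsq
    have m1 : (starRingEnd ℂ) a * -a + (starRingEnd ℂ) b * b = ((‖b‖ ^ 2 - ‖a‖ ^ 2 : ℝ) : ℂ) := by
      rw [mul_neg, Complex.conj_mul', Complex.conj_mul']; push_cast; ring
    rw [n1, m1, Complex.norm_real, Complex.norm_real, Real.norm_eq_abs, Real.norm_eq_abs, sq_abs,
      sq_abs, show (1 - 2 * p) ^ 2 = 2 * A - 1 by linear_combination 2 * hpA] at e1
    rw [n2, Complex.sq_norm ((p : ℂ) + _), Complex.normSq_add_mul_I, hpA] at e2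
    rw [n3, Complex.sq_norm (((-p : ℝ) : ℂ) + _), Complex.normSq_add_mul_I, neg_sq, hpA] at e3
    -- On the side of `F` the parallelogram law gives `2 f A = 2 ((f p)² + (1 - f p)²)`, while `e1`
    -- gives `f (2A - 1) = (1 - 2 f p)²`. Eliminating `f p` leaves the doubling relation.
    have e4 := parallelogram_law_with_norm ℝ ((starRingEnd ℂ) b * b') ((starRingEnd ℂ) a * a')
    rw [norm_mul, norm_mul, RCLike.norm_conj, RCLike.norm_conj] at e4
    have e5 : (starRingEnd ℂ) a * a' + (starRingEnd ℂ) b * b' =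
        (starRingEnd ℂ) b * b' + (starRingEnd ℂ) a * a' := by ring
    have e6 : (starRingEnd ℂ) a * -a' + (starRingEnd ℂ) b * b' =
        (starRingEnd ℂ) b * b' - (starRingEnd ℂ) a * a' := by ring
    rw [e5] at e2
    rw [e6] at e3
    rw [e2, e3] at e4
    have hbb : ‖b‖ ^ 2 = 1 - f p := by linarith
    have hbb' : ‖b'‖ ^ 2 = 1 - f p := by linarith
    have e7 : (‖b‖ * ‖b'‖) ^ 2 + (‖a‖ * ‖a'‖) ^ 2 = (1 - f p) ^ 2 + f p ^ 2 := by
      rw [mul_pow, mul_pow, hbb, hbb', ha, ha']; ring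
    rw [e7] at e4
    rw [hbb, ha] at e1
    linarith [e1, e4]
  rw [hf h h']
  refine eq_self_of_doubling (fun p h0 h1 => (hbound p h0 h1).1) (fun p h0 h1 => (hbound p h0 h1).2)
    hdbl (by positivity) ?_
  have := norm_inner_le_norm (𝕜 := ℂ) x x'
  rw [hx, h'.norm_left, mul_one] at this
  exact pow_le_one₀ (norm_nonneg _) this

end Overlaps

/-! ### Wigner's theorem: implementation by a unitary or an antiunitary -/

section Implementation

variable {E F : Type*} [NormedAddCommGroup E] [InnerProductSpace ℂ E]
  [NormedAddCommGroup F] [InnerProductSpace ℂ F]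

/-- The rank-one endomorphism `ξ ↦ ⟨y, ξ⟩ x`. -/
def ketbra (x y : E) : Module.End ℂ E := (innerₛₗ ℂ y).smulRight x

@[simp] theorem ketbra_apply (x y ξ : E) : ketbra x y ξ = (inner ℂ y ξ : ℂ) • x := rfl

theorem mul_ketbra (A : Module.End ℂ E) (x y : E) : A * ketbra x y = ketbra (A x) y := by
  ext ξ; simp

theorem ketbra_mul_ketbra (x y z w : E) :
    ketbra x y * ketbra z w = (inner ℂ y z : ℂ) • ketbra x w := by
  ext ξ; simp [inner_smul_right, smul_smul, mul_comm]

theorem ketbra_mul_toEnd_inv (u : E ≃ₗᵢ[ℂ] E) (x y : E) :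
    ketbra x y * toEnd u⁻¹ = ketbra x (u y) := by
  ext ξ
  simp only [Module.End.mul_apply, ketbra_apply, toEnd_apply]
  rw [← u.inner_map_map, isometry_apply_inv_apply]

theorem conj_ketbra (u : E ≃ₗᵢ[ℂ] E) (x y : E) :
    toEnd u * ketbra x y * toEnd u⁻¹ = ketbra (u x) (u y) := by
  rw [mul_ketbra, ketbra_mul_toEnd_inv, toEnd_apply]

theorem ketbra_mul_mul_ketbra (A : Module.End ℂ E) (x : E) :
    ketbra x x * A * ketbra x x = (inner ℂ x (A x) : ℂ) • ketbra x x := by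
  rw [mul_assoc, mul_ketbra, ketbra_mul_ketbra]

variable [FiniteDimensional ℂ E] [FiniteDimensional ℂ F]

theorem adjoint_ketbra (x y : E) : LinearMap.adjoint (ketbra x y) = ketbra y x := by
  rw [eq_comm, LinearMap.eq_adjoint_iff]
  intro ξ η
  simp [inner_smul_left, inner_smul_right, mul_comm]

/-- The projections onto lines span the endomorphisms. -/
theorem eq_top_of_ketbra_mem (p : Submodule ℂ (Module.End ℂ E))
    (h : ∀ x : E, ‖x‖ = 1 → ketbra x x ∈ p) : p = ⊤ := by
  have h1 : ∀ x : E, ketbra x x ∈ p := by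
    intro x
    by_cases hx : x = 0
    · have : ketbra x x = 0 := by ext ξ; simp [hx]
      rw [this]; exact p.zero_mem
    have hn : (‖x‖ : ℂ) ≠ 0 := by exact_mod_cast norm_ne_zero_iff.2 hx
    have h2 := p.smul_mem ((‖x‖ : ℂ) * ‖x‖) (h ((‖x‖ : ℂ)⁻¹ • x) (by simp [norm_smul, hx]))
    convert h2 using 1
    ext ξ
    simp only [ketbra_apply, LinearMap.smul_apply, inner_smul_left, smul_smul, map_inv₀,
      Complex.conj_ofReal]
    congr 1
    field_simp
  have h2 : ∀ x y : E, ketbra x y ∈ p := by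
    intro x y
    -- Polarization.
    have e : ketbra x y = (4 : ℂ)⁻¹ • ((ketbra (x + y) (x + y) - ketbra (x - y) (x - y)) +
        Complex.I • (ketbra (x + Complex.I • y) (x + Complex.I • y) -
          ketbra (x - Complex.I • y) (x - Complex.I • y))) := by
      ext ξ
      simp only [ketbra_apply, LinearMap.smul_apply, LinearMap.add_apply, LinearMap.sub_apply,
        inner_add_left, inner_sub_left, inner_smul_left, Complex.conj_I, smul_add, smul_sub,
        smul_smul, add_smul, sub_smul]
      match_scalars
      · linear_combination ((inner ℂ y ξ : ℂ) / 2) * Complex.I_sq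
      · linear_combination (-(inner ℂ x ξ : ℂ) / 2) * Complex.I_sq
    rw [e]
    exact p.smul_mem _ (p.add_mem (p.sub_mem (h1 _) (h1 _)) (p.smul_mem _ (p.sub_mem (h1 _) (h1 _))))
  rw [eq_top_iff]
  rintro A -
  have hA : A = ∑ i, ketbra (A (stdOrthonormalBasis ℂ E i)) (stdOrthonormalBasis ℂ E i) := by
    ext ξ
    conv_lhs => rw [← (stdOrthonormalBasis ℂ E).sum_repr ξ]
    simp [LinearMap.sum_apply, OrthonormalBasis.repr_apply_apply]
  rw [hA]
  exact p.sum_mem fun i _ => h2 _ _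

theorem linearMap_ext_ketbra {V : Type*} [AddCommGroup V] [Module ℂ V]
    {f g : Module.End ℂ E →ₗ[ℂ] V} (h : ∀ x : E, ‖x‖ = 1 → f (ketbra x x) = g (ketbra x x)) :
    f = g :=
  LinearMap.eqLocus_eq_top.1 (eq_top_of_ketbra_mem _ h)

/-- The expectation `A ↦ ⟨x, A x⟩` as a linear functional. -/
def expectation (x : E) : Module.End ℂ E →ₗ[ℂ] ℂ :=
  innerₛₗ ℂ x ∘ₗ LinearMap.applyₗ x

@[simp] theorem expectation_apply (x : E) (A : Module.End ℂ E) :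
    expectation x A = inner ℂ x (A x) := rfl

theorem expectation_ketbra (x y : E) :
    expectation x (ketbra y y) = ((‖(inner ℂ x y : ℂ)‖ ^ 2 : ℝ) : ℂ) := by
  rw [expectation_apply, ketbra_apply, inner_smul_right, ← inner_conj_symm y x, Complex.conj_mul']
  push_cast; rfl

/-- An overlap-preserving correspondence of lines is induced by a linear map of endomorphisms. -/
theorem exists_linear_of_overlap {ι : Type*} (x : ι → E) (y : ι → F)
    (hxy : ∀ i j, ‖(inner ℂ (y i) (y j) : ℂ)‖ ^ 2 = ‖(inner ℂ (x i) (x j) : ℂ)‖ ^ 2)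
    (hx : ∀ e : E, ‖e‖ = 1 → ∃ i, x i = e) (hy : ∀ e : F, ‖e‖ = 1 → ∃ i, y i = e) :
    ∃ L : Module.End ℂ E →ₗ[ℂ] Module.End ℂ F, ∀ i, L (ketbra (x i) (x i)) = ketbra (y i) (y i) := by
  let Φ : (ι →₀ ℂ) →ₗ[ℂ] Module.End ℂ E :=
    Finsupp.linearCombination ℂ fun i => ketbra (x i) (x i)
  let Ψ : (ι →₀ ℂ) →ₗ[ℂ] Module.End ℂ F :=
    Finsupp.linearCombination ℂ fun i => ketbra (y i) (y i)
  have hΦ : LinearMap.range Φ = ⊤ := eq_top_of_ketbra_mem _ fun e he => by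
    obtain ⟨i, rfl⟩ := hx e he
    exact ⟨Finsupp.single i 1, by simp [Φ]⟩
  obtain ⟨g, hg⟩ := Φ.exists_rightInverse_of_surjective hΦ
  have hexp : ∀ j, expectation (y j) ∘ₗ Ψ = expectation (x j) ∘ₗ Φ := fun j => by
    ext i
    simp only [Φ, Ψ, LinearMap.comp_apply, Finsupp.lsingle_apply,
      Finsupp.linearCombination_single, one_smul, expectation_ketbra, hxy]
  -- Equal overlaps make the expectations of `Ψ a` those of `Φ a`, and over `ℂ` an operator with
  -- vanishing expectations is zero. Hence `Ψ` factors through `Φ`.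
  have hker : ∀ a, Φ a = 0 → Ψ a = 0 := by
    intro a ha
    rw [← inner_map_self_eq_zero]
    have h1 : ∀ e : F, ‖e‖ = 1 → inner ℂ e (Ψ a e) = (0 : ℂ) := by
      intro e he
      obtain ⟨j, rfl⟩ := hy e he
      have := congrArg (fun f => f a) (hexp j)
      simpa [ha] using this
    intro ζ
    rw [inner_eq_zero_symm]
    by_cases hζ : ζ = 0
    · simp [hζ]
    have hn : (‖ζ‖ : ℂ) ≠ 0 := by exact_mod_cast norm_ne_zero_iff.2 hζ
    have h2 := h1 ((‖ζ‖ : ℂ)⁻¹ • ζ) (by simp [norm_smul, hζ])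
    rw [map_smul, inner_smul_left, inner_smul_right] at h2
    simpa [hζ] using h2
  refine ⟨Ψ ∘ₗ g, fun i => ?_⟩
  have h1 : Φ (g (ketbra (x i) (x i)) - Finsupp.single i 1) = 0 := by
    have := congrArg (fun f => f (ketbra (x i) (x i))) hg
    simp only [LinearMap.comp_apply, LinearMap.id_apply] at this
    rw [map_sub, this]
    simp [Φ]
  have h2 := hker _ h1
  rw [map_sub, sub_eq_zero] at h2
  rw [LinearMap.comp_apply, h2]
  simp [Ψ]

variable {R : Subgroup ((E ≃ₗᵢ[ℂ] E) × (F ≃ₗᵢ[ℂ] F))} {c d : Circle}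

theorem toEnd_crefl {x : E} (hx : ‖x‖ = 1) (z : Circle) :
    toEnd (crefl x z) = 1 + ((z : ℂ) - 1) • ketbra x x := by
  ext ξ
  simp [crefl_apply hx, smul_smul]

theorem Circle.coe_inv_of_sq (hc : (c : ℂ) ^ 2 = -1) : ((c⁻¹ : Circle) : ℂ) = -c := by
  have h := c.coe_ne_zero
  rw [Circle.coe_inv]
  field_simp
  linear_combination hc

/-- Since `c⁻¹ = -c`, adding the expansions for `c` and `c⁻¹` isolates the anticommutator of `A`
with the projection, and subtracting them isolates `c` times the commutator. -/
theorem conj_crefl_expand (hc : (c : ℂ) ^ 2 = -1) {x : E} (hx : ‖x‖ = 1) (A : Module.End ℂ E) :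
    toEnd (crefl x c) * A * toEnd (crefl x c)⁻¹ = A + ((c : ℂ) - 1) • (ketbra x x * A) -
      ((c : ℂ) + 1) • (A * ketbra x x) + (2 : ℂ) • (ketbra x x * A * ketbra x x) := by
  rw [crefl_inv hx, toEnd_crefl hx, toEnd_crefl hx, Circle.coe_inv_of_sq hc]
  simp only [add_mul, mul_add, one_mul, mul_one, smul_mul_assoc, mul_smul_comm, smul_smul]
  match_scalars <;> first | ring1 | linear_combination -hc

/-- The correspondence of lines extends to a linear map `L` of endomorphisms that intertwines
conjugations, preserves expectations and adjoints, and is multiplicative or antimultiplicative. -/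
theorem ProjectiveCorrespondence.exists_linear (hR : ProjectiveCorrespondence R)
    (hE : 2 ≤ Module.finrank ℂ E) (hF : 2 ≤ Module.finrank ℂ F) :
    ∃ (L : Module.End ℂ E →ₗ[ℂ] Module.End ℂ F) (x : E) (y : F), ‖x‖ = 1 ∧ ‖y‖ = 1 ∧
      L (ketbra x x) = ketbra y y ∧
      (∀ u v, (u, v) ∈ R → ∀ A, L (toEnd u * A * toEnd u⁻¹) = toEnd v * L A * toEnd v⁻¹) ∧
      (∀ A, inner ℂ y (L A y) = (inner ℂ x (A x) : ℂ)) ∧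
      (∀ A, L (LinearMap.adjoint A) = LinearMap.adjoint (L A)) ∧
      ((∀ A B, L (A * B) = L A * L B) ∨ (∀ A B, L (A * B) = L B * L A)) := by
  have : Nontrivial E := Module.nontrivial_of_finrank_pos (R := ℂ) (by omega)
  obtain ⟨x₀, hx₀⟩ := exists_norm_eq E zero_le_one
  obtain ⟨c, hc⟩ : ∃ c : Circle, (c : ℂ) ^ 2 = -1 := by
    obtain ⟨c, hc⟩ := exists_circle_of_norm Complex.norm_I
    exact ⟨c, by rw [hc, Complex.I_sq]⟩
  obtain ⟨y₀, d, hd, h₀⟩ := hR.exists_quarterTurnRel hE hF hx₀ hc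
  obtain ⟨L, hL'⟩ := exists_linear_of_overlap
    (ι := {p : E × F // QuarterTurnRel R c d p.1 p.2}) (fun p => p.1.1) (fun p => p.1.2)
    (fun p q => p.2.norm_inner_sq_eq hR hE hF hc hd q.2)
    (fun e he => by
      obtain ⟨y, hy⟩ := h₀.exists_right hR hE he
      exact ⟨⟨(e, y), hy⟩, rfl⟩)
    (fun e he => by
      obtain ⟨x, hx⟩ := h₀.exists_left hR hF he
      exact ⟨⟨(x, e), hx⟩, rfl⟩)
  have hL : ∀ {x y}, QuarterTurnRel R c d x y → L (ketbra x x) = ketbra y y :=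
    fun {x y} h => hL' ⟨(x, y), h⟩
  have hexp : ∀ {x y}, QuarterTurnRel R c d x y → ∀ A, inner ℂ y (L A y) = (inner ℂ x (A x) : ℂ) := by
    intro x y h A
    have : expectation y ∘ₗ L = expectation x := linearMap_ext_ketbra fun e he => by
      obtain ⟨f, hf⟩ := h₀.exists_right hR hE he
      rw [LinearMap.comp_apply, hL hf, expectation_ketbra, expectation_ketbra,
        h.norm_inner_sq_eq hR hE hF hc hd hf]
    exact congrArg (fun f => f A) this
  have hconj : ∀ u v, (u, v) ∈ R → ∀ A,
      L (toEnd u * A * toEnd u⁻¹) = toEnd v * L A * toEnd v⁻¹ := by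
    intro u v huv A
    have : L ∘ₗ LinearMap.mulRight ℂ (toEnd u⁻¹) ∘ₗ LinearMap.mulLeft ℂ (toEnd u) =
        LinearMap.mulRight ℂ (toEnd v⁻¹) ∘ₗ LinearMap.mulLeft ℂ (toEnd v) ∘ₗ L :=
      linearMap_ext_ketbra fun e he => by
        obtain ⟨f, hf⟩ := h₀.exists_right hR hE he
        simp only [LinearMap.comp_apply, LinearMap.mulRight_apply, LinearMap.mulLeft_apply]
        rw [conj_ketbra, hL hf, conj_ketbra, hL (hf.map huv)]
    exact congrArg (fun f => f A) this
  have hadj : ∀ A, L (LinearMap.adjoint A) = LinearMap.adjoint (L A) := by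
    intro A
    let p : Submodule ℂ (Module.End ℂ E) :=
      { carrier := {A | L (LinearMap.adjoint A) = LinearMap.adjoint (L A)}
        zero_mem' := by simp
        add_mem' := by
          intro A B hA hB
          simp only [Set.mem_ofPred_eq] at *
          rw [map_add, map_add, map_add, map_add, hA, hB]
        smul_mem' := by
          intro a A hA
          simp only [Set.mem_ofPred_eq] at *
          rw [LinearEquiv.map_smulₛₗ, map_smul, map_smul, LinearEquiv.map_smulₛₗ, hA] }
    have hp : p = ⊤ := eq_top_of_ketbra_mem p fun e he => by
      obtain ⟨f, hf⟩ := h₀.exists_right hR hE he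
      change L (LinearMap.adjoint _) = LinearMap.adjoint (L _)
      rw [adjoint_ketbra, hL hf, adjoint_ketbra]
    have : A ∈ p := hp ▸ Submodule.mem_top
    exact this
  have hsum : ∀ {x y}, QuarterTurnRel R c d x y → ∀ A,
      L (ketbra x x * A) + L (A * ketbra x x) = ketbra y y * L A + L A * ketbra y y ∧
      (c : ℂ) • (L (ketbra x x * A) - L (A * ketbra x x)) =
        (d : ℂ) • (ketbra y y * L A - L A * ketbra y y) := by
    intro x y h A
    have h1 := hconj _ _ h.mem A
    have h2 := hconj _ _ (R.inv_mem h.mem) A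
    have hc' : ((c⁻¹ : Circle) : ℂ) ^ 2 = -1 := by rw [Circle.coe_inv_of_sq hc, neg_sq, hc]
    have hd' : ((d⁻¹ : Circle) : ℂ) ^ 2 = -1 := by rw [Circle.coe_inv_of_sq hd, neg_sq, hd]
    simp only [Prod.fst_inv, Prod.snd_inv] at h2
    rw [conj_crefl_expand hc h.norm_left, conj_crefl_expand hd h.norm_right] at h1
    rw [crefl_inv h.norm_left, crefl_inv h.norm_right, conj_crefl_expand hc' h.norm_left,
      conj_crefl_expand hd' h.norm_right, Circle.coe_inv_of_sq hc, Circle.coe_inv_of_sq hd] at h2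
    have h3 : L (ketbra x x * A * ketbra x x) = ketbra y y * L A * ketbra y y := by
      rw [ketbra_mul_mul_ketbra, ketbra_mul_mul_ketbra, map_smul, hL h, hexp h]
    simp only [map_add, map_sub, map_smul, h3] at h1 h2
    generalize ketbra y y * L A * ketbra y y = Z at h1 h2
    generalize L (ketbra x x * A) = P at h1 h2 ⊢
    generalize L (A * ketbra x x) = Q at h1 h2 ⊢
    generalize ketbra y y * L A = P' at h1 h2 ⊢
    generalize L A * ketbra y y = Q' at h1 h2 ⊢
    constructor
    · linear_combination (norm := module) (-(1 / 2 : ℂ)) • h1 + (-(1 / 2 : ℂ)) • h2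
    · linear_combination (norm := module) (1 / 2 : ℂ) • h1 - (1 / 2 : ℂ) • h2
  refine ⟨L, x₀, y₀, hx₀, h₀.norm_right, hL h₀, hconj, hexp h₀, hadj, ?_⟩
  have hc0 : (c : ℂ) ≠ 0 := c.coe_ne_zero
  -- `L` respects anticommutators with line projections, and it respects commutators up to the
  -- factor `d / c`. The factor 1 makes it multiplicative, the factor -1 antimultiplicative.
  have hcd : (d : ℂ) = c ∨ (d : ℂ) = -c := sq_eq_sq_iff_eq_or_eq_neg.1 (hd.trans hc.symm)
  rcases hcd with hcd | hcd
  · left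
    intro A B
    have : L ∘ₗ LinearMap.mulRight ℂ B = LinearMap.mulRight ℂ (L B) ∘ₗ L :=
      linearMap_ext_ketbra fun e he => by
        obtain ⟨f, hf⟩ := h₀.exists_right hR hE he
        simp only [LinearMap.comp_apply, LinearMap.mulRight_apply]
        obtain ⟨h1, h2⟩ := hsum hf B
        rw [hcd] at h2
        have h3 := smul_right_injective _ hc0 h2
        rw [hL hf]
        linear_combination (norm := module) (1 / 2 : ℂ) • h1 + (1 / 2 : ℂ) • h3
    exact congrArg (fun f => f A) this
  · right
    intro A B
    have : L ∘ₗ LinearMap.mulRight ℂ B = LinearMap.mulLeft ℂ (L B) ∘ₗ L :=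
      linearMap_ext_ketbra fun e he => by
        obtain ⟨f, hf⟩ := h₀.exists_right hR hE he
        simp only [LinearMap.comp_apply, LinearMap.mulRight_apply, LinearMap.mulLeft_apply]
        obtain ⟨h1, h2⟩ := hsum hf B
        rw [hcd, neg_smul, ← smul_neg] at h2
        have h3 := smul_right_injective _ hc0 h2
        rw [hL hf]
        linear_combination (norm := module) (1 / 2 : ℂ) • h1 + (1 / 2 : ℂ) • h3
    exact congrArg (fun f => f A) this

theorem exists_orthonormalBasis_eq {ι : Type*} [Fintype ι] {f : ι → F} (hf : Orthonormal ℂ f)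
    (h : Module.finrank ℂ F = Fintype.card ι) : ∃ b : OrthonormalBasis ι ℂ F, ∀ i, b i = f i := by
  obtain ⟨b, hb⟩ := Orthonormal.exists_orthonormalBasis_extension_of_card_eq (v := f)
    (s := Set.univ) h (hf.comp _ Subtype.val_injective)
  exact ⟨b, fun i => hb i trivial⟩

/-- A projective correspondence is implemented, up to scalars, by a unitary or an antiunitary. -/
theorem ProjectiveCorrespondence.exists_implementing_basis (hR : ProjectiveCorrespondence R)
    (hE : 2 ≤ Module.finrank ℂ E) (hF : 2 ≤ Module.finrank ℂ F) {ι : Type*} [Fintype ι]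
    (b : OrthonormalBasis ι ℂ E) : ∃ f : OrthonormalBasis ι ℂ F,
      (∀ u v, (u, v) ∈ R → ∃ a : ℂ, ∀ i,
        v (f i) = a • ∑ j, (inner ℂ (b j) (u (b i)) : ℂ) • f j) ∨
      (∀ u v, (u, v) ∈ R → ∃ a : ℂ, ∀ i,
        v (f i) = a • ∑ j, (starRingEnd ℂ (inner ℂ (b j) (u (b i)) : ℂ)) • f j) := by
  classical
  obtain ⟨L, x, y, hx, hy, hL, hconj, hexp, hadj, hmul⟩ := hR.exists_linear hE hF
  have hxx := inner_self_of_norm_eq_one hx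
  have hcard : Module.finrank ℂ F = Fintype.card ι := by
    rw [← hR.finrank_eq hE hF, Module.finrank_eq_card_basis b.toBasis]
  rcases hmul with hmul | hmul
  -- As in the Gelfand–Naimark–Segal construction, `y` is a reference vector whose expectation pulls
  -- back under `L` to that of `x`; hence `W` is isometric.
  · let W : E →ₗ[ℂ] F :=
      { toFun := fun ξ => L (ketbra ξ x) y
        map_add' := fun ξ η => by
          have : ketbra (ξ + η) x = ketbra ξ x + ketbra η x := by ext; simp
          rw [this, map_add, LinearMap.add_apply]
        map_smul' := fun a ξ => by
          have : ketbra (a • ξ) x = a • ketbra ξ x := by ext; simp [smul_comm a]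
          rw [this, map_smul, LinearMap.smul_apply, RingHom.id_apply] }
    have hW : ∀ ξ η, inner ℂ (W ξ) (W η) = (inner ℂ ξ η : ℂ) := by
      intro ξ η
      change inner ℂ (L (ketbra ξ x) y) (L (ketbra η x) y) = _
      rw [← LinearMap.adjoint_inner_right, ← hadj, adjoint_ketbra, ← Module.End.mul_apply, ← hmul,
        hexp, ketbra_mul_ketbra, LinearMap.smul_apply, ketbra_apply, hxx, one_smul,
        inner_smul_right, hxx, mul_one]
    obtain ⟨f, hf⟩ := exists_orthonormalBasis_eq (f := fun i => W (b i))
      (orthonormal_iff_ite.2 fun i j => by rw [hW, b.inner_eq_ite]) hcard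
    refine ⟨f, Or.inl fun u v huv => ⟨inner ℂ y (L (ketbra x (u x)) (v y)), fun i => ?_⟩⟩
    have h1 : ∀ ξ, v (W ξ) = (inner ℂ y (L (ketbra x (u x)) (v y)) : ℂ) • W (u ξ) := by
      intro ξ
      change v (L (ketbra ξ x) y) = _ • L (ketbra (u ξ) x) y
      have h2 := congrArg (fun f => f (v y)) (hconj u v huv (ketbra ξ x))
      simp only [Module.End.mul_apply, toEnd_apply, isometry_inv_apply_apply] at h2
      rw [← h2, conj_ketbra]
      -- The middle factor maps under `L` to the projection onto `y`, which turns the last factor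
      -- into a scalar independent of `ξ`.
      have h3 : ketbra (u ξ) (u x) = ketbra (u ξ) x * (ketbra x x * ketbra x (u x)) := by
        rw [ketbra_mul_ketbra, hxx, one_smul, ketbra_mul_ketbra, hxx, one_smul]
      rw [h3, hmul, hmul, hL, Module.End.mul_apply, Module.End.mul_apply, ketbra_apply, map_smul]
    rw [hf, h1]
    congr 1
    conv_lhs => rw [← b.sum_repr (u (b i)), map_sum]
    simp only [map_smul, hf, OrthonormalBasis.repr_apply_apply]
  -- Reversal of products forces the variable into the bra, so `W` is antilinear.
  · let W : E →ₛₗ[starRingEnd ℂ] F :=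
      { toFun := fun ξ => L (ketbra x ξ) y
        map_add' := fun ξ η => by
          have : ketbra x (ξ + η) = ketbra x ξ + ketbra x η := by
            ext; simp [inner_add_left, add_smul]
          rw [this, map_add, LinearMap.add_apply]
        map_smul' := fun a ξ => by
          have : ketbra x (a • ξ) = (starRingEnd ℂ) a • ketbra x ξ := by
            ext; simp [smul_smul, mul_comm]
          rw [this, map_smul, LinearMap.smul_apply] }
    have hW : ∀ ξ η, inner ℂ (W ξ) (W η) = (inner ℂ η ξ : ℂ) := by
      intro ξ η
      change inner ℂ (L (ketbra x ξ) y) (L (ketbra x η) y) = _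
      rw [← LinearMap.adjoint_inner_right, ← hadj, adjoint_ketbra, ← Module.End.mul_apply, ← hmul,
        hexp, ketbra_mul_ketbra, LinearMap.smul_apply, ketbra_apply, hxx, one_smul,
        inner_smul_right, hxx, mul_one]
    obtain ⟨f, hf⟩ := exists_orthonormalBasis_eq (f := fun i => W (b i))
      (orthonormal_iff_ite.2 fun i j => by
        rw [hW, b.inner_eq_ite]; simp [eq_comm]) hcard
    refine ⟨f, Or.inr fun u v huv => ⟨inner ℂ y (L (ketbra (u x) x) (v y)), fun i => ?_⟩⟩
    have h1 : ∀ ξ, v (W ξ) = (inner ℂ y (L (ketbra (u x) x) (v y)) : ℂ) • W (u ξ) := by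
      intro ξ
      change v (L (ketbra x ξ) y) = _ • L (ketbra x (u ξ)) y
      have h2 := congrArg (fun f => f (v y)) (hconj u v huv (ketbra x ξ))
      simp only [Module.End.mul_apply, toEnd_apply, isometry_inv_apply_apply] at h2
      rw [← h2, conj_ketbra]
      have h3 : ketbra (u x) (u ξ) = (ketbra (u x) x * ketbra x x) * ketbra x (u ξ) := by
        rw [ketbra_mul_ketbra, hxx, one_smul, ketbra_mul_ketbra, hxx, one_smul]
      rw [h3, hmul, hmul, hL, Module.End.mul_apply, Module.End.mul_apply, ketbra_apply, map_smul]
    rw [hf, h1]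
    congr 1
    conv_lhs => rw [← b.sum_repr (u (b i)), map_sum]
    simp only [LinearMap.map_smulₛₗ, hf, OrthonormalBasis.repr_apply_apply]

end Implementation

/-! ### Joint surjectivity onto perfect groups -/

section JointSurjectivity

variable {Γ ι : Type*} [Group Γ] {S : ι → Type*} [∀ i, Group (S i)] {N : ∀ i, Subgroup (S i)}
  {π : ∀ i, Γ →* S i} {K : Subgroup Γ}

/-- Homomorphisms onto perfect groups that are pairwise jointly surjective remain surjective on the
intersection of the kernels of finitely many of the others. -/
theorem le_map_inf_ker (hperf : ∀ i, N i ≤ ⁅N i, N i⁆) (hsurj : ∀ i, N i ≤ K.map (π i))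
    (hpair : ∀ i j, i ≠ j → N i ≤ (K ⊓ (π j).ker).map (π i)) (F : Finset ι) :
    ∀ i ∉ F, N i ≤ (K ⊓ ⨅ j ∈ F, (π j).ker).map (π i) := by
  classical
  induction F using Finset.induction_on with
  | empty => intro i _; simpa using hsurj i
  | insert j F _ ih =>
    intro i hi
    rw [Finset.mem_insert, not_or] at hi
    -- A commutator of an element killed by `π j` with one killed by every `π k`, `k ∈ F`, is killed
    -- by all of them; perfectness says that such commutators suffice.
    refine (hperf i).trans ((Subgroup.commutator_mono (hpair i j hi.1) (ih i hi.2)).trans ?_)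
    rw [← Subgroup.map_commutator]
    refine Subgroup.map_mono (Subgroup.commutator_le.2 fun g hg h hh => ?_)
    simp only [Finset.mem_insert, iInf_or, iInf_inf_eq, iInf_iInf_eq_left, Subgroup.mem_inf,
      Subgroup.mem_iInf, MonoidHom.mem_ker] at hg hh ⊢
    refine ⟨K.mul_mem (K.mul_mem (K.mul_mem hg.1 hh.1) (K.inv_mem hg.1)) (K.inv_mem hh.1), ?_,
      fun k hk => ?_⟩
    · change π j (g * h * g⁻¹ * h⁻¹) = 1
      simp [hg.2]
    · change π k (g * h * g⁻¹ * h⁻¹) = 1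
      simp [hh.2 k hk]

/-- Coordinates are corrected one at a time: the factor repairing coordinate `j` is trivial at the
coordinates already settled. -/
theorem exists_forall_map_eq [Finite ι] (hperf : ∀ i, N i ≤ ⁅N i, N i⁆)
    (hsurj : ∀ i, N i ≤ K.map (π i))
    (hpair : ∀ i j, i ≠ j → N i ≤ (K ⊓ (π j).ker).map (π i))
    (hle : ∀ i, K.map (π i) ≤ N i) (a : ∀ i, S i) (ha : ∀ i, a i ∈ N i) :
    ∃ V ∈ K, ∀ i, π i V = a i := by
  classical
  have := Fintype.ofFinite ι
  have key : ∀ F : Finset ι, ∃ V ∈ K, ∀ i ∈ F, π i V = a i := by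
    intro F
    induction F using Finset.induction_on with
    | empty => exact ⟨1, K.one_mem, by simp⟩
    | insert j F hj ih =>
      obtain ⟨V, hV, hVF⟩ := ih
      obtain ⟨W, hW, hWj⟩ := le_map_inf_ker hperf hsurj hpair F j hj
        ((N j).mul_mem (ha j) ((N j).inv_mem (hle j ⟨V, hV, rfl⟩)))
      simp only [SetLike.mem_coe, Subgroup.mem_inf, Subgroup.mem_iInf, MonoidHom.mem_ker] at hW
      refine ⟨W * V, K.mul_mem hW.1 hV, fun i hi => ?_⟩
      rcases Finset.mem_insert.1 hi with rfl | hi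
      · rw [map_mul, hWj, inv_mul_cancel_right]
      · rw [map_mul, hW.2 i hi, one_mul, hVF i hi]
  obtain ⟨V, hV, h⟩ := key Finset.univ
  exact ⟨V, hV, fun i => h i (Finset.mem_univ i)⟩

end JointSurjectivity

/-- Homomorphisms into an algebra that agree up to scalars agree on commutators. -/
theorem eq_on_commutator_of_smul {Γ A : Type*} [Group Γ] [Ring A] [Algebra ℂ A] {α β : Γ →* A}
    {T : Subgroup Γ} (h : ∀ V ∈ T, ∃ a : ℂ, β V = a • α V) : ∀ V ∈ ⁅T, T⁆, β V = α V := by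
  have hinv : ∀ g ∈ T, ∃ a a' : ℂ, β g = a • α g ∧ β g⁻¹ = a' • α g⁻¹ ∧
      ∀ x : A, (a * a') • x = x := by
    intro g hg
    obtain ⟨a, ha⟩ := h g hg
    obtain ⟨a', ha'⟩ := h g⁻¹ (T.inv_mem hg)
    refine ⟨a, a', ha, ha', fun x => ?_⟩
    have h1 : (1 : A) = (a * a') • (1 : A) := by
      rw [← map_one α, ← mul_inv_cancel g, map_mul, ← smul_mul_smul_comm, ← ha, ← ha', ← map_mul,
        ← map_mul, mul_inv_cancel, map_one, map_one]
    rw [← one_mul x, ← smul_mul_assoc, ← h1]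
  have : ⁅T, T⁆ ≤ MonoidHom.eqLocus β α := by
    refine Subgroup.commutator_le.2 fun g hg k hk => ?_
    obtain ⟨a, a', h1, h2, h3⟩ := hinv g hg
    obtain ⟨c, c', h4, h5, h6⟩ := hinv k hk
    change β (g * k * g⁻¹ * k⁻¹) = α (g * k * g⁻¹ * k⁻¹)
    simp only [map_mul, h1, h2, h4, h5, smul_mul_smul_comm]
    rw [show a * c * a' * c' = (a * a') * (c * c') by ring, mul_smul, h6, h3]
  exact fun V hV => this hV

/-! ### Two sectors: independent, or related by a unitary or an antiunitary -/

section PairDichotomy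

variable {E F : Type*} [NormedAddCommGroup E] [InnerProductSpace ℂ E] [FiniteDimensional ℂ E]
  [NormedAddCommGroup F] [InnerProductSpace ℂ F] [FiniteDimensional ℂ F]
  {Γ : Type*} [Group Γ] {p : Γ →* (E ≃ₗᵢ[ℂ] E)} {q : Γ →* (F ≃ₗᵢ[ℂ] F)} {T : Subgroup Γ}

/-- Commutators have determinant 1, and `SU(E)` is perfect. -/
theorem map_commutator_eq_isometrySU (hp : isometrySU E ≤ T.map p) :
    (⁅T, T⁆).map p = isometrySU E := by
  rw [Subgroup.map_commutator]
  exact le_antisymm (commutator_le_isometrySU _ _)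
    (isometrySU_le_commutator.trans (Subgroup.commutator_mono hp hp))

/-- Goursat's alternative for a quasi-simple image. -/
theorem isometrySU_le_map_ker_or (hp : isometrySU E ≤ T.map p) :
    isometrySU E ≤ (⁅T, T⁆ ⊓ q.ker).map p ∨
      2 ≤ Module.finrank ℂ E ∧ ∀ V ∈ ⁅T, T⁆, q V = 1 → p V ∈ scalars E := by
  by_cases hE : 2 ≤ Module.finrank ℂ E
  · by_cases h : ∀ V ∈ ⁅T, T⁆, q V = 1 → p V ∈ scalars E
    · exact Or.inr ⟨hE, h⟩
    · push Not at h
      obtain ⟨V, hV, hq, hn⟩ := h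
      refine Or.inl (isometrySU_le_of_nonscalar hE _ ?_ ?_ ⟨V, ⟨hV, hq⟩, rfl⟩ hn)
      · exact (Subgroup.map_mono inf_le_left).trans (map_commutator_eq_isometrySU hp).le
      · rintro g hg _ ⟨W, ⟨hW, hqW⟩, rfl⟩
        rw [← map_commutator_eq_isometrySU hp] at hg
        obtain ⟨X, hX, rfl⟩ := hg
        refine ⟨X * W * X⁻¹, ⟨Subgroup.mul_mem _ (Subgroup.mul_mem _ hX hW)
          (Subgroup.inv_mem _ hX), ?_⟩, by simp⟩
        replace hqW : q W = 1 := hqW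
        change q (X * W * X⁻¹) = 1
        simp [hqW]
  · left
    rw [isometrySU_eq_bot (by omega)]
    exact bot_le

/-- An element `V` is corrected by some `W` in the kernel of `q` with `p W = p V`; then `W⁻¹ V` lies
in the kernel of `p` and has the same image under `q`. -/
theorem isometrySU_le_map_ker_symm (hq : isometrySU F ≤ T.map q) (hp : isometrySU E ≤ T.map p)
    (h : isometrySU E ≤ (⁅T, T⁆ ⊓ q.ker).map p) : isometrySU F ≤ (⁅T, T⁆ ⊓ p.ker).map q := by
  intro a ha
  rw [← map_commutator_eq_isometrySU hq] at ha
  obtain ⟨V, hV, rfl⟩ := ha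
  obtain ⟨W, ⟨hW, hqW⟩, hpW⟩ := h ((map_commutator_eq_isometrySU hp).le ⟨V, hV, rfl⟩)
  replace hqW : q W = 1 := hqW
  refine ⟨W⁻¹ * V, ⟨Subgroup.mul_mem _ (Subgroup.inv_mem _ hW) hV, ?_⟩, by simp [hqW]⟩
  change p (W⁻¹ * V) = 1
  simp [hpW]

/-- A unitary that commutes with `SU(F)` modulo scalars is a scalar. -/
theorem mem_scalars_of_commutator_mem (hF : 2 ≤ Module.finrank ℂ F) {v : F ≃ₗᵢ[ℂ] F}
    (h : ∀ w ∈ isometrySU F, v * w * v⁻¹ * w⁻¹ ∈ scalars F) : v ∈ scalars F := by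
  obtain ⟨z, hz⟩ := exists_circle_of_norm Complex.norm_I
  refine mem_scalars_of_parallel v fun ξ => ?_
  by_cases hξ : ξ = 0
  · exact ⟨0, by simp [hξ]⟩
  set y : F := ((‖ξ‖ : ℂ)⁻¹) • ξ with hydef
  have hn : (‖ξ‖ : ℂ) ≠ 0 := by simpa using hξ
  have hy : ‖y‖ = 1 := by
    rw [hydef, norm_smul, norm_inv, Complex.norm_real, norm_norm, inv_mul_cancel₀]
    simpa using hξ
  have hξy : ξ = (‖ξ‖ : ℂ) • y := by rw [hydef, smul_smul, mul_inv_cancel₀ hn, one_smul]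
  -- The quarter turn about `y` has nonzero trace, so commuting with it modulo scalars is commuting;
  -- the phase making it special drops out of the commutator.
  obtain ⟨t, ht⟩ := exists_phase_mul_mem_isometrySU (crefl y z)
  have h1 := h _ ht
  have h2 : v * (phase t * crefl y z) * v⁻¹ * (phase t * crefl y z)⁻¹ =
      v * crefl y z * v⁻¹ * (crefl y z)⁻¹ := by
    ext ξ
    simp only [mul_inv_rev, isometry_mul_apply]
    have : ∀ η : F, phase t η = (t : ℂ) • η := fun η => rfl
    rw [this, map_smul, ← map_smul, ← map_smul, ← map_smul, ← map_smul, ← this, isometry_apply_inv_apply]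
  rw [h2] at h1
  have h3 := commute_of_commutator_mem_scalars h1 (trace_crefl_ne_zero hF hy (by
    rw [hz]; intro h; simpa using congrArg Complex.im h))
  have h4 := apply_eq_smul_of_commute hy (by
    rintro rfl; simpa using congrArg Complex.im hz) h3
  refine ⟨inner ℂ y (v y), ?_⟩
  conv_lhs => rw [hξy, map_smul, h4, smul_comm, ← hξy]

/-- If `p V` is scalar, every commutator of `V` with `T` is killed by `p` and so acts by a scalar
under `q`. Thus `q V` commutes with `SU(F)` modulo scalars. This carries the hypothesis from `[T,T]`
to `T`. -/
theorem scalars_of_kernel_scalars (hF : 2 ≤ Module.finrank ℂ F) (hq : isometrySU F ≤ T.map q)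
    (h : ∀ V ∈ ⁅T, T⁆, p V = 1 → q V ∈ scalars F) {V : Γ} (hV : V ∈ T)
    (hpV : p V ∈ scalars E) : q V ∈ scalars F := by
  refine mem_scalars_of_commutator_mem hF fun w hw => ?_
  obtain ⟨W, hW, rfl⟩ := hq hw
  have h1 : p (V * W * V⁻¹ * W⁻¹) = 1 := by
    rw [map_mul, map_mul, map_mul, (commute_of_mem_scalars hpV _).eq, map_inv, map_inv]
    simp
  have h2 := h _ (Subgroup.commutator_mem_commutator hV hW) h1
  change q (V * W * V⁻¹ * W⁻¹) ∈ _ at h2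
  simpa using h2

/-- Adjoining all pairs of scalars makes both coordinate projections onto the full unitary groups.
The ambiguity this introduces disappears on commutators. -/
theorem projectiveCorrespondence_of_kernel_scalars
    (hE : 2 ≤ Module.finrank ℂ E) (hF : 2 ≤ Module.finrank ℂ F)
    (hp : isometrySU E ≤ T.map p) (hq : isometrySU F ≤ T.map q)
    (h1 : ∀ V ∈ ⁅T, T⁆, p V = 1 → q V ∈ scalars F)
    (h2 : ∀ V ∈ ⁅T, T⁆, q V = 1 → p V ∈ scalars E) :
    ProjectiveCorrespondence (T.map (p.prod q) ⊔ (scalars E).prod (scalars F)) where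
  exists_right u := by
    obtain ⟨z, hz⟩ := exists_phase_mul_mem_isometrySU u
    obtain ⟨V, hV, hpV⟩ := hp hz
    refine ⟨q V, Subgroup.mem_sup_of_normal_right.2 ⟨_, ⟨V, hV, rfl⟩, ((phase z)⁻¹, 1),
      ⟨Subgroup.inv_mem _ (phase_mem_scalars z), Subgroup.one_mem _⟩, ?_⟩⟩
    rw [MonoidHom.prod_apply, hpV, Prod.mk_mul_mk, mul_one, (phase_commute z u).eq,
      mul_inv_cancel_right]
  exists_left u := by
    obtain ⟨z, hz⟩ := exists_phase_mul_mem_isometrySU u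
    obtain ⟨V, hV, hqV⟩ := hq hz
    refine ⟨p V, Subgroup.mem_sup_of_normal_right.2 ⟨_, ⟨V, hV, rfl⟩, (1, (phase z)⁻¹),
      ⟨Subgroup.one_mem _, Subgroup.inv_mem _ (phase_mem_scalars z)⟩, ?_⟩⟩
    rw [MonoidHom.prod_apply, hqV, Prod.mk_mul_mk, mul_one, (phase_commute z u).eq,
      mul_inv_cancel_right]
  scalar_iff {u v} huv := by
    obtain ⟨_, ⟨V, hV, rfl⟩, ⟨s, t⟩, ⟨hs, ht⟩, he⟩ := Subgroup.mem_sup_of_normal_right.1 huv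
    rw [MonoidHom.prod_apply, Prod.mk_mul_mk, Prod.mk.injEq] at he
    obtain ⟨rfl, rfl⟩ := he
    rw [Subgroup.mul_mem_cancel_right _ hs, Subgroup.mul_mem_cancel_right _ ht]
    exact ⟨scalars_of_kernel_scalars hF hq h1 hV, scalars_of_kernel_scalars hE hp h2 hV⟩
  scalar_mem hu hv := Subgroup.mem_sup_right ⟨hu, hv⟩

/-- The matrix of a unitary in an orthonormal basis, as a homomorphism. -/
def matrixHom {ι : Type*} [Fintype ι] [DecidableEq ι] (b : OrthonormalBasis ι ℂ E) :
    (E ≃ₗᵢ[ℂ] E) →* Matrix ι ι ℂ :=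
  ((LinearMap.toMatrixAlgEquiv b.toBasis : Module.End ℂ E ≃ₐ[ℂ] Matrix ι ι ℂ) :
    Module.End ℂ E →* Matrix ι ι ℂ).comp toEnd

theorem matrixHom_apply {ι : Type*} [Fintype ι] [DecidableEq ι] (b : OrthonormalBasis ι ℂ E)
    (u : E ≃ₗᵢ[ℂ] E) (i j : ι) : matrixHom b u i j = inner ℂ (b i) (u (b j)) := by
  rw [← b.repr_apply_apply]
  exact LinearMap.toMatrixAlgEquiv_apply _ _ _ _

/-- Entrywise complex conjugation of matrices. -/
def matrixConj (ι : Type*) [Fintype ι] [DecidableEq ι] : Matrix ι ι ℂ →* Matrix ι ι ℂ :=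
  ((starRingEnd ℂ).mapMatrix : Matrix ι ι ℂ →+* Matrix ι ι ℂ)

/-- Two homomorphisms whose images contain the special unitary groups are either independent on the
commutator subgroup, or related there by a unitary or an antiunitary. -/
theorem independent_or_implemented (hp : isometrySU E ≤ T.map p) (hq : isometrySU F ≤ T.map q) :
    isometrySU E ≤ (⁅T, T⁆ ⊓ q.ker).map p ∨
    2 ≤ Module.finrank ℂ E ∧ Module.finrank ℂ E = Module.finrank ℂ F ∧
      ∀ {ι : Type} [Fintype ι] [DecidableEq ι] (b : OrthonormalBasis ι ℂ E),
        ∃ f : OrthonormalBasis ι ℂ F,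
          (∀ V ∈ ⁅T, T⁆, matrixHom f (q V) = matrixHom b (p V)) ∨
          (∀ V ∈ ⁅T, T⁆, matrixHom f (q V) = matrixConj ι (matrixHom b (p V))) := by
  rcases isometrySU_le_map_ker_or (q := q) hp with h | ⟨hE, h2⟩
  · exact Or.inl h
  rcases isometrySU_le_map_ker_or (q := p) hq with h | ⟨hF, h1⟩
  · exact Or.inl (isometrySU_le_map_ker_symm hp hq h)
  have hR := projectiveCorrespondence_of_kernel_scalars hE hF hp hq h1 h2
  refine Or.inr ⟨hE, hR.finrank_eq hE hF, fun {ι} _ _ b => ?_⟩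
  obtain ⟨f, hf⟩ := hR.exists_implementing_basis hE hF b
  have hmem : ∀ V ∈ T, (p V, q V) ∈ T.map (p.prod q) ⊔ (scalars E).prod (scalars F) :=
    fun V hV => Subgroup.mem_sup_left ⟨V, hV, rfl⟩
  have hin : ∀ (i k : ι) (a : ℂ) (c : ι → ℂ), inner ℂ (f i) (a • ∑ j, c j • f j) = a * c i := by
    intro i k a c
    rw [inner_smul_right, f.orthonormal.inner_right_fintype]
  refine ⟨f, hf.imp (fun h => ?_) (fun h => ?_)⟩
  · refine eq_on_commutator_of_smul (α := (matrixHom b).comp p) (β := (matrixHom f).comp q)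
      fun V hV => ?_
    obtain ⟨a, ha⟩ := h _ _ (hmem V hV)
    refine ⟨a, ?_⟩
    ext i j
    rw [MonoidHom.comp_apply, matrixHom_apply, ha, hin i i, Matrix.smul_apply, MonoidHom.comp_apply,
      matrixHom_apply, smul_eq_mul]
  · refine eq_on_commutator_of_smul (α := ((matrixConj ι).comp (matrixHom b)).comp p)
      (β := (matrixHom f).comp q) fun V hV => ?_
    obtain ⟨a, ha⟩ := h _ _ (hmem V hV)
    refine ⟨a, ?_⟩
    ext i j
    rw [MonoidHom.comp_apply, matrixHom_apply, ha, hin i i, Matrix.smul_apply, smul_eq_mul]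
    congr 1
    exact congrArg _ (matrixHom_apply b (p V) i j).symm

end PairDichotomy

/-! ### Matrices in orthonormal bases -/

section Matrices

variable {E F : Type*} [NormedAddCommGroup E] [InnerProductSpace ℂ E] [FiniteDimensional ℂ E]
  [NormedAddCommGroup F] [InnerProductSpace ℂ F] [FiniteDimensional ℂ F]
  {ι : Type*} [Fintype ι] [DecidableEq ι]

theorem matrixHom_injective (b : OrthonormalBasis ι ℂ E) : Function.Injective (matrixHom b) :=
  (LinearMap.toMatrixAlgEquiv b.toBasis).injective.comp toEnd_injective

theorem matrixConj_injective : Function.Injective (matrixConj ι) := fun A B h => by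
  ext i j
  exact (starRingEnd ℂ).injective (congrFun (congrFun h i) j)

theorem matrixHom_inv (b : OrthonormalBasis ι ℂ E) (u : E ≃ₗᵢ[ℂ] E) :
    matrixHom b u⁻¹ = (matrixHom b u).conjTranspose := by
  ext i j
  rw [Matrix.conjTranspose_apply, matrixHom_apply, matrixHom_apply, ← u.inner_map_map,
    isometry_apply_inv_apply]
  exact (inner_conj_symm _ _).symm

theorem det_matrixHom (b : OrthonormalBasis ι ℂ E) (u : E ≃ₗᵢ[ℂ] E) :
    (matrixHom b u).det = LinearMap.det (toEnd u) :=
  LinearMap.det_toMatrix b.toBasis _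

theorem matrixHom_mem_specialUnitaryGroup (b : OrthonormalBasis ι ℂ E) {u : E ≃ₗᵢ[ℂ] E} :
    matrixHom b u ∈ Matrix.specialUnitaryGroup ι ℂ ↔ u ∈ isometrySU E := by
  rw [Matrix.mem_specialUnitaryGroup_iff, mem_isometrySU, det_matrixHom, and_iff_right_iff_imp]
  intro _
  rw [Matrix.mem_unitaryGroup_iff, Matrix.star_eq_conjTranspose, ← matrixHom_inv, ← map_mul,
    mul_inv_cancel, map_one]

theorem exists_matrixHom_eq (b : OrthonormalBasis ι ℂ E) {A : Matrix ι ι ℂ}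
    (hA : A ∈ Matrix.unitaryGroup ι ℂ) : ∃ u, matrixHom b u = A := by
  have hin : ∀ i j, inner ℂ (b i) (∑ k, A k j • b k) = (A i j : ℂ) := fun i j =>
    b.orthonormal.inner_right_fintype _ _
  obtain ⟨f, hf⟩ := exists_orthonormalBasis_eq (f := fun j => ∑ i, A i j • b i)
    (orthonormal_iff_ite.2 fun i j => by
      have h := congrFun (congrFun (Matrix.mem_unitaryGroup_iff'.1 hA) i) j
      rw [Matrix.mul_apply, Matrix.one_apply] at h
      rw [sum_inner, ← h]
      refine Finset.sum_congr rfl fun k _ => ?_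
      rw [inner_smul_left, hin]
      rfl) (Module.finrank_eq_card_basis b.toBasis)
  refine ⟨b.equiv f (Equiv.refl ι), ?_⟩
  ext i j
  rw [matrixHom_apply, OrthonormalBasis.equiv_apply_basis, Equiv.refl_apply, hf, hin]

/-- A change of orthonormal basis is conjugation by a special unitary matrix. -/
theorem exists_specialUnitary_conj (b f : OrthonormalBasis ι ℂ E) :
    ∃ W ∈ Matrix.specialUnitaryGroup ι ℂ, ∀ u,
      matrixHom b u = W * matrixHom f u * W.conjTranspose := by
  -- A phase brings the change of basis to determinant 1 and cancels in the conjugation.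
  obtain ⟨z, hz⟩ := exists_phase_mul_mem_isometrySU (b.equiv f (Equiv.refl ι))
  set w := phase z * b.equiv f (Equiv.refl ι) with hw
  refine ⟨matrixHom b w, (matrixHom_mem_specialUnitaryGroup b).2 hz, fun u => ?_⟩
  have h : matrixHom f u = matrixHom b (w⁻¹ * u * w) := by
    have hz : phase z * u * (phase z)⁻¹ = u := by
      rw [(phase_commute z u).eq, mul_inv_cancel_right]
    have hu : w⁻¹ * u * w = (b.equiv f (Equiv.refl ι))⁻¹ * u * b.equiv f (Equiv.refl ι) := by
      rw [hw, mul_inv_rev]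
      nth_rw 1 [← hz]
      group
    ext i j
    rw [hu, matrixHom_apply, matrixHom_apply, isometry_mul_apply, isometry_mul_apply,
      ← (b.equiv f (Equiv.refl ι)).inner_map_map (b i), isometry_apply_inv_apply,
      OrthonormalBasis.equiv_apply_basis, OrthonormalBasis.equiv_apply_basis]
    rfl
  rw [h, ← matrixHom_inv, ← map_mul, ← map_mul]
  congr 1
  group

end Matrices

/-! ### Equality of kernels as the equivalence of sectors -/

section Kernels

variable {E F : Type*} [NormedAddCommGroup E] [InnerProductSpace ℂ E] [FiniteDimensional ℂ E]
  [NormedAddCommGroup F] [InnerProductSpace ℂ F] [FiniteDimensional ℂ F]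
  {Γ : Type*} [Group Γ] {p : Γ →* (E ≃ₗᵢ[ℂ] E)} {q : Γ →* (F ≃ₗᵢ[ℂ] F)} {T : Subgroup Γ}

theorem finrank_le_one_of_isometrySU_eq_bot (h : isometrySU E = ⊥) :
    Module.finrank ℂ E ≤ 1 := by
  by_contra! hE
  obtain ⟨g, hg, k, hk, hn⟩ := exists_commutator_not_scalar (E := E) hE
  rw [h, Subgroup.mem_bot] at hg hk
  exact hn (by simpa [hg, hk] using Subgroup.one_mem _)

theorem isometrySU_eq_bot_of_ker_le (hq : ⁅T, T⁆ ⊓ q.ker ≤ ⁅T, T⁆ ⊓ p.ker)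
    (h : isometrySU E ≤ (⁅T, T⁆ ⊓ q.ker).map p) : isometrySU E = ⊥ := by
  rw [eq_bot_iff]
  refine h.trans ((Subgroup.map_mono (hq.trans inf_le_right)).trans ?_)
  rintro _ ⟨V, hV, rfl⟩
  exact hV

/-- Independence is compatible with equal kernels only if both special unitary groups are trivial.
Then both spaces are one-dimensional, `[T,T]` acts trivially on them, and any basis serves. -/
theorem exists_basis_of_ker_eq [Nontrivial E] [Nontrivial F]
    (hp : isometrySU E ≤ T.map p) (hq : isometrySU F ≤ T.map q)
    (hker : ⁅T, T⁆ ⊓ p.ker = ⁅T, T⁆ ⊓ q.ker) :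
    Module.finrank ℂ E = Module.finrank ℂ F ∧
      ∀ {ι : Type} [Fintype ι] [DecidableEq ι] (b : OrthonormalBasis ι ℂ E),
        ∃ f : OrthonormalBasis ι ℂ F,
          (∀ V ∈ ⁅T, T⁆, matrixHom f (q V) = matrixHom b (p V)) ∨
          (∀ V ∈ ⁅T, T⁆, matrixHom f (q V) = matrixConj ι (matrixHom b (p V))) := by
  rcases independent_or_implemented hp hq with h | ⟨-, h⟩
  · have hE := isometrySU_eq_bot_of_ker_le hker.ge h
    have hF := isometrySU_eq_bot_of_ker_le hker.le (isometrySU_le_map_ker_symm hq hp h)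
    have hdim : Module.finrank ℂ E = Module.finrank ℂ F := by
      have h1 := finrank_le_one_of_isometrySU_eq_bot hE
      have h2 := finrank_le_one_of_isometrySU_eq_bot hF
      have h3 := Module.finrank_pos (R := ℂ) (M := E)
      have h4 := Module.finrank_pos (R := ℂ) (M := F)
      omega
    refine ⟨hdim, fun {ι} _ _ b => ?_⟩
    let f := (stdOrthonormalBasis ℂ F).reindex (Fintype.equivOfCardEq (β := ι) (by
      rw [Fintype.card_fin, ← hdim, Module.finrank_eq_card_basis b.toBasis]))
    refine ⟨f, Or.inl fun V hV => ?_⟩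
    have h1 : p V ∈ (⊥ : Subgroup (E ≃ₗᵢ[ℂ] E)) :=
      hE ▸ (map_commutator_eq_isometrySU hp).le ⟨V, hV, rfl⟩
    have h2 : q V ∈ (⊥ : Subgroup (F ≃ₗᵢ[ℂ] F)) :=
      hF ▸ (map_commutator_eq_isometrySU hq).le ⟨V, hV, rfl⟩
    rw [Subgroup.mem_bot] at h1 h2
    rw [h1, h2, map_one, map_one]
  · exact h

/-- A unitary or antiunitary relation on `[T,T]` would make the two kernels equal, so only
independence remains. -/
theorem isometrySU_le_map_ker_of_ne (hp : isometrySU E ≤ T.map p) (hq : isometrySU F ≤ T.map q)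
    (hker : ⁅T, T⁆ ⊓ p.ker ≠ ⁅T, T⁆ ⊓ q.ker) : isometrySU E ≤ (⁅T, T⁆ ⊓ q.ker).map p := by
  refine (independent_or_implemented hp hq).resolve_right fun ⟨_, _, h⟩ => hker ?_
  obtain ⟨f, hf⟩ := h (stdOrthonormalBasis ℂ E)
  have key : ∀ V ∈ ⁅T, T⁆, p V = 1 ↔ q V = 1 := by
    intro V hV
    rw [← (matrixHom_injective f).eq_iff, ← (matrixHom_injective (stdOrthonormalBasis ℂ E)).eq_iff,
      map_one, map_one]
    rcases hf with hf | hf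
    · rw [hf V hV]
    · rw [hf V hV, ← matrixConj_injective.eq_iff, map_one]
  ext V
  simp only [Subgroup.mem_inf, MonoidHom.mem_ker]
  exact and_congr_right fun hV => key V hV

end Kernels

/-- A function on a finite type factors through an enumeration of its fibres. -/
theorem exists_enumeration_of_fibres {Λ α : Type*} [Finite Λ] (κ : Λ → α) :
    ∃ (s : ℕ) (cls : Λ → Fin s), Function.Surjective cls ∧
      ∀ l l', cls l = cls l' ↔ κ l = κ l' := by
  obtain ⟨s, ⟨e⟩⟩ := Finite.exists_equiv_fin (Set.range κ)
  refine ⟨s, fun l => e ⟨κ l, l, rfl⟩, fun r => ?_, fun l l' => ?_⟩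
  · obtain ⟨⟨_, l, rfl⟩, h⟩ := e.surjective r
    exact ⟨l, h⟩
  · exact e.injective.eq_iff.trans Subtype.ext_iff

/-! ### The projections onto sectors, and continuity -/

namespace IsotypicDecomposition

variable {G : Type*} [Group G] {H : Type*} [NormedAddCommGroup H]
  [InnerProductSpace ℂ H] [CompleteSpace H] {U : G →* unitary (H →L[ℂ] H)}
  {Λ : Type*} [Fintype Λ] {Q M : Λ → Type*}
  [∀ l, NormedAddCommGroup (Q l)] [∀ l, InnerProductSpace ℂ (Q l)] [∀ l, CompleteSpace (Q l)]
  [∀ l, FiniteDimensional ℂ (Q l)]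
  [∀ l, NormedAddCommGroup (M l)] [∀ l, InnerProductSpace ℂ (M l)] [∀ l, CompleteSpace (M l)]
  [∀ l, FiniteDimensional ℂ (M l)]

/-- The homomorphism `π_l` with values in isometric automorphisms. -/
def isometryProj (D : IsotypicDecomposition U Λ Q M) (l : Λ) :
    invariantUnitaries U →* (M l ≃ₗᵢ[ℂ] M l) :=
  (Unitary.linearIsometryEquiv : unitary (M l →L[ℂ] M l) ≃* _).toMonoidHom.comp (D.proj l)

theorem iso_isometryProj (D : IsotypicDecomposition U Λ Q M) (l : Λ) (V : invariantUnitaries U)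
    (x : H) : D.iso ((V.1 : H →L[ℂ] H) x) l =
      (toEnd (D.isometryProj l V)).lTensor (Q l) (D.iso x l) := by
  rw [iso_component, ContinuousLinearMap.lTensor_apply]
  rfl

theorem unitaryMatrix_proj (D : IsotypicDecomposition U Λ Q M) (l : Λ) {m : ℕ}
    (b : OrthonormalBasis (Fin m) ℂ (M l)) (V : invariantUnitaries U) :
    unitaryMatrix b (D.proj l V) = matrixHom b (D.isometryProj l V) := rfl

theorem isometrySU_le_map (D : IsotypicDecomposition U Λ Q M)
    {T : Subgroup (invariantUnitaries U)} (hT : SubsystemUniversal D T) (l : Λ) :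
    isometrySU (M l) ≤ T.map (D.isometryProj l) := by
  intro u hu
  have h : Unitary.linearIsometryEquiv.symm u ∈ specialUnitary (M l) := hu
  obtain ⟨V, hV, h⟩ := hT l h
  refine ⟨V, hV, ?_⟩
  change Unitary.linearIsometryEquiv (D.proj l V) = u
  rw [h, MulEquiv.apply_symm_apply]

theorem eq_one_of_isometryProj (D : IsotypicDecomposition U Λ Q M) {V : invariantUnitaries U}
    (h : ∀ l, D.isometryProj l V = 1) : V = 1 := by
  apply Subtype.ext
  apply Subtype.ext
  ext x
  apply D.iso.injective
  ext l
  rw [iso_isometryProj, h, map_one]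
  exact congrArg (fun f => f (D.iso x l)) (LinearMap.lTensor_id (Q l) (M l))

/-- For a unit vector `q` of `Q l`, the entries of the matrix of `π_l V` are matrix coefficients of
`V` at the vectors `q ⊗ b j`. -/
theorem continuous_matrixHom_isometryProj (D : IsotypicDecomposition U Λ Q M) (l : Λ)
    {ι : Type*} [Fintype ι] [DecidableEq ι] (b : OrthonormalBasis ι ℂ (M l)) :
    Continuous fun V => matrixHom b (D.isometryProj l V) := by
  classical
  obtain ⟨q, hq⟩ := D.exists_unit l
  refine continuous_matrix fun i j => ?_
  have h : ∀ V : invariantUnitaries U, matrixHom b (D.isometryProj l V) i j =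
      inner ℂ (q ⊗ₜ[ℂ] b i)
        (D.iso ((V.1 : H →L[ℂ] H) (D.iso.symm (PiLp.single 2 l (q ⊗ₜ b j)))) l) := by
    intro V
    rw [iso_isometryProj, LinearIsometryEquiv.apply_symm_apply, matrixHom_apply]
    simp [hq, TensorProduct.inner_tmul]
  simp only [h]
  have h1 : Continuous fun V : invariantUnitaries U =>
      (V.1 : H →L[ℂ] H) (D.iso.symm (PiLp.single 2 l (q ⊗ₜ b j))) := by fun_prop
  exact continuous_const.inner ((PiLp.continuous_apply 2 _ l).comp (D.iso.continuous.comp h1))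

/-- A family of invariant unitaries is continuous if all its components have continuous matrices. -/
theorem continuous_of_matrixHom [FiniteDimensional ℂ H] (D : IsotypicDecomposition U Λ Q M)
    {X : Type*} [TopologicalSpace X] {φ : X → invariantUnitaries U}
    (h : ∀ l, ∃ (m : ℕ) (b : OrthonormalBasis (Fin m) ℂ (M l)),
      Continuous fun x => matrixHom b (D.isometryProj l (φ x))) : Continuous φ := by
  rw [continuous_induced_rng, continuous_induced_rng]
  -- As `H` is finite-dimensional, continuity in operator norm is pointwise continuity.
  refine continuous_clm_apply.2 fun ξ => ?_
  have h1 : Continuous fun x => D.iso (((φ x).1 : H →L[ℂ] H) ξ) := by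
    refine (PiLp.continuous_toLp 2 _).comp
      (f := fun x l => D.iso (((φ x).1 : H →L[ℂ] H) ξ) l) (continuous_pi fun l => ?_)
    obtain ⟨m, b, hb⟩ := h l
    let L : Matrix (Fin m) (Fin m) ℂ →ₗ[ℂ] Q l ⊗[ℂ] M l :=
      (LinearMap.applyₗ (D.iso ξ l)) ∘ₗ (LinearMap.lTensorHom (Q l)) ∘ₗ
        (LinearMap.toMatrixAlgEquiv b.toBasis).symm.toLinearMap
    have hL : Continuous L := L.continuous_of_finiteDimensional
    refine (hL.comp hb).congr fun x => ?_
    rw [iso_isometryProj]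
    change LinearMap.lTensor (Q l) ((LinearMap.toMatrixAlgEquiv b.toBasis).symm
      (LinearMap.toMatrixAlgEquiv b.toBasis (toEnd (D.isometryProj l (φ x))))) _ = _
    rw [AlgEquiv.symm_apply_apply]
  exact (D.iso.symm.continuous.comp h1).congr fun x => D.iso.symm_apply_apply _

end IsotypicDecomposition

end

/-! ### Assembly -/

/-- A class `Δ_r` of the partition of `Λ` is the fibre of `cls` over `r`. -/
theorem mainTheorem11 {G : Type*} [Group G] {H : Type*} [NormedAddCommGroup H]
    [InnerProductSpace ℂ H] [CompleteSpace H] [FiniteDimensional ℂ H]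
    (U : G →* unitary (H →L[ℂ] H))
    {Λ : Type*} [Fintype Λ] {Q M : Λ → Type*}
    [∀ l, NormedAddCommGroup (Q l)] [∀ l, InnerProductSpace ℂ (Q l)] [∀ l, CompleteSpace (Q l)]
    [∀ l, FiniteDimensional ℂ (Q l)]
    [∀ l, NormedAddCommGroup (M l)] [∀ l, InnerProductSpace ℂ (M l)] [∀ l, CompleteSpace (M l)]
    [∀ l, FiniteDimensional ℂ (M l)]
    (D : IsotypicDecomposition U Λ Q M) (T : Subgroup (invariantUnitaries U))
    (hT : SubsystemUniversal D T) :
    ∃ (s : ℕ) (cls : Λ → Fin s) (m : Fin s → ℕ),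
      Function.Surjective cls ∧
      (∀ l, Module.finrank ℂ (M l) = m (cls l)) ∧
      Nonempty ((⁅T, T⁆ : Subgroup (invariantUnitaries U)) ≃ₜ*
        (∀ r : Fin s, Matrix.specialUnitaryGroup (Fin (m r)) ℂ)) ∧
      ∀ (r : Fin s) (l l' : Λ), cls l = r → cls l' = r →
        ∀ (b : OrthonormalBasis (Fin (m r)) ℂ (M l)) (b' : OrthonormalBasis (Fin (m r)) ℂ (M l')),
          ∃ W ∈ Matrix.specialUnitaryGroup (Fin (m r)) ℂ,
            (∀ V ∈ ⁅T, T⁆, unitaryMatrix b' (D.proj l' V) =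
              W * unitaryMatrix b (D.proj l V) * W.conjTranspose) ∨
            (∀ V ∈ ⁅T, T⁆, unitaryMatrix b' (D.proj l' V) =
              W * (unitaryMatrix b (D.proj l V)).map (starRingEnd ℂ) * W.conjTranspose) := by
  classical
  have := D.nontrivial_mult
  have hSU := D.isometrySU_le_map hT
  -- Sectors are grouped by the kernel of their projection restricted to `[T,T]`, and one
  -- representative is taken per class.
  obtain ⟨s, cls, hcls, hfib⟩ :=
    exists_enumeration_of_fibres fun l => ⁅T, T⁆ ⊓ (D.isometryProj l).ker
  obtain ⟨rep, hrep⟩ := hcls.hasRightInverse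
  have hsame := fun {l l' : Λ} (h : cls l = cls l') =>
    exists_basis_of_ker_eq (hSU l) (hSU l') ((hfib l l').1 h)
  refine ⟨s, cls, fun r => Module.finrank ℂ (M (rep r)), hcls,
    fun l => (hsame (hrep (cls l)).symm).1, ?_, ?_⟩
  · let b := fun r => stdOrthonormalBasis ℂ (M (rep r))
    have hmem : ∀ r, ∀ V ∈ ⁅T, T⁆, D.isometryProj (rep r) V ∈ isometrySU (M (rep r)) :=
      fun r V hV => (map_commutator_eq_isometrySU (hSU (rep r))).le ⟨V, hV, rfl⟩
    let Φ : (⁅T, T⁆ : Subgroup (invariantUnitaries U)) →*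
        (∀ r : Fin s, Matrix.specialUnitaryGroup (Fin (Module.finrank ℂ (M (rep r)))) ℂ) :=
      { toFun := fun V r => ⟨matrixHom (b r) (D.isometryProj (rep r) V),
          (matrixHom_mem_specialUnitaryGroup (b r)).2 (hmem r V V.2)⟩
        map_one' := by
          ext r : 2
          exact (congrArg _ (map_one _)).trans (map_one _)
        map_mul' := fun V W => by
          ext r : 2
          exact (congrArg _ (map_mul _ _ _)).trans (map_mul _ _ _) }
    have hΦ : ∀ V r, (Φ V r : Matrix _ _ ℂ) = matrixHom (b r) (D.isometryProj (rep r) V) :=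
      fun V r => rfl
    -- Triviality at a representative is triviality throughout its class, since the kernels
    -- coincide.
    have hinj : Function.Injective Φ := by
      refine (injective_iff_map_eq_one Φ).2 fun V hV => Subtype.ext (D.eq_one_of_isometryProj
        fun l => ?_)
      have h1 : D.isometryProj (rep (cls l)) V = 1 := by
        apply matrixHom_injective (b (cls l))
        rw [← hΦ, hV, map_one]
        rfl
      have h2 : V.1 ∈ ⁅T, T⁆ ⊓ (D.isometryProj (rep (cls l))).ker := ⟨V.2, h1⟩
      rw [(hfib _ l).1 (hrep (cls l))] at h2
      exact h2.2
    have hsurj : Function.Surjective Φ := by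
      intro A
      choose a ha using fun r => exists_matrixHom_eq (b r)
        (Matrix.mem_specialUnitaryGroup_iff.1 (A r).2).1
      obtain ⟨V, hV, h⟩ := exists_forall_map_eq (K := ⁅T, T⁆) (N := fun r => isometrySU (M (rep r)))
        (π := fun r => D.isometryProj (rep r)) (fun r => isometrySU_le_commutator)
        (fun r => (map_commutator_eq_isometrySU (hSU (rep r))).ge)
        (fun r r' hr => isometrySU_le_map_ker_of_ne (hSU _) (hSU _) fun h => hr (by
          rw [← hrep r, ← hrep r', (hfib _ _).2 h]))
        (fun r => (map_commutator_eq_isometrySU (hSU (rep r))).le) a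
        (fun r => (matrixHom_mem_specialUnitaryGroup (b r)).1 (by rw [ha]; exact (A r).2))
      refine ⟨⟨V, hV⟩, ?_⟩
      ext r : 2
      rw [hΦ, h, ha]
    let e := MulEquiv.ofBijective Φ ⟨hinj, hsurj⟩
    have he : ∀ A r, matrixHom (b r) (D.isometryProj (rep r) (e.symm A).1) = (A r).1 := by
      intro A r
      rw [← hΦ]
      exact congrArg (fun A => (A r).1) (e.apply_symm_apply A)
    refine ⟨{ e with
      continuous_toFun := continuous_pi fun r => Continuous.subtype_mk
        ((D.continuous_matrixHom_isometryProj (rep r) (b r)).comp continuous_subtype_val) _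
      continuous_invFun := ?_ }⟩
    have hcont : ∀ r, Continuous fun A : (∀ r : Fin s,
        Matrix.specialUnitaryGroup (Fin (Module.finrank ℂ (M (rep r)))) ℂ) => (A r).1 :=
      fun r => continuous_subtype_val.comp (continuous_apply r)
    -- In a suitable basis, the component of the inverse in any sector is the matrix of its class or
    -- the conjugate of that matrix, and both depend continuously on the tuple.
    refine continuous_induced_rng.2 (D.continuous_of_matrixHom fun l => ?_)
    obtain ⟨f, hf⟩ := (hsame (hrep (cls l))).2 (b (cls l))
    refine ⟨_, f, ?_⟩
    rcases hf with hf | hf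
    · refine (hcont (cls l)).congr fun A => ?_
      exact ((hf _ (e.symm A).2).trans (he A (cls l))).symm
    · refine (Continuous.matrix_map (hcont (cls l)) Complex.continuous_conj).congr fun A => ?_
      exact ((hf _ (e.symm A).2).trans (congrArg _ (he A (cls l)))).symm
  · intro r l l' hl hl' b b'
    obtain ⟨f, hf⟩ := (hsame (hl.trans hl'.symm)).2 b
    obtain ⟨W, hW, h⟩ := exists_specialUnitary_conj b' f
    refine ⟨W, hW, hf.imp (fun hf V hV => ?_) (fun hf V hV => ?_)⟩
    · rw [D.unitaryMatrix_proj, D.unitaryMatrix_proj, h, hf V hV]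
    · rw [D.unitaryMatrix_proj, D.unitaryMatrix_proj, h, hf V hV]
      rfl
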